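/- **Definitions.** *Order types.* Two real sequences $(u_i)_{i=1}^p$, $(v_i)_{i=1}^p$ have the same order type if for some real $\varepsilon\neq 0$ one has $u_i<u_j \iff \varepsilon v_i<\varepsilon v_j$ for all $i,j$; an order type $\aleph$ of length $|\aleph|=p$ is an equivalence class of this relation. *Epstein class.* A diffeomorphism $E$ of an open real interval $T'$ onto an open real interval $T$ is in the Epstein class if $E^{-1}:T\to T'$ extends to a univalent (holomorphic and injective) map $(\mathbb C\setminus\mathbb R)\cup T\to(\mathbb C\setminus\mathbb R)\cup T'$. The inverse of this extension continues $E$ analytically to the range of the extension, and is again denoted by $E$. *EW-class.* Let $\aleph$ be an order type of length $p$. A $C^\infty$ unimodal map $H:[0,1]\to[0,1]$, strictly decreasing on $[0,x_0]$ and strictly increasing on $[x_0,1]$ for some $x_0\in(0,1)$, with $H(x_0)=0$, $H(0)=1$, and such that $x_0,H(x_0),\dots,H^{p-1}(x_0)$ has order type $\aleph$, belongs to the Eckmann-Wittwer class (EW-class) with combinatorial type $\aleph$ if: 1. there is $\tau>1$ with $\tau H^p(x)=H(\tau x)$ for all $0\le x\le\tau^{-1}$; 2. $H$ has an analytic continuation,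 also denoted by $H$, to the union of two topological disks $U_-$ and $U_+$; 3. for some $R>1$, $H$ restricted to either of $U_-$, $U_+$ is an unbranched covering of $D(0,R)\setminus\{0\}$, and $\overline{U_+\cup U_-}\subset D(0,R)$; 4. there are real $\ell_m\to\infty$ and diffeomorphisms $E_{\ell_m}$ in the Epstein class, defined at $0$ and $1$, with $E_{\ell_m}(0)=1$ and $E_{\ell_m}(1)\in(-1,0)$, such that $H(z)=\lim_{m\to\infty}\left((E_{\ell_m}(z))^2\right)^{\ell_m/2}$ on $U_+\cup U_-$, where $w^{\ell_m/2}$ is the principal branch on $\mathbb C\setminus(-\infty,0]$, and for every compact $K\subset U_+\cup U_-$ the right-hand side is well defined on $K$ for all but finitely many $m$ and converges uniformly on $K$; 5. there are $b_0'<0$ and $1<b_0<R$ with $[b_0',x_0)\subset U_-$, $(x_0,b_0]\subset U_+$, $H(b_0)=H(b_0')=b_0$ and $H'(b_0)>1$; 6. $U_-$ and $U_+$ are symmetric with respect to the real axis, and $\overline{U_-}\cap\overline{U_+}=\{x_0\}$; 7. the map $G(x):=H^{p-1}(\tau^{-1}x)$ fixes $x_0$, and $G^2(x)=x-\epsilon(x-x_0)^3+O(|x-x_0|^4)$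 as $x\to x_0$, for some $\epsilon>0$. Such an $H$ is then a unimodal map of $[b_0',b_0]\supset[0,1]$ into itself with critical point $x_0$. *Wandering intervals.* A nondegenerate interval $J\subset[b_0',b_0]$ is wandering for $H$ if all its forward images $H^n(J)$, $n\ge 0$, avoid the critical point $x_0$, and its $\omega$-limit set $\bigcap_{N}\overline{\bigcup_{n\ge N}H^n(J)}$ is not a periodic orbit. **Proposition.** Let $\aleph$ be any order type and let $H$ be a map in the EW-class with combinatorial type $\aleph$. Then $H$ has no wandering interval in $[b_0',b_0]$; in particular, it has none in $[0,1]$. -/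

import Mathlib

open Set Filter Topology
open scoped ContDiff

noncomputable section

/-- Two real sequences of length `p` have the same order type if they are ordered in the same
way, up to a global reversal of the order (`ε < 0`). -/
def SameOrderType {p : ℕ} (u v : Fin p → ℝ) : Prop :=
  ∃ ε : ℝ, ε ≠ 0 ∧ ∀ i j, u i < u j ↔ ε * v i < ε * v j

theorem SameOrderType.refl {p : ℕ} (u : Fin p → ℝ) : SameOrderType u u :=
  ⟨1, one_ne_zero, fun i j => by simp⟩

theorem SameOrderType.symm {p : ℕ} {u v : Fin p → ℝ} (h : SameOrderType u v) :
    SameOrderType v u := by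
  obtain ⟨ε, hε, h⟩ := h
  refine ⟨ε, hε, fun i j => ?_⟩
  rcases lt_or_gt_of_ne hε with hneg | hpos
  · have := h j i
    rw [mul_lt_mul_left_of_neg hneg] at this
    rw [mul_lt_mul_left_of_neg hneg]
    exact this.symm
  · have := h i j
    rw [mul_lt_mul_iff_right₀ hpos] at this
    rw [mul_lt_mul_iff_right₀ hpos]
    exact this.symm

theorem SameOrderType.trans {p : ℕ} {u v w : Fin p → ℝ} (h : SameOrderType u v)
    (h' : SameOrderType v w) : SameOrderType u w := by
  obtain ⟨ε, hε, h⟩ := h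
  obtain ⟨δ, hδ, h'⟩ := h'
  refine ⟨ε * δ, mul_ne_zero hε hδ, fun i j => ?_⟩
  rw [h i j, mul_assoc, mul_assoc]
  rcases lt_or_gt_of_ne hε with hneg | hpos
  · rw [mul_lt_mul_left_of_neg hneg, mul_lt_mul_left_of_neg hneg]
    exact h' j i
  · rw [mul_lt_mul_iff_right₀ hpos, mul_lt_mul_iff_right₀ hpos]
    exact h' i j

/-- The order-type equivalence relation on sequences of length `p`. -/
def orderTypeSetoid (p : ℕ) : Setoid (Fin p → ℝ) where
  r := SameOrderType
  iseqv := ⟨SameOrderType.refl, SameOrderType.symm, SameOrderType.trans⟩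

/-- Order types of length `p`. -/
def CombinatorialType (p : ℕ) : Type := Quotient (orderTypeSetoid p)

/-- The order type of a sequence of length `p`. -/
def orderTypeOf {p : ℕ} (u : Fin p → ℝ) : CombinatorialType p :=
  Quotient.mk (orderTypeSetoid p) u

/-- The doubly slit plane `(ℂ ∖ ℝ) ∪ T`, for a set `T` of real numbers. -/
def slitDomain (T : Set ℝ) : Set ℂ :=
  {z : ℂ | z.im ≠ 0} ∪ (fun x : ℝ => (x : ℂ)) '' T

/-- A diffeomorphism `E` of an open real interval `T' = source` onto an open real interval
`T = target` that belongs to the Epstein class. It is recorded through the univalent extension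
`inv : (ℂ ∖ ℝ) ∪ T → (ℂ ∖ ℝ) ∪ T'` of its inverse `E⁻¹ : T → T'`. -/
structure EpsteinDiffeo where
  source : Set ℝ
  target : Set ℝ
  isOpen_source : IsOpen source
  isOpen_target : IsOpen target
  ordConnected_source : source.OrdConnected
  ordConnected_target : target.OrdConnected
  nonempty_source : source.Nonempty
  inv : ℂ → ℂ
  differentiableOn_inv : DifferentiableOn ℂ inv (slitDomain target)
  injOn_inv : InjOn inv (slitDomain target)
  mapsTo_inv : MapsTo inv (slitDomain target) (slitDomain source)
  image_inv : inv '' ((fun x : ℝ => (x : ℂ)) '' target) = (fun x : ℝ => (x : ℂ)) '' source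

/-- The domain of the complex analytic continuation of `E`: the range of the extension of `E⁻¹`.
Its real points are exactly those of `E.source`. -/
def EpsteinDiffeo.domain (E : EpsteinDiffeo) : Set ℂ := E.inv '' slitDomain E.target

/-- The complex analytic continuation of `E` to `E.domain` (the values elsewhere are junk). -/
def EpsteinDiffeo.ext (E : EpsteinDiffeo) : ℂ → ℂ :=
  Function.invFunOn E.inv (slitDomain E.target)

/-- An open subset of the plane homeomorphic to the unit disk. -/
def IsTopologicalDisk (U : Set ℂ) : Prop :=
  IsOpen U ∧ Nonempty (U ≃ₜ Metric.ball (0 : ℂ) 1)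

/-- `F` restricts to an (unbranched) covering map from `U` to `V`. -/
def RestrictsToCovering (F : ℂ → ℂ) (U V : Set ℂ) : Prop :=
  ∃ h : MapsTo F U V, IsCoveringMap (h.restrict F U V)

/-- Membership of `H` in the Eckmann-Wittwer class with combinatorial type `A`, together with the
objects that witness it. `H` is a smooth unimodal map of `[0,1]`; `F` is its complex analytic
continuation to `Uminus ∪ Uplus`, and `H` also denotes the restriction of `F` to the real points
of `Uminus ∪ Uplus`. So only the values of `H` at `x₀` and at those points matter. -/
structure EckmannWittwer {p : ℕ} (A : CombinatorialType p) (H : ℝ → ℝ) where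
  /-- the critical point -/
  x₀ : ℝ
  /-- the scaling constant -/
  τ : ℝ
  /-- the analytic continuation of `H` -/
  F : ℂ → ℂ
  Uminus : Set ℂ
  Uplus : Set ℂ
  R : ℝ
  b₀' : ℝ
  b₀ : ℝ
  -- `H` is a smooth unimodal map of `[0,1]` into itself with its minimum at `x₀`
  x₀_mem : x₀ ∈ Ioo (0 : ℝ) 1
  smooth : ContDiffOn ℝ ∞ H (Icc 0 1)
  mapsTo : MapsTo H (Icc 0 1) (Icc 0 1)
  strictAntiOn : StrictAntiOn H (Icc 0 x₀)
  strictMonoOn : StrictMonoOn H (Icc x₀ 1)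
  map_x₀ : H x₀ = 0
  map_zero : H 0 = 1
  orderType_orbit : orderTypeOf (fun i : Fin p => H^[i] x₀) = A
  -- the fixed point equation
  one_lt_τ : 1 < τ
  functional_eq : ∀ x ∈ Icc (0 : ℝ) τ⁻¹, τ * H^[p] x = H (τ * x)
  -- analytic continuation to two topological disks
  disk_minus : IsTopologicalDisk Uminus
  disk_plus : IsTopologicalDisk Uplus
  differentiableOn : DifferentiableOn ℂ F (Uminus ∪ Uplus)
  continuation : ∀ x : ℝ, (x : ℂ) ∈ Uminus ∪ Uplus → F x = H x
  -- coverings of the punctured disk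
  one_lt_R : 1 < R
  covering_minus : RestrictsToCovering F Uminus (Metric.ball 0 R \ {0})
  covering_plus : RestrictsToCovering F Uplus (Metric.ball 0 R \ {0})
  closure_subset : closure (Uplus ∪ Uminus) ⊆ Metric.ball 0 R
  -- `H` is a limit of powers of diffeomorphisms in the Epstein class
  limit : ∃ (ℓ : ℕ → ℝ) (E : ℕ → EpsteinDiffeo), Tendsto ℓ atTop atTop ∧
    (∀ m, (0 : ℝ) ∈ (E m).source ∧ (1 : ℝ) ∈ (E m).source ∧ (E m).ext 0 = 1 ∧
      ∃ y ∈ Ioo (-1 : ℝ) 0, (E m).ext 1 = (y : ℂ)) ∧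
    ∀ K : Set ℂ, IsCompact K → K ⊆ Uplus ∪ Uminus →
      (∀ᶠ m in atTop, K ⊆ (E m).domain ∧ ∀ z ∈ K, ((E m).ext z) ^ 2 ∈ Complex.slitPlane) ∧
      TendstoUniformlyOn (fun m z => (((E m).ext z) ^ 2) ^ ((ℓ m / 2 : ℝ) : ℂ)) F atTop K
  -- the real traces of the two disks
  Ico_subset : ∀ x ∈ Ico b₀' x₀, (x : ℂ) ∈ Uminus
  Ioc_subset : ∀ x ∈ Ioc x₀ b₀, (x : ℂ) ∈ Uplus
  b₀'_neg : b₀' < 0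
  one_lt_b₀ : 1 < b₀
  b₀_lt_R : b₀ < R
  map_b₀ : H b₀ = b₀
  map_b₀' : H b₀' = b₀
  one_lt_deriv : 1 < deriv H b₀
  -- symmetry and position of the two disks
  symm_minus : ∀ z ∈ Uminus, (starRingEnd ℂ) z ∈ Uminus
  symm_plus : ∀ z ∈ Uplus, (starRingEnd ℂ) z ∈ Uplus
  closure_inter : closure Uminus ∩ closure Uplus = {(x₀ : ℂ)}
  -- the map `G x = H^{p-1}(x / τ)` and the expansion of `G ∘ G` at `x₀`
  G_fixed : H^[p - 1] (τ⁻¹ * x₀) = x₀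
  G_expansion : ∃ ε : ℝ, 0 < ε ∧
    (fun x : ℝ => H^[p - 1] (τ⁻¹ * H^[p - 1] (τ⁻¹ * x)) - (x - ε * (x - x₀) ^ 3))
      =O[𝓝 x₀] (fun x : ℝ => |x - x₀| ^ 4)

/-- `J` is a wandering interval of the map `f` of `I` with critical point `c`: a nondegenerate
interval all of whose forward images avoid `c`, and whose `ω`-limit set is not a periodic orbit. -/
structure IsWanderingInterval (f : ℝ → ℝ) (c : ℝ) (I J : Set ℝ) : Prop where
  subset : J ⊆ I
  ordConnected : J.OrdConnected
  nontrivial : J.Nontrivial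
  avoids : ∀ n : ℕ, c ∉ f^[n] '' J
  omegaLimit_ne : ¬ ∃ q ∈ Function.periodicPts f,
    omegaLimit atTop (fun (n : ℕ) x => f^[n] x) J = range (fun n : ℕ => f^[n] q)

end

/-!
The map `H` satisfies more than is claimed: every nondegenerate interval in `[b₀', b₀]` contains a
preimage of the critical point `c = x₀`. Call an open interval without such preimages a
*homterval*; all iterates of `H` are monotone on it. A wandering interval contains one.

*Expansion of cross-ratios.* On real points `H` is a limit of maps `|E| ^ ℓ` with `E` in the Epstein
class. The inverse `w ↦ E⁻¹ (± w ^ (1 / ℓ))` is holomorphic on a slit plane and maps it into a slit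
plane, so by the Schwarz lemma it contracts hyperbolic distances of real points, which are
logarithms of cross-ratios (`hyperbolic_contraction_of_mapsTo_slitDomain`). Hence `H` expands
cross-ratios on each lap, and so does every iterate on intervals where it is monotone. From here on
only the real data collected in `IsSelfSimilarUnimodal` are used.

*Self-similarity.* Put `I n = [0, τ ^ (-n)]`. Then `H^[p ^ n]` on `I n` is a scaled copy of `H` on
`[0, 1]`, so the critical value `0` satisfies `H^[p ^ n] 0 = τ ^ (-n)`; it is recurrent and not
preperiodic.

*No homterval returns to itself, even after rescaling.* Let `h = τ ^ m H^[s]` with `s ≥ 1` map a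
maximal homterval `(a, b)` into itself, increasingly after passing to `h ∘ h`. No point of `[a, b]`
is precritical, because the critical point would then be periodic. By maximality `h` fixes `a` and
`b`, and these fixed points attract no full neighbourhood. Together with the expansion of
cross-ratios this makes `h` the identity on `(a, b)`, by analyticity also near `a`, which
contradicts maximality (`not_mapsTo_of_strictMonoOn`). The case `m = 0` shows that `I n` returns to
itself only at multiples of `p ^ n` (`returnTimes`), which is needed for `m > 0`
(`rescaledIterate_notMem`).

*Recurrence.* Let `w` lie in a homterval `J`. If the orbit of `w` stayed out of some `I n`, it would
stay away from the orbit of `0` and leave a neighbourhood of the repelling point `b₀` infinitely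
often, so infinitely many monotone branches `H^[k]` around `J` would have definite space around `H^[k] w`;
expansion of cross-ratios would give these `H^[k] J` a definite size, and two of them would overlap.
So the orbit of `w` enters every `I n`. At the first entry into `I n` at a point outside `I (n + 1)`
the branch covers a definite neighbourhood of the image point at scale `τ ^ (-n)`
(`exists_entry_space`), so the rescaled images `τ ^ n H^[k] J ⊆ [0, 1]` have a definite size. Two of
them overlap, and then a rescaled iterate takes a point of a homterval back into that homterval.
-/

/-! ### The Schwarz lemma on slit planes -/

/-- The Schwarz–Pick inequality for the right half-plane, at two points of the positive real axis
that are mapped to real points. -/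
theorem abs_sub_mul_add_le_of_mapsTo_halfPlane {φ : ℂ → ℂ}
    (hd : DifferentiableOn ℂ φ {z | 0 < z.re}) (hm : MapsTo φ {z | 0 < z.re} {z | 0 < z.re})
    {s t s' t' : ℝ} (hs : 0 < s) (ht : 0 < t) (hφs : φ s = s') (hφt : φ t = t') :
    |t' - s'| * (t + s) ≤ |t - s| * (t' + s') := by
  have hs' : 0 < s' := by
    have := hm (show (s : ℂ) ∈ {z : ℂ | 0 < z.re} by simpa using hs)
    simpa [hφs] using this
  have ht' : 0 < t' := by
    have := hm (show (t : ℂ) ∈ {z : ℂ | 0 < z.re} by simpa using ht)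
    simpa [hφt] using this
  -- Conjugate to the unit disk by Cayley transforms sending `s`, respectively `s'`, to `0`.
  set c : ℂ → ℂ := fun w => s * (1 + w) / (1 - w) with hc
  have hne : ∀ w ∈ Metric.ball (0 : ℂ) 1, 1 - w ≠ 0 := by
    intro w hw h
    have : w = 1 := by linear_combination -h
    simp [this] at hw
  have hcm : MapsTo c (Metric.ball 0 1) {z | 0 < z.re} := by
    intro w hw
    have hn : w.re ^ 2 + w.im ^ 2 < 1 := by
      have h1 : ‖w‖ < 1 := by simpa using hw
      have h2 : ‖w‖ ^ 2 < 1 := by nlinarith [norm_nonneg w]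
      rwa [Complex.sq_norm, Complex.normSq_apply, ← sq, ← sq] at h2
    have hpos : 0 < Complex.normSq (1 - w) := Complex.normSq_pos.2 (hne w hw)
    have : (c w).re = s * (1 - w.re ^ 2 - w.im ^ 2) / Complex.normSq (1 - w) := by
      simp only [hc, Complex.div_re, Complex.mul_re, Complex.mul_im, Complex.ofReal_re,
        Complex.ofReal_im, Complex.add_re, Complex.add_im, Complex.sub_re, Complex.sub_im,
        Complex.one_re, Complex.one_im]
      field_simp
      ring
    simp only [mem_ofPred_eq, this]
    exact div_pos (mul_pos hs (by linarith)) hpos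
  have hcd : DifferentiableOn ℂ c (Metric.ball 0 1) := by
    intro w hw
    have := hne w hw
    apply DifferentiableAt.differentiableWithinAt
    simp only [hc]
    fun_prop (disch := assumption)
  have hplus : ∀ z : ℂ, 0 < z.re → z + s' ≠ 0 := by
    intro z hz h
    have := congrArg Complex.re h
    simp at this
    linarith
  set g : ℂ → ℂ := fun w => (φ (c w) - s') / (φ (c w) + s') with hg
  have hφc : DifferentiableOn ℂ (fun w => φ (c w)) (Metric.ball 0 1) := hd.comp hcd hcm
  have hgd : DifferentiableOn ℂ g (Metric.ball 0 1) :=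
    (hφc.sub_const _).div (hφc.add_const _) fun w hw => hplus _ (hm (hcm hw))
  have hgm : MapsTo g (Metric.ball 0 1) (Metric.closedBall 0 1) := by
    intro w hw
    have hz := hm (hcm hw)
    have hz0 : 0 < (φ (c w)).re := hz
    simp only [mem_closedBall_zero_iff, hg, norm_div]
    rw [div_le_one (norm_pos_iff.2 (hplus _ hz))]
    rw [← sq_le_sq₀ (norm_nonneg _) (norm_nonneg _), Complex.sq_norm, Complex.sq_norm,
      Complex.normSq_apply, Complex.normSq_apply]
    simp
    nlinarith
  have hg0 : g 0 = 0 := by simp [hg, hc, hφs]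
  set w : ℂ := (((t - s) / (t + s) : ℝ) : ℂ) with hw
  have hwn : ‖w‖ = |t - s| / (t + s) := by
    rw [hw, Complex.norm_real, Real.norm_eq_abs, abs_div, abs_of_pos (add_pos ht hs)]
  have hw1 : ‖w‖ < 1 := by
    rw [hwn, div_lt_one (by linarith), abs_lt]
    constructor <;> linarith
  have hcw : c w = t := by
    have h1 : ((t : ℂ) + s) ≠ 0 := by exact_mod_cast (add_pos ht hs).ne'
    have h2 : (1 : ℂ) - w ≠ 0 := hne w (by simpa using hw1)
    have h3 : (s : ℂ) ≠ 0 := by exact_mod_cast hs.ne'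
    simp only [hc]
    rw [div_eq_iff h2, hw]
    push_cast
    field_simp
    ring
  have key := Complex.norm_le_norm_of_mapsTo_ball hgd hgm hg0 hw1
  have hgw : ‖g w‖ = |t' - s'| / (t' + s') := by
    simp only [hg, hcw, hφt]
    rw [← Complex.ofReal_sub, ← Complex.ofReal_add, ← Complex.ofReal_div, Complex.norm_real,
      Real.norm_eq_abs, abs_div, abs_of_pos (add_pos ht' hs')]
  rw [hgw, hwn, div_le_div_iff₀ (by linarith) (by linarith)] at key
  exact key

theorem mem_slitDomain_ofReal {T : Set ℝ} {x : ℝ} : (x : ℂ) ∈ slitDomain T ↔ x ∈ T := by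
  simp [slitDomain]

/-- `u ↦ B - (B - A) / (1 + u)` parametrizes the slit plane over `(A, B)` by `ℂ ∖ (-∞, 0]`. -/
theorem slitDomain_Ioo_param {A B : ℝ} (hAB : A < B) {u : ℂ} (hu : u ∈ Complex.slitPlane) :
    1 + u ≠ 0 ∧ B - (B - A) / (1 + u) ∈ slitDomain (Ioo A B) := by
  have hne : 1 + u ≠ 0 := by
    intro h
    have : u = -1 := by linear_combination h
    simp [this, Complex.mem_slitPlane_iff] at hu
    linarith
  refine ⟨hne, ?_⟩
  by_cases him : u.im = 0
  · have hre : 0 < u.re := by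
      rcases hu with h | h
      · exact h
      · exact absurd him h
    right
    refine ⟨B - (B - A) / (1 + u.re), ⟨?_, ?_⟩, ?_⟩
    · have : (B - A) / (1 + u.re) < B - A := by
        rw [div_lt_iff₀ (by linarith)]
        nlinarith
      linarith
    · have : 0 < (B - A) / (1 + u.re) := div_pos (by linarith) (by linarith)
      linarith
    · have : u = (u.re : ℂ) := by
        apply Complex.ext <;> simp [him]
      rw [this]
      push_cast
      simp
  · left
    have : ((B : ℂ) - (B - A) / (1 + u)).im = (B - A) * u.im / Complex.normSq (1 + u) := by
      rw [← Complex.ofReal_sub, Complex.sub_im, Complex.div_im]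
      simp
    simp only [mem_ofPred_eq, this]
    exact div_ne_zero (mul_ne_zero (by linarith) him) (Complex.normSq_pos.2 hne).ne'

/-- `z ↦ (z - a) / (b - z)` maps the slit plane over `(a, b)` into `ℂ ∖ (-∞, 0]`. -/
theorem slitDomain_Ioo_coord {a b : ℝ} (hab : a < b) {z : ℂ} (hz : z ∈ slitDomain (Ioo a b)) :
    b - z ≠ 0 ∧ (z - a) / (b - z) ∈ Complex.slitPlane := by
  rcases hz with hz | ⟨x, ⟨hxa, hxb⟩, rfl⟩
  · have hz : z.im ≠ 0 := hz
    have hne : (b : ℂ) - z ≠ 0 := by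
      intro h
      apply hz
      have := congrArg Complex.im h
      simpa using this
    refine ⟨hne, Or.inr ?_⟩
    have : ((z - a) / (b - z)).im = (b - a) * z.im / Complex.normSq (b - z) := by
      rw [Complex.div_im]
      simp
      ring
    rw [this]
    exact div_ne_zero (mul_ne_zero (by linarith) hz) (Complex.normSq_pos.2 hne).ne'
  · refine ⟨by rw [← Complex.ofReal_sub]; exact_mod_cast (sub_pos.2 hxb).ne', ?_⟩
    rw [← Complex.ofReal_sub, ← Complex.ofReal_sub, ← Complex.ofReal_div,
      Complex.ofReal_mem_slitPlane]
    exact div_pos (sub_pos.2 hxa) (sub_pos.2 hxb)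

theorem sqrt_re_pos {u : ℂ} (hu : u ∈ Complex.slitPlane) : 0 < (u ^ ((1 / 2 : ℝ) : ℂ)).re := by
  rw [Complex.cpow_ofReal_re]
  have h0 : u ≠ 0 := Complex.slitPlane_ne_zero hu
  have h1 := Complex.neg_pi_lt_arg u
  have h2 : u.arg < Real.pi :=
    lt_of_le_of_ne (Complex.arg_le_pi u) (Complex.mem_slitPlane_iff_arg.1 hu).1
  exact mul_pos (Real.rpow_pos_of_pos (norm_pos_iff.2 h0) _)
    (Real.cos_pos_of_mem_Ioo ⟨by linarith, by linarith⟩)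

theorem cpow_im_ne_zero {w : ℂ} (hw : w.im ≠ 0) {ℓ : ℝ} (hℓ : 1 ≤ ℓ) :
    (w ^ ((1 / ℓ : ℝ) : ℂ)).im ≠ 0 := by
  have hℓ0 : 0 < ℓ := by linarith
  have h0 : w ≠ 0 := by
    rintro rfl
    simp at hw
  have harg0 : w.arg ≠ 0 := fun h => hw (Complex.arg_eq_zero_iff.1 h).2
  have hargpi : w.arg ≠ Real.pi := fun h => hw (Complex.arg_eq_pi_iff.1 h).2
  have h1 := Complex.neg_pi_lt_arg w
  have h2 := lt_of_le_of_ne (Complex.arg_le_pi w) hargpi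
  rw [Complex.cpow_ofReal_im]
  refine mul_ne_zero (Real.rpow_pos_of_pos (norm_pos_iff.2 h0) _).ne' ?_
  have h3 : 0 < 1 / ℓ := by positivity
  have h4 : 1 / ℓ ≤ 1 := by rw [div_le_one hℓ0]; exact hℓ
  rw [Ne, Real.sin_eq_zero_iff_of_lt_of_lt]
  · exact mul_ne_zero harg0 h3.ne'
  · nlinarith [Real.pi_pos]
  · nlinarith [Real.pi_pos]

theorem sq_mem_slitPlane {s : ℂ} (hs : 0 < s.re) : s ^ 2 ∈ Complex.slitPlane := by
  rw [Complex.mem_slitPlane_iff, sq, Complex.mul_re, Complex.mul_im]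
  by_cases h : s.im = 0
  · left
    rw [h]
    nlinarith
  · right
    have : s.re * s.im + s.im * s.re = 2 * (s.re * s.im) := by ring
    rw [this]
    exact mul_ne_zero two_ne_zero (mul_ne_zero hs.ne' h)

/-- A holomorphic map between slit planes over bounded intervals does not increase the
hyperbolic distance of real points. With the coordinate `u = (x - a) / (b - x)` on `(a, b)`, the
distance is half of `|log (u₂ / u₁)|`, and the two inequalities bound `u₂ / u₁` and `u₁ / u₂`. -/
theorem hyperbolic_contraction_of_mapsTo_slitDomain {φ : ℂ → ℂ} {A B a b X Y x y : ℝ}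
    (hab : a < b) (hd : DifferentiableOn ℂ φ (slitDomain (Ioo A B)))
    (hm : MapsTo φ (slitDomain (Ioo A B)) (slitDomain (Ioo a b)))
    (hAX : A < X) (hXY : X < Y) (hYB : Y < B) (hX : φ X = x) (hY : φ Y = y) :
    (y - a) / (b - y) * ((X - A) / (B - X)) ≤ (Y - A) / (B - Y) * ((x - a) / (b - x)) ∧
    (x - a) / (b - x) * ((X - A) / (B - X)) ≤ (Y - A) / (B - Y) * ((y - a) / (b - y)) := by
  have hAB : A < B := by linarith
  -- Uniformize both slit planes by the right half-plane.
  set P : ℂ → ℂ := fun s => B - (B - A) / (1 + s ^ 2) with hP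
  set Q : ℂ → ℂ := fun z => ((z - a) / (b - z)) ^ ((1 / 2 : ℝ) : ℂ) with hQ
  have hPm : MapsTo P {z | 0 < z.re} (slitDomain (Ioo A B)) := fun s hs =>
    (slitDomain_Ioo_param hAB (sq_mem_slitPlane hs)).2
  have hPd : DifferentiableOn ℂ P {z | 0 < z.re} := by
    intro s hs
    have := (slitDomain_Ioo_param hAB (sq_mem_slitPlane hs)).1
    apply DifferentiableAt.differentiableWithinAt
    simp only [hP]
    fun_prop (disch := assumption)
  have hQm : MapsTo Q (slitDomain (Ioo a b)) {z | 0 < z.re} := fun z hz =>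
    sqrt_re_pos (slitDomain_Ioo_coord hab hz).2
  have hQd : DifferentiableOn ℂ Q (slitDomain (Ioo a b)) := by
    intro z hz
    obtain ⟨h1, h2⟩ := slitDomain_Ioo_coord hab hz
    apply DifferentiableAt.differentiableWithinAt
    simp only [hQ]
    exact DifferentiableAt.cpow_const (by fun_prop (disch := assumption)) h2
  have hPr : ∀ Z : ℝ, A < Z → Z < B → P (Real.sqrt ((Z - A) / (B - Z)) : ℝ) = Z := by
    intro Z h1 h2
    have h3 : 0 < B - Z := by linarith
    have h4 : 0 ≤ (Z - A) / (B - Z) := (div_pos (by linarith) h3).le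
    simp only [hP]
    rw [← Complex.ofReal_pow, Real.sq_sqrt h4]
    norm_cast
    have : 1 + (Z - A) / (B - Z) = (B - A) / (B - Z) := by field_simp; ring
    rw [this]
    have : B - A ≠ 0 := by linarith
    field_simp
    ring
  have hQr : ∀ z : ℝ, a < z → z < b → Q z = (Real.sqrt ((z - a) / (b - z)) : ℝ) := by
    intro z h1 h2
    have h4 : 0 ≤ (z - a) / (b - z) := (div_pos (by linarith) (by linarith)).le
    simp only [hQ]
    rw [← Complex.ofReal_sub, ← Complex.ofReal_sub, ← Complex.ofReal_div,
      ← Complex.ofReal_cpow h4, Real.sqrt_eq_rpow]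
  have hXm := hm (mem_slitDomain_ofReal.2 (show X ∈ Ioo A B from ⟨hAX, by linarith⟩))
  have hYm := hm (mem_slitDomain_ofReal.2 (show Y ∈ Ioo A B from ⟨by linarith, hYB⟩))
  rw [hX, mem_slitDomain_ofReal] at hXm
  rw [hY, mem_slitDomain_ofReal] at hYm
  have hUX : 0 < (X - A) / (B - X) := div_pos (by linarith) (by linarith)
  have hUY : 0 < (Y - A) / (B - Y) := div_pos (by linarith) (by linarith)
  have hux : 0 < (x - a) / (b - x) := div_pos (by linarith [hXm.1]) (by linarith [hXm.2])
  have huy : 0 < (y - a) / (b - y) := div_pos (by linarith [hYm.1]) (by linarith [hYm.2])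
  have hUXY : (X - A) / (B - X) < (Y - A) / (B - Y) := by
    rw [div_lt_div_iff₀ (by linarith) (by linarith)]
    nlinarith
  have key := abs_sub_mul_add_le_of_mapsTo_halfPlane (φ := fun s => Q (φ (P s)))
    ((hQd.comp hd hm).comp hPd hPm) (fun s hs => hQm (hm (hPm hs)))
    (Real.sqrt_pos.2 hUX) (Real.sqrt_pos.2 hUY)
    (s' := Real.sqrt ((x - a) / (b - x))) (t' := Real.sqrt ((y - a) / (b - y)))
    (by rw [hPr X hAX (by linarith), hX, hQr x hXm.1 hXm.2])
    (by rw [hPr Y (by linarith) hYB, hY, hQr y hYm.1 hYm.2])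
  have e1 := Real.sq_sqrt hUX.le
  have e2 := Real.sq_sqrt hUY.le
  have e3 := Real.sq_sqrt hux.le
  have e4 := Real.sq_sqrt huy.le
  have p1 := Real.sqrt_pos.2 hUX
  have p2 := Real.sqrt_pos.2 hUY
  have p3 := Real.sqrt_pos.2 hux
  have p4 := Real.sqrt_pos.2 huy
  have hlt := Real.sqrt_lt_sqrt hUX.le hUXY
  rw [← e1, ← e2, ← e3, ← e4]
  rw [abs_of_pos (sub_pos.2 hlt)] at key
  generalize Real.sqrt ((X - A) / (B - X)) = S at *
  generalize Real.sqrt ((Y - A) / (B - Y)) = T at *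
  generalize Real.sqrt ((x - a) / (b - x)) = S' at *
  generalize Real.sqrt ((y - a) / (b - y)) = T' at *
  have k1 := (mul_le_mul_of_nonneg_right (le_abs_self (T' - S')) (by linarith : 0 ≤ T + S)).trans
    key
  have k2 := (mul_le_mul_of_nonneg_right (neg_le_abs (T' - S')) (by linarith : 0 ≤ T + S)).trans
    key
  constructor
  · have : T' * S ≤ T * S' := by nlinarith
    have := pow_le_pow_left₀ (by positivity) this 2
    simpa [mul_pow] using this
  · have : S' * S ≤ T * T' := by nlinarith
    have := pow_le_pow_left₀ (by positivity) this 2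
    simpa [mul_pow] using this

/-! ### The cross-ratio of four real points -/

/-- The cross-ratio of the points `x`, `y` of the interval with endpoints `a`, `b`. For
`a < x < y < b`, as for `b < y < x < a`, it exceeds `1`, and its logarithm is the hyperbolic
distance of `x` and `y` in that interval. -/
noncomputable def crossRatio (a x y b : ℝ) : ℝ := (y - a) * (b - x) / ((x - a) * (b - y))

theorem crossRatio_reverse (a x y b : ℝ) : crossRatio b y x a = crossRatio a x y b := by
  unfold crossRatio
  congr 1 <;> ring

theorem crossRatio_const_mul {t : ℝ} (ht : t ≠ 0) (a x y b : ℝ) :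
    crossRatio (t * a) (t * x) (t * y) (t * b) = crossRatio a x y b := by
  unfold crossRatio
  rw [show (t * y - t * a) * (t * b - t * x) = (t * t) * ((y - a) * (b - x)) by ring,
    show (t * x - t * a) * (t * b - t * y) = (t * t) * ((x - a) * (b - y)) by ring,
    mul_div_mul_left _ _ (mul_ne_zero ht ht)]

theorem crossRatio_neg (a x y b : ℝ) :
    crossRatio (-a) (-x) (-y) (-b) = crossRatio a x y b := by
  simpa using crossRatio_const_mul (t := -1) (by norm_num) a x y b

theorem crossRatio_sub_one {a x y b : ℝ} (hx : x ≠ a) (hy : y ≠ b) :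
    crossRatio a x y b - 1 = (y - x) * (b - a) / ((x - a) * (b - y)) := by
  unfold crossRatio
  have h1 : x - a ≠ 0 := sub_ne_zero.2 hx
  have h2 : b - y ≠ 0 := sub_ne_zero.2 hy.symm
  field_simp
  ring

theorem Filter.Tendsto.crossRatio {α : Type*} {l : Filter α} {a x y b : α → ℝ} {a' x' y' b' : ℝ}
    (ha : Tendsto a l (𝓝 a')) (hx : Tendsto x l (𝓝 x')) (hy : Tendsto y l (𝓝 y'))
    (hb : Tendsto b l (𝓝 b')) (hxa : x' ≠ a') (hyb : y' ≠ b') :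
    Tendsto (fun i => _root_.crossRatio (a i) (x i) (y i) (b i)) l
      (𝓝 (_root_.crossRatio a' x' y' b')) :=
  ((hy.sub ha).mul (hb.sub hx)).div ((hx.sub ha).mul (hb.sub hy))
    (mul_ne_zero (sub_ne_zero.2 hxa) (sub_ne_zero.2 hyb.symm))

/-- Space on both sides of `w` prevents `x` from coming close to `w`, as long as the cross-ratio
stays away from `1`. -/
theorem le_abs_sub_of_crossRatio {A X W B δ κ : ℝ}
    (h : (A < X ∧ X < W ∧ W < B) ∨ (B < W ∧ W < X ∧ X < A)) (hκ1 : κ ≤ 1)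
    (hA : δ ≤ |W - A|) (hB : δ ≤ |B - W|) (hδ : 0 < δ) (hcr : κ ≤ crossRatio A X W B - 1) :
    κ * δ / 4 ≤ |W - X| := by
  wlog hord : A < X ∧ X < W ∧ W < B generalizing A X W B
  · have h' := h.resolve_left hord
    have := this (A := -A) (X := -X) (W := -W) (B := -B)
      (Or.inl ⟨by linarith, by linarith, by linarith⟩)
      (by rwa [show -W - -A = -(W - A) by ring, abs_neg])
      (by rwa [show -B - -W = -(B - W) by ring, abs_neg])
      (by rwa [crossRatio_neg]) ⟨by linarith, by linarith, by linarith⟩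
    rwa [show -W - -X = -(W - X) by ring, abs_neg] at this
  obtain ⟨h1, h2, h3⟩ := hord
  rw [crossRatio_sub_one h1.ne' h3.ne, le_div_iff₀ (mul_pos (by linarith) (by linarith))] at hcr
  rw [abs_of_pos (by linarith)] at hA hB ⊢
  by_contra! hlt
  set p := W - X
  set q := X - A
  set r := B - W
  have hp : 0 < p := by simp only [p]; linarith
  have e1 : W - A = p + q := by simp only [p, q]; ring
  have e2 : B - A = p + q + r := by simp only [p, q, r]; ring
  rw [e1] at hA
  rw [e2] at hcr
  have hp4 : p < δ / 4 := by nlinarith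
  have hq : 3 / 4 * δ ≤ q := by linarith
  -- with `q, r ≥ 3 δ / 4` one has `p + q + r ≤ (4 / δ) q r`, so `κ ≤ 4 p / δ`
  have h5 : (p + q + r) * δ < 4 * (q * r) := by nlinarith
  have hqr : 0 < q * r := mul_pos (by linarith) (by linarith)
  nlinarith [mul_lt_mul_of_pos_left h5 hp, mul_lt_mul_of_pos_right hlt hqr]

/-! ### Real traces of Epstein diffeomorphisms -/

namespace EpsteinDiffeo

variable (E : EpsteinDiffeo)

theorem ext_inv {w : ℂ} (hw : w ∈ slitDomain E.target) : E.ext (E.inv w) = w :=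
  E.injOn_inv.leftInvOn_invFunOn hw

theorem exists_inv_eq {x : ℝ} (hx : x ∈ E.source) :
    ∃ t ∈ E.target, E.inv (t : ℂ) = x ∧ E.ext x = t := by
  have : (x : ℂ) ∈ E.inv '' ((fun x : ℝ => (x : ℂ)) '' E.target) := by
    rw [E.image_inv]; exact ⟨x, hx, rfl⟩
  obtain ⟨_, ⟨t, ht, rfl⟩, h⟩ := this
  refine ⟨t, ht, h, ?_⟩
  have := E.ext_inv (mem_slitDomain_ofReal.2 ht)
  rwa [h] at this

theorem exists_inv_ofReal {t : ℝ} (ht : t ∈ E.target) :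
    ∃ x ∈ E.source, E.inv (t : ℂ) = x := by
  have : E.inv (t : ℂ) ∈ (fun x : ℝ => (x : ℂ)) '' E.source := by
    rw [← E.image_inv]; exact ⟨_, ⟨t, ht, rfl⟩, rfl⟩
  obtain ⟨x, hx, h⟩ := this
  exact ⟨x, hx, h.symm⟩

theorem mem_source_of_mem_domain {x : ℝ} (hx : (x : ℂ) ∈ E.domain) : x ∈ E.source := by
  obtain ⟨w, hw, h⟩ := hx
  have := E.mapsTo_inv hw
  rwa [h, mem_slitDomain_ofReal] at this

/-- The extension of `E⁻¹` maps non-real points to non-real points: a real value would already be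
taken on the real target interval. -/
theorem inv_im_ne_zero {w : ℂ} (hw : w.im ≠ 0) : (E.inv w).im ≠ 0 := by
  intro h
  have hwT : w ∈ slitDomain E.target := Or.inl hw
  have hr : E.inv w = ((E.inv w).re : ℂ) := by
    apply Complex.ext <;> simp [h]
  have hmem : (E.inv w).re ∈ E.source :=
    E.mem_source_of_mem_domain (hr ▸ mem_image_of_mem _ hwT)
  obtain ⟨t, -, -, ht⟩ := E.exists_inv_eq hmem
  rw [← hr, E.ext_inv hwT] at ht
  exact hw (by simp [ht])

/-- An Epstein diffeomorphism with `E 0 = 1` and `E 1 < 0` reverses the order. -/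
theorem ext_re_strictAntiOn (h0 : (0 : ℝ) ∈ E.source) (h1 : (1 : ℝ) ∈ E.source)
    (h01 : E.ext 0 = 1) {y : ℝ} (hy : y < 1) (h1y : E.ext 1 = y) :
    StrictAntiOn (fun x : ℝ => (E.ext x).re) E.source := by
  intro x hx x' hx' hxx'
  obtain ⟨t0, ht0, hi0, he0⟩ := E.exists_inv_eq h0
  obtain ⟨t1, ht1, hi1, he1⟩ := E.exists_inv_eq h1
  obtain ⟨t, ht, hi, he⟩ := E.exists_inv_eq hx
  obtain ⟨t', ht', hi', he'⟩ := E.exists_inv_eq hx'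
  simp only [Complex.ofReal_zero, Complex.ofReal_one] at hi0 he0 hi1 he1
  rw [h01] at he0
  rw [h1y] at he1
  have he0 : t0 = 1 := by exact_mod_cast he0.symm
  have he1 : t1 = y := by exact_mod_cast he1.symm
  set l := min (min t0 t1) (min t t')
  set u := max (max t0 t1) (max t t')
  have hl : l ∈ E.target := by
    simp only [l]
    rcases min_choice (min t0 t1) (min t t') with h | h <;> rw [h]
    · rcases min_choice t0 t1 with h | h <;> rw [h] <;> assumption
    · rcases min_choice t t' with h | h <;> rw [h] <;> assumption
  have hu : u ∈ E.target := by
    simp only [u]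
    rcases max_choice (max t0 t1) (max t t') with h | h <;> rw [h]
    · rcases max_choice t0 t1 with h | h <;> rw [h] <;> assumption
    · rcases max_choice t t' with h | h <;> rw [h] <;> assumption
  have hsub : Icc l u ⊆ E.target := E.ordConnected_target.out hl hu
  have m0 : t0 ∈ Icc l u := ⟨by simp [l], by simp [u]⟩
  have m1 : t1 ∈ Icc l u := ⟨by simp [l], by simp [u]⟩
  have m : t ∈ Icc l u := ⟨by simp [l], by simp [u]⟩
  have m' : t' ∈ Icc l u := ⟨by simp [l], by simp [u]⟩
  have hc : ContinuousOn (fun s : ℝ => (E.inv s).re) (Icc l u) := by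
    refine Complex.continuous_re.comp_continuousOn
      (E.differentiableOn_inv.continuousOn.comp Complex.continuous_ofReal.continuousOn ?_)
    intro s hs
    exact mem_slitDomain_ofReal.2 (hsub hs)
  have hinj : InjOn (fun s : ℝ => (E.inv s).re) (Icc l u) := by
    intro s hs s' hs' h
    obtain ⟨z, -, hz⟩ := E.exists_inv_ofReal (hsub hs)
    obtain ⟨z', -, hz'⟩ := E.exists_inv_ofReal (hsub hs')
    have h : (E.inv s).re = (E.inv s').re := h
    rw [hz, hz', Complex.ofReal_re, Complex.ofReal_re] at h
    have := E.injOn_inv (mem_slitDomain_ofReal.2 (hsub hs)) (mem_slitDomain_ofReal.2 (hsub hs'))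
      (by rw [hz, hz', h])
    exact_mod_cast this
  have hanti : StrictAntiOn (fun s : ℝ => (E.inv s).re) (Icc l u) := by
    refine (hc.strictMonoOn_of_injOn_Icc' (m.1.trans m.2) hinj).resolve_left fun hmono => ?_
    have h : (E.inv t1).re < (E.inv t0).re := hmono m1 m0 (by linarith)
    rw [hi0, hi1] at h
    norm_num at h
  have h : (E.inv t).re < (E.inv t').re := by simpa [hi, hi'] using hxx'
  have := (hanti.lt_iff_gt m m').1 h
  simpa [he, he'] using this

theorem ext_ofReal_re {x : ℝ} (hx : x ∈ E.source) : E.ext x = ((E.ext x).re : ℂ) := by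
  obtain ⟨t, -, -, h⟩ := E.exists_inv_eq hx
  simp [h]

/-- Powers `|E| ^ ℓ` of an Epstein diffeomorphism expand cross-ratios where `E` has no zero,
because the inverse `w ↦ E⁻¹ (± w ^ (1 / ℓ))` extends holomorphically to a slit plane. -/
theorem crossRatio_le_abs_rpow {σ : ℝ} (hσ : σ = 1 ∨ σ = -1) {ℓ : ℝ} (hℓ : 1 ≤ ℓ)
    (hanti : StrictAntiOn (fun x : ℝ => (E.ext x).re) E.source) {a x y b : ℝ}
    (hax : a < x) (hxy : x < y) (hyb : y < b) (hsub : Icc a b ⊆ E.source)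
    (hpos : ∀ z ∈ Icc a b, 0 < σ * (E.ext (z : ℂ)).re) :
    crossRatio a x y b ≤ crossRatio ((σ * (E.ext (a : ℂ)).re) ^ ℓ) ((σ * (E.ext (x : ℂ)).re) ^ ℓ)
      ((σ * (E.ext (y : ℂ)).re) ^ ℓ) ((σ * (E.ext (b : ℂ)).re) ^ ℓ) := by
  have hℓ0 : 0 < ℓ := by linarith
  have hσ2 : σ * σ = 1 := by rcases hσ with rfl | rfl <;> norm_num
  set e : ℝ → ℝ := fun x => (E.ext (x : ℂ)).re with he
  set g : ℝ → ℝ := fun x => (σ * e x) ^ ℓ with hg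
  have ha : a ∈ Icc a b := ⟨le_rfl, by linarith⟩
  have hx : x ∈ Icc a b := ⟨by linarith, by linarith⟩
  have hy : y ∈ Icc a b := ⟨by linarith, by linarith⟩
  have hb : b ∈ Icc a b := ⟨by linarith, le_rfl⟩
  set φ : ℂ → ℂ := fun w => E.inv (σ * w ^ ((1 / ℓ : ℝ) : ℂ)) with hφ
  have hroot : ∀ z ∈ Icc a b, (g z) ^ (1 / ℓ) = σ * e z := by
    intro z hz
    simp only [hg]
    rw [← Real.rpow_mul (hpos z hz).le, mul_one_div_cancel hℓ0.ne', Real.rpow_one]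
  have hgpos : ∀ z ∈ Icc a b, 0 < g z := fun z hz => Real.rpow_pos_of_pos (hpos z hz) _
  have hφg : ∀ z ∈ Icc a b, φ (g z) = z := by
    intro z hz
    simp only [hφ]
    rw [← Complex.ofReal_cpow (hgpos z hz).le, hroot z hz, ← Complex.ofReal_mul, ← mul_assoc, hσ2,
      one_mul]
    obtain ⟨t, -, ht, het⟩ := E.exists_inv_eq (hsub hz)
    simp only [he, het, Complex.ofReal_re, ht]
  -- real points strictly between `e b` and `e a` are mapped by `E⁻¹` between `a` and `b`
  have hbetween : ∀ t : ℝ, e b < t → t < e a → t ∈ E.target ∧ ∃ z ∈ Ioo a b, E.inv t = z := by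
    intro t htb hta
    obtain ⟨ta, hta', -, hea⟩ := E.exists_inv_eq (hsub ha)
    obtain ⟨tb, htb', -, heb⟩ := E.exists_inv_eq (hsub hb)
    have htT : t ∈ E.target := by
      refine E.ordConnected_target.out htb' hta' ⟨?_, ?_⟩
      · simp only [he, heb, Complex.ofReal_re] at htb; exact htb.le
      · simp only [he, hea, Complex.ofReal_re] at hta; exact hta.le
    obtain ⟨z, hz, hzt⟩ := E.exists_inv_ofReal htT
    have hez : e z = t := by
      simp only [he]
      rw [← hzt, E.ext_inv (mem_slitDomain_ofReal.2 htT), Complex.ofReal_re]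
    refine ⟨htT, z, ⟨?_, ?_⟩, hzt⟩
    · rw [← hez] at hta
      exact (hanti.lt_iff_gt hz (hsub ha)).1 hta
    · rw [← hez] at htb
      exact (hanti.lt_iff_gt (hsub hb) hz).1 htb
  have main : ∀ A B : ℝ, 0 < A → (∀ r : ℝ, A < r → r < B →
      e b < σ * r ^ (1 / ℓ) ∧ σ * r ^ (1 / ℓ) < e a) →
      DifferentiableOn ℂ φ (slitDomain (Ioo A B)) ∧
      MapsTo φ (slitDomain (Ioo A B)) (slitDomain (Ioo a b)) := by
    intro A B hA hAB
    have him : ∀ w : ℂ, w.im ≠ 0 → (σ * w ^ ((1 / ℓ : ℝ) : ℂ)).im ≠ 0 := by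
      intro w hw
      rw [Complex.im_ofReal_mul]
      exact mul_ne_zero (by rintro rfl; norm_num at hσ2) (cpow_im_ne_zero hw hℓ)
    have hreal : ∀ r ∈ Ioo A B, (σ : ℂ) * (r : ℂ) ^ ((1 / ℓ : ℝ) : ℂ)
        = ((σ * r ^ (1 / ℓ) : ℝ) : ℂ) := by
      intro r hr
      rw [← Complex.ofReal_cpow (hA.trans hr.1).le, ← Complex.ofReal_mul]
    have hmT : MapsTo (fun w : ℂ => (σ : ℂ) * w ^ ((1 / ℓ : ℝ) : ℂ)) (slitDomain (Ioo A B))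
        (slitDomain E.target) := by
      rintro w (hw | ⟨r, hr, rfl⟩)
      · exact Or.inl (him w hw)
      · beta_reduce
        rw [hreal r hr, mem_slitDomain_ofReal]
        exact (hbetween _ (hAB r hr.1 hr.2).1 (hAB r hr.1 hr.2).2).1
    constructor
    · refine E.differentiableOn_inv.comp ?_ hmT
      intro w hw
      apply DifferentiableAt.differentiableWithinAt
      refine DifferentiableAt.const_mul (DifferentiableAt.cpow_const differentiableAt_id ?_) _
      rcases hw with hw | ⟨r, hr, rfl⟩
      · exact Or.inr hw
      · exact Complex.ofReal_mem_slitPlane.2 (hA.trans hr.1)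
    · rintro w (hw | ⟨r, hr, rfl⟩)
      · exact Or.inl (E.inv_im_ne_zero (him w hw))
      · obtain ⟨-, z, hz, hzr⟩ := hbetween _ (hAB r hr.1 hr.2).1 (hAB r hr.1 hr.2).2
        simp only [hφ]
        rw [hreal r hr, hzr, mem_slitDomain_ofReal]
        exact hz
  have hab : a < b := by linarith
  have hℓ' : 0 < 1 / ℓ := by positivity
  have hrt : ∀ r s : ℝ, 0 < r → r < s → r ^ (1 / ℓ) < s ^ (1 / ℓ) := fun r s hr hrs =>
    Real.rpow_lt_rpow hr.le hrs hℓ'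
  have hmono : ∀ u ∈ Icc a b, ∀ v ∈ Icc a b, σ * e u < σ * e v → g u < g v :=
    fun u hu v hv huv => Real.rpow_lt_rpow (hpos u hu).le huv hℓ0
  have hee : ∀ u ∈ Icc a b, ∀ v ∈ Icc a b, u < v → e v < e u :=
    fun u hu v hv huv => hanti (hsub hu) (hsub hv) huv
  change crossRatio a x y b ≤ crossRatio (g a) (g x) (g y) (g b)
  rcases hσ with rfl | rfl
  · have k1 : g b < g y := hmono b hb y hy (by linarith [hee y hy b hb hyb])
    have k2 : g y < g x := hmono y hy x hx (by linarith [hee x hx y hy hxy])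
    have k3 : g x < g a := hmono x hx a ha (by linarith [hee a ha x hx hax])
    obtain ⟨hd, hm⟩ := main (g b) (g a) (hgpos b hb) (by
      intro r h1 h2
      have h3 := hrt _ _ (hgpos b hb) h1
      have h4 := hrt _ _ ((hgpos b hb).trans h1) h2
      rw [hroot b hb] at h3
      rw [hroot a ha] at h4
      constructor <;> linarith)
    have key := (hyperbolic_contraction_of_mapsTo_slitDomain hab hd hm k1 k2 k3 (hφg y hy)
      (hφg x hx)).2
    rw [← crossRatio_reverse (g a)]
    unfold crossRatio
    rw [div_mul_div_comm, div_mul_div_comm, div_le_div_iff₀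
      (mul_pos (by linarith) (by linarith)) (mul_pos (by linarith) (by linarith))] at key
    rw [div_le_div_iff₀ (mul_pos (by linarith) (by linarith))
      (mul_pos (by linarith) (by linarith))]
    linarith
  · have k1 : g a < g x := hmono a ha x hx (by linarith [hee a ha x hx hax])
    have k2 : g x < g y := hmono x hx y hy (by linarith [hee x hx y hy hxy])
    have k3 : g y < g b := hmono y hy b hb (by linarith [hee y hy b hb hyb])
    obtain ⟨hd, hm⟩ := main (g a) (g b) (hgpos a ha) (by
      intro r h1 h2
      have h3 := hrt _ _ (hgpos a ha) h1
      have h4 := hrt _ _ ((hgpos a ha).trans h1) h2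
      rw [hroot a ha] at h3
      rw [hroot b hb] at h4
      constructor <;> linarith)
    have key := (hyperbolic_contraction_of_mapsTo_slitDomain hab hd hm k1 k2 k3 (hφg x hx)
      (hφg y hy)).1
    unfold crossRatio
    rw [div_mul_div_comm, div_mul_div_comm, div_le_div_iff₀
      (mul_pos (by linarith) (by linarith)) (mul_pos (by linarith) (by linarith))] at key
    rw [div_le_div_iff₀ (mul_pos (by linarith) (by linarith))
      (mul_pos (by linarith) (by linarith))]
    linarith

end EpsteinDiffeo

/-! ### Real dynamics of the Eckmann–Wittwer class -/

/-- The real-variable properties of an Eckmann–Wittwer map `f` that exclude wandering intervals: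
`f` is a unimodal map of `[lo, hi]` with minimum at `c`, analytic off `c`, expands cross-ratios on
each of its two laps, has the repelling boundary fixed point `hi`, and its `p`-th iterate
on `[0, τ⁻¹]` is an affine copy of its restriction to `[0, 1]`. -/
structure IsSelfSimilarUnimodal (f : ℝ → ℝ) (c lo hi τ : ℝ) (p : ℕ) : Prop where
  lo_neg : lo < 0
  one_lt_hi : 1 < hi
  c_pos : 0 < c
  c_lt_one : c < 1
  continuousAt : ∀ x ∈ Icc lo hi, ContinuousAt f x
  analyticAt : ∀ x ∈ Icc lo hi, x ≠ c → AnalyticAt ℝ f x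
  strictAntiOn : StrictAntiOn f (Icc lo c)
  strictMonoOn : StrictMonoOn f (Icc c hi)
  map_c : f c = 0
  map_zero : f 0 = 1
  map_one_le : f 1 ≤ 1
  map_lo : f lo = hi
  map_hi : f hi = hi
  crossRatio_left : ∀ a x y b, lo ≤ a → a < x → x < y → y < b → b ≤ c →
    crossRatio a x y b ≤ crossRatio (f a) (f x) (f y) (f b)
  crossRatio_right : ∀ a x y b, c ≤ a → a < x → x < y → y < b → b ≤ hi →
    crossRatio a x y b ≤ crossRatio (f a) (f x) (f y) (f b)
  one_lt_τ : 1 < τ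
  functional_eq : ∀ x ∈ Icc (0 : ℝ) τ⁻¹, τ * f^[p] x = f (τ * x)
  one_lt_deriv : 1 < deriv f hi

/-- A map that is analytic on an interval, and not constant, is not constant on any nondegenerate
subinterval. -/
theorem not_const_of_analytic {f : ℝ → ℝ} {s : Set ℝ} (hs : s.OrdConnected)
    (hf : ∀ x ∈ s, AnalyticAt ℝ f x) {u v : ℝ} (hu : u ∈ s) (hv : v ∈ s) (huv : f u ≠ f v)
    {x y : ℝ} (hx : x ∈ s) (hy : y ∈ s) (hxy : x < y) : ¬ ∀ z ∈ Icc x y, f z = f x := by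
  intro h
  have hm : (x + y) / 2 ∈ s := hs.out hx hy ⟨by linarith, by linarith⟩
  have heq : EqOn f (fun _ => f x) s := by
    refine AnalyticOnNhd.eqOn_of_preconnected_of_eventuallyEq hf
      (fun z _ => analyticAt_const) hs.isPreconnected hm ?_
    filter_upwards [Ioo_mem_nhds (by linarith : x < (x + y) / 2) (by linarith : (x + y) / 2 < y)]
      with z hz
    exact h z ⟨hz.1.le, hz.2.le⟩
  exact huv ((heq hu).trans (heq hv).symm)

namespace EckmannWittwer

variable {p : ℕ} {A : CombinatorialType p} {H : ℝ → ℝ}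

theorem isOpen_domain (S : EckmannWittwer A H) : IsOpen (S.Uminus ∪ S.Uplus) :=
  S.disk_minus.1.union S.disk_plus.1

theorem mem_domain (S : EckmannWittwer A H) {x : ℝ} (hx : x ∈ Icc S.b₀' S.b₀) (hc : x ≠ S.x₀) :
    (x : ℂ) ∈ S.Uminus ∪ S.Uplus := by
  rcases lt_or_gt_of_ne hc with h | h
  · exact Or.inl (S.Ico_subset x ⟨hx.1, h⟩)
  · exact Or.inr (S.Ioc_subset x ⟨h, hx.2⟩)

theorem analyticAt (S : EckmannWittwer A H) {x : ℝ} (hx : x ∈ Icc S.b₀' S.b₀) (hc : x ≠ S.x₀) :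
    AnalyticAt ℝ H x := by
  have hmem := S.isOpen_domain.mem_nhds (S.mem_domain hx hc)
  have hF : AnalyticAt ℂ S.F x := S.differentiableOn.analyticAt hmem
  refine hF.re_ofReal.congr ?_
  filter_upwards [Complex.continuous_ofReal.continuousAt hmem] with y hy
  rw [S.continuation y hy, Complex.ofReal_re]

/-- On an interval in one lap that contains the base point `0` or `1` of that lap, `H` is the limit
of the real functions `|E| ^ ℓ`, where `|E| = σ E`. -/
theorem exists_tendsto (S : EckmannWittwer A H) {a b σ : ℝ}
    (hK : ∀ x ∈ Icc a b, (x : ℂ) ∈ S.Uplus ∪ S.Uminus)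
    (hσ : (σ = 1 ∧ (0 : ℝ) ∈ Icc a b) ∨ (σ = -1 ∧ (1 : ℝ) ∈ Icc a b)) :
    ∃ (ℓ : ℕ → ℝ) (E : ℕ → EpsteinDiffeo),
      (∀ᶠ m in atTop, 1 ≤ ℓ m ∧
        StrictAntiOn (fun x : ℝ => ((E m).ext x).re) (E m).source ∧ Icc a b ⊆ (E m).source ∧
        ∀ z ∈ Icc a b, 0 < σ * ((E m).ext (z : ℂ)).re) ∧
      ∀ z ∈ Icc a b, Tendsto (fun m => (σ * ((E m).ext (z : ℂ)).re) ^ ℓ m) atTop (𝓝 (H z)) := by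
  obtain ⟨ℓ, E, hℓ, hE, hlim⟩ := S.limit
  obtain ⟨hdom, hunif⟩ := hlim ((fun x : ℝ => (x : ℂ)) '' Icc a b)
    (isCompact_Icc.image Complex.continuous_ofReal) (by rintro _ ⟨x, hx, rfl⟩; exact hK x hx)
  have hev : ∀ᶠ m in atTop, 1 ≤ ℓ m ∧
        StrictAntiOn (fun x : ℝ => ((E m).ext x).re) (E m).source ∧ Icc a b ⊆ (E m).source ∧
        ∀ z ∈ Icc a b, 0 < σ * ((E m).ext (z : ℂ)).re := by
    filter_upwards [hℓ.eventually_ge_atTop 1, hdom] with m hm ⟨hd, hslit⟩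
    obtain ⟨h0, h1, h01, y, hy, h1y⟩ := hE m
    have hsub : Icc a b ⊆ (E m).source := fun x hx =>
      (E m).mem_source_of_mem_domain (hd ⟨x, hx, rfl⟩)
    have hanti := (E m).ext_re_strictAntiOn h0 h1 h01 (by linarith [hy.2] : y < 1) h1y
    refine ⟨hm, hanti, hsub, ?_⟩
    have hne : ∀ z ∈ Icc a b, ((E m).ext (z : ℂ)).re ≠ 0 := by
      intro z hz h
      have h2 := hslit _ ⟨z, hz, rfl⟩
      rw [(E m).ext_ofReal_re (hsub hz), h] at h2
      simp at h2
    -- the value `0` is not taken on `[a, b]`, so the sign is the one at the base point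
    have hzero : ∀ u ∈ Icc a b, ∀ v ∈ Icc a b, 0 < ((E m).ext (u : ℂ)).re →
        ¬ ((E m).ext (v : ℂ)).re < 0 := by
      intro u hu v hv hu0 hv0
      obtain ⟨tu, htu, -, heu⟩ := (E m).exists_inv_eq (hsub hu)
      obtain ⟨tv, htv, -, hev⟩ := (E m).exists_inv_eq (hsub hv)
      have hT : (0 : ℝ) ∈ (E m).target := by
        refine (E m).ordConnected_target.out htv htu ⟨?_, ?_⟩
        · simp only [hev, Complex.ofReal_re] at hv0; exact hv0.le
        · simp only [heu, Complex.ofReal_re] at hu0; exact hu0.le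
      obtain ⟨z, hz, hz0⟩ := (E m).exists_inv_ofReal hT
      have hez : ((E m).ext (z : ℂ)).re = 0 := by
        rw [← hz0, (E m).ext_inv (mem_slitDomain_ofReal.2 hT), Complex.ofReal_re]
      have h3 : u < z := (hanti.lt_iff_gt hz (hsub hu)).1 (by simpa [hez] using hu0)
      have h4 : z < v := (hanti.lt_iff_gt (hsub hv) hz).1 (by simpa [hez] using hv0)
      exact hne z ⟨hu.1.trans h3.le, h4.le.trans hv.2⟩ hez
    intro z hz
    rcases hσ with ⟨rfl, hm0⟩ | ⟨rfl, hm1⟩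
    · have := hzero 0 hm0 z hz (by simp [h01])
      rw [one_mul]
      exact lt_of_le_of_ne (not_lt.1 this) (hne z hz).symm
    · have : ¬ 0 < ((E m).ext (z : ℂ)).re := fun h =>
        hzero z hz 1 hm1 h (by simp [h1y, hy.2])
      have := lt_of_le_of_ne (not_lt.1 this) (hne z hz)
      linarith
  refine ⟨ℓ, E, hev, fun z hz => ?_⟩
  have ht := hunif.tendsto_at (mem_image_of_mem (fun x : ℝ => (x : ℂ)) hz)
  rw [S.continuation z (by rw [union_comm]; exact hK z hz)] at ht
  have ht := (Complex.continuous_re.tendsto _).comp ht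
  rw [Complex.ofReal_re] at ht
  refine ht.congr' ?_
  filter_upwards [hev] with m ⟨_, _, hsub, hpos⟩
  have hσ2 : σ ^ 2 = 1 := by rcases hσ with ⟨rfl, -⟩ | ⟨rfl, -⟩ <;> norm_num
  simp only [Function.comp_apply]
  rw [(E m).ext_ofReal_re (hsub hz), Complex.ofReal_re]
  have hp := hpos z hz
  generalize ((E m).ext (z : ℂ)).re = r at hp ⊢
  rw [← Complex.ofReal_pow, ← Complex.ofReal_cpow (sq_nonneg r), Complex.ofReal_re,
    show r ^ 2 = (σ * r) ^ 2 by rw [mul_pow, hσ2, one_mul], ← Real.rpow_natCast,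
    ← Real.rpow_mul hp.le]
  congr 1
  push_cast
  ring

/-- On a lap, `H` is monotone, and it expands cross-ratios as soon as it is injective: both
properties pass to the limit of the functions `|E| ^ ℓ`. -/
theorem lap_monotone_and_expansion (S : EckmannWittwer A H) {a b σ : ℝ}
    (hK : ∀ x ∈ Icc a b, (x : ℂ) ∈ S.Uplus ∪ S.Uminus)
    (hσ : (σ = 1 ∧ (0 : ℝ) ∈ Icc a b) ∨ (σ = -1 ∧ (1 : ℝ) ∈ Icc a b)) :
    (∀ x ∈ Icc a b, ∀ y ∈ Icc a b, x ≤ y → σ * H y ≤ σ * H x) ∧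
    (InjOn H (Icc a b) → ∀ a' x y b', a ≤ a' → a' < x → x < y → y < b' → b' ≤ b →
      crossRatio a' x y b' ≤ crossRatio (H a') (H x) (H y) (H b')) := by
  obtain ⟨ℓ, E, hev, ht⟩ := S.exists_tendsto hK hσ
  constructor
  · intro x hx y hy hxy
    refine le_of_tendsto_of_tendsto ((ht y hy).const_mul σ) ((ht x hx).const_mul σ) ?_
    filter_upwards [hev] with m ⟨hm, hanti, hsub, hpos⟩
    have h1 := hanti.antitoneOn (hsub hx) (hsub hy) hxy
    have h2 := hpos x hx
    have h3 := hpos y hy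
    rcases hσ with ⟨rfl, -⟩ | ⟨rfl, -⟩
    · simp only [one_mul] at h2 h3 ⊢
      exact Real.rpow_le_rpow h3.le (by linarith) (by linarith)
    · have := Real.rpow_le_rpow h2.le (by linarith :
        (-1) * ((E m).ext (x : ℂ)).re ≤ (-1) * ((E m).ext (y : ℂ)).re) (by linarith : 0 ≤ ℓ m)
      linarith
  · intro hinj a' x y b' haa hax hxy hyb hbb
    have ma : a' ∈ Icc a b := ⟨haa, by linarith⟩
    have mx : x ∈ Icc a b := ⟨by linarith, by linarith⟩
    have my : y ∈ Icc a b := ⟨by linarith, by linarith⟩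
    have mb : b' ∈ Icc a b := ⟨by linarith, hbb⟩
    refine ge_of_tendsto (Filter.Tendsto.crossRatio (ht a' ma) (ht x mx) (ht y my) (ht b' mb)
      (fun h => hax.ne' (hinj mx ma h)) (fun h => hyb.ne (hinj my mb h))) ?_
    filter_upwards [hev] with m ⟨hm, hanti, hsub, hpos⟩
    have hI : Icc a' b' ⊆ Icc a b := Icc_subset_Icc haa hbb
    exact (E m).crossRatio_le_abs_rpow (hσ.imp And.left And.left) hm hanti hax hxy hyb
      (hI.trans hsub) fun z hz => hpos z (hI hz)

theorem strictAntiOn_Ico (S : EckmannWittwer A H) : StrictAntiOn H (Ico S.b₀' S.x₀) := by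
  have hx := S.x₀_mem
  have hb := S.b₀'_neg
  have hb' := S.one_lt_b₀
  have hmono : ∀ x ∈ Ico S.b₀' S.x₀, ∀ y ∈ Ico S.b₀' S.x₀, x ≤ y → H y ≤ H x := by
    intro x hx' y hy' hxy
    have := (S.lap_monotone_and_expansion (a := min x 0) (b := max y 0) (σ := 1) (fun z hz => Or.inr
      (S.Ico_subset z ⟨(le_min hx'.1 hb.le).trans hz.1, hz.2.trans_lt (max_lt hy'.2 hx.1)⟩))
      (Or.inl ⟨rfl, by simp⟩)).1 x ⟨by simp, hxy.trans (by simp)⟩ y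
      ⟨(min_le_left _ _).trans hxy, by simp⟩ hxy
    linarith
  intro x hx' y hy' hxy
  refine lt_of_le_of_ne (hmono x hx' y hy' hxy.le) fun heq => ?_
  have h0 : (0 : ℝ) ∈ Ico S.b₀' S.x₀ := ⟨hb.le, hx.1⟩
  have hh : S.x₀ / 2 ∈ Ico S.b₀' S.x₀ := ⟨by linarith [hx.1], by linarith [hx.1]⟩
  refine not_const_of_analytic ordConnected_Ico
    (fun z hz => S.analyticAt ⟨hz.1, by linarith [hz.2, hx.2]⟩ hz.2.ne) h0 hh
    (S.strictAntiOn ⟨le_rfl, hx.1.le⟩ ⟨by linarith [hx.1], hh.2.le⟩ (by linarith [hx.1])).ne'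
    hx' hy' hxy fun z hz => ?_
  have hz' : z ∈ Ico S.b₀' S.x₀ := ⟨hx'.1.trans hz.1, hz.2.trans_lt hy'.2⟩
  exact le_antisymm (hmono x hx' z hz' hz.1) (heq ▸ hmono z hz' y hy' hz.2)

theorem strictMonoOn_Ioc (S : EckmannWittwer A H) : StrictMonoOn H (Ioc S.x₀ S.b₀) := by
  have hx := S.x₀_mem
  have hb := S.b₀'_neg
  have hb' := S.one_lt_b₀
  have hmono : ∀ x ∈ Ioc S.x₀ S.b₀, ∀ y ∈ Ioc S.x₀ S.b₀, x ≤ y → H x ≤ H y := by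
    intro x hx' y hy' hxy
    have := (S.lap_monotone_and_expansion (a := min x 1) (b := max y 1) (σ := -1)
      (fun z hz => Or.inl (S.Ioc_subset z ⟨(lt_min hx'.1 hx.2).trans_le hz.1, hz.2.trans (max_le hy'.2 hb'.le)⟩))
      (Or.inr ⟨rfl, by simp⟩)).1 x ⟨by simp, hxy.trans (by simp)⟩ y
      ⟨(min_le_left _ _).trans hxy, by simp⟩ hxy
    linarith
  intro x hx' y hy' hxy
  refine lt_of_le_of_ne (hmono x hx' y hy' hxy.le) fun heq => ?_
  have h1 : (1 : ℝ) ∈ Ioc S.x₀ S.b₀ := ⟨hx.2, hb'.le⟩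
  have hh : (S.x₀ + 1) / 2 ∈ Ioc S.x₀ S.b₀ := ⟨by linarith [hx.2], by linarith [hx.2]⟩
  refine not_const_of_analytic ordConnected_Ioc
    (fun z hz => S.analyticAt ⟨by linarith [hz.1, hx.1], hz.2⟩ hz.1.ne') h1 hh
    (S.strictMonoOn ⟨hh.1.le, by linarith [hx.2]⟩ ⟨hx.2.le, le_rfl⟩ (by linarith [hx.2])).ne'
    hx' hy' hxy fun z hz => ?_
  have hz' : z ∈ Ioc S.x₀ S.b₀ := ⟨hx'.1.trans_le hz.1, hz.2.trans hy'.2⟩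
  exact le_antisymm (heq ▸ hmono z hz' y hy' hz.2) (hmono x hx' z hz' hz.1)

theorem continuousAt_x₀ (S : EckmannWittwer A H) : ContinuousAt H S.x₀ :=
  (S.smooth.continuousOn S.x₀ ⟨S.x₀_mem.1.le, S.x₀_mem.2.le⟩).continuousAt
    (Icc_mem_nhds S.x₀_mem.1 S.x₀_mem.2)

theorem continuousAt (S : EckmannWittwer A H) {x : ℝ} (hx : x ∈ Icc S.b₀' S.b₀) :
    ContinuousAt H x := by
  by_cases h : x = S.x₀
  · rw [h]; exact S.continuousAt_x₀
  · exact (S.analyticAt hx h).continuousAt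

theorem isSelfSimilarUnimodal (S : EckmannWittwer A H) :
    IsSelfSimilarUnimodal H S.x₀ S.b₀' S.b₀ S.τ p := by
  have hx := S.x₀_mem
  have hb := S.b₀'_neg
  have hb' := S.one_lt_b₀
  have hanti : StrictAntiOn H (Icc S.b₀' S.x₀) := by
    intro x hx' y hy' hxy
    rcases hy'.2.lt_or_eq with hy | rfl
    · exact S.strictAntiOn_Ico ⟨hx'.1, hxy.trans hy⟩ ⟨hy'.1, hy⟩ hxy
    · obtain ⟨z, hz1, hz2⟩ := exists_between (max_lt hxy hx.1)
      obtain ⟨hz1, hz0⟩ := max_lt_iff.1 hz1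
      exact (S.strictAntiOn ⟨hz0.le, hz2.le⟩ ⟨hx.1.le, le_rfl⟩ hz2).trans
        (S.strictAntiOn_Ico ⟨hx'.1, hxy⟩ ⟨hx'.1.trans hz1.le, hz2⟩ hz1)
  have hmono : StrictMonoOn H (Icc S.x₀ S.b₀) := by
    intro x hx' y hy' hxy
    rcases hx'.1.lt_or_eq with hx0 | rfl
    · exact S.strictMonoOn_Ioc ⟨hx0, hx'.2⟩ ⟨hx0.trans hxy, hy'.2⟩ hxy
    · obtain ⟨z, hz1, hz2⟩ := exists_between (lt_min hxy hx.2)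
      obtain ⟨hz2, hz0⟩ := lt_min_iff.1 hz2
      exact (S.strictMonoOn ⟨le_rfl, hx.2.le⟩ ⟨hz1.le, hz0.le⟩ hz1).trans
        (S.strictMonoOn_Ioc ⟨hz1, hz2.le.trans hy'.2⟩ ⟨hxy, hy'.2⟩ hz2)
  have hleft : ∀ a x y b, S.b₀' ≤ a → a < x → x < y → y < b → b < S.x₀ →
      crossRatio a x y b ≤ crossRatio (H a) (H x) (H y) (H b) := by
    intro a x y b ha hax hxy hyb hbc
    have hI : ∀ z ∈ Icc (min a 0) (max b 0), z ∈ Ico S.b₀' S.x₀ := fun z hz =>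
      ⟨(le_min ha hb.le).trans hz.1, hz.2.trans_lt (max_lt hbc hx.1)⟩
    exact (S.lap_monotone_and_expansion (σ := 1) (fun z hz => Or.inr (S.Ico_subset z (hI z hz)))
      (Or.inl ⟨rfl, by simp⟩)).2 (S.strictAntiOn_Ico.injOn.mono hI) a x y b (by simp) hax hxy hyb
      (by simp)
  have hright : ∀ a x y b, S.x₀ < a → a < x → x < y → y < b → b ≤ S.b₀ →
      crossRatio a x y b ≤ crossRatio (H a) (H x) (H y) (H b) := by
    intro a x y b ha hax hxy hyb hbc
    have hI : ∀ z ∈ Icc (min a 1) (max b 1), z ∈ Ioc S.x₀ S.b₀ := fun z hz =>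
      ⟨(lt_min ha hx.2).trans_le hz.1, hz.2.trans (max_le hbc hb'.le)⟩
    exact (S.lap_monotone_and_expansion (σ := -1) (fun z hz => Or.inl (S.Ioc_subset z (hI z hz)))
      (Or.inr ⟨rfl, by simp⟩)).2 (S.strictMonoOn_Ioc.injOn.mono hI) a x y b (by simp) hax hxy hyb
      (by simp)
  exact
  { lo_neg := hb
    one_lt_hi := hb'
    c_pos := hx.1
    c_lt_one := hx.2
    continuousAt := fun x h => S.continuousAt h
    analyticAt := fun x h hc => S.analyticAt h hc
    strictAntiOn := hanti
    strictMonoOn := hmono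
    map_c := S.map_x₀
    map_zero := S.map_zero
    map_one_le := (S.mapsTo ⟨zero_le_one, le_rfl⟩).2
    map_lo := S.map_b₀'
    map_hi := S.map_b₀
    crossRatio_left := by
      intro a x y b ha hax hxy hyb hbc
      rcases hbc.lt_or_eq with hbc | rfl
      · exact hleft a x y b ha hax hxy hyb hbc
      · have hm : ∀ z, a ≤ z → z ≤ S.x₀ → z ∈ Icc S.b₀' S.x₀ := fun z h1 h2 => ⟨ha.trans h1, h2⟩
        refine le_of_tendsto_of_tendsto
          (Filter.Tendsto.crossRatio tendsto_const_nhds tendsto_const_nhds tendsto_const_nhds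
            (tendsto_nhdsWithin_of_tendsto_nhds tendsto_id) hax.ne' hyb.ne)
          (Filter.Tendsto.crossRatio tendsto_const_nhds tendsto_const_nhds tendsto_const_nhds
            (tendsto_nhdsWithin_of_tendsto_nhds S.continuousAt_x₀)
            (hanti (hm a le_rfl (by linarith)) (hm x hax.le (by linarith)) hax).ne
            (hanti (hm y (by linarith) hyb.le) (hm _ (by linarith) le_rfl) hyb).ne')
          (f := fun z => crossRatio a x y z) (b := 𝓝[<] S.x₀) ?_
        filter_upwards [Ioo_mem_nhdsLT hyb] with z hz
        exact hleft a x y z ha hax hxy hz.1 hz.2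
    crossRatio_right := by
      intro a x y b hac hax hxy hyb hbc
      rcases hac.lt_or_eq with hac | rfl
      · exact hright a x y b hac hax hxy hyb hbc
      · have hm : ∀ z, S.x₀ ≤ z → z ≤ b → z ∈ Icc S.x₀ S.b₀ := fun z h1 h2 => ⟨h1, h2.trans hbc⟩
        refine le_of_tendsto_of_tendsto
          (Filter.Tendsto.crossRatio (tendsto_nhdsWithin_of_tendsto_nhds tendsto_id)
            tendsto_const_nhds tendsto_const_nhds tendsto_const_nhds hax.ne' hyb.ne)
          (Filter.Tendsto.crossRatio (tendsto_nhdsWithin_of_tendsto_nhds S.continuousAt_x₀)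
            tendsto_const_nhds tendsto_const_nhds tendsto_const_nhds
            (hmono (hm _ le_rfl (by linarith)) (hm x hax.le (by linarith)) hax).ne'
            (hmono (hm y (by linarith) hyb.le) (hm _ (by linarith) le_rfl) hyb).ne)
          (f := fun z => crossRatio z x y b) (b := 𝓝[>] S.x₀) ?_
        filter_upwards [Ioo_mem_nhdsGT hax] with z hz
        exact hright z x y b hz.1 hz.2 hxy hyb hbc
    one_lt_τ := S.one_lt_τ
    functional_eq := S.functional_eq
    one_lt_deriv := S.one_lt_deriv }

end EckmannWittwer

/-! ### Iterates and their monotone branches -/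

/-- A continuous function on an interval whose interior it maps off `c` stays on one side
of `c`. -/
theorem one_side {g : ℝ → ℝ} {a b c : ℝ} (hg : ContinuousOn g (Icc a b))
    (h : ∀ x ∈ Ioo a b, g x ≠ c) : (∀ x ∈ Icc a b, g x ≤ c) ∨ ∀ x ∈ Icc a b, c ≤ g x := by
  by_contra! hcon
  obtain ⟨⟨x, hx, hxc⟩, y, hy, hyc⟩ := hcon
  have hsub : uIcc x y ⊆ Icc a b := ordConnected_Icc.uIcc_subset hx hy
  obtain ⟨z, hz, hzc⟩ := intermediate_value_uIcc (hg.mono hsub)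
    (show c ∈ uIcc (g x) (g y) from mem_uIcc.2 (Or.inr ⟨hyc.le, hxc.le⟩))
  have hzx : z ≠ x := by rintro rfl; linarith
  have hzy : z ≠ y := by rintro rfl; linarith
  refine h z ?_ hzc
  rcases mem_uIcc.1 hz with ⟨h1, h2⟩ | ⟨h1, h2⟩
  · exact ⟨hx.1.trans_lt (h1.lt_of_ne hzx.symm), (h2.lt_of_ne hzy).trans_le hy.2⟩
  · exact ⟨hy.1.trans_lt (h1.lt_of_ne hzy.symm), (h2.lt_of_ne hzx).trans_le hx.2⟩

section Dynamics

variable {f : ℝ → ℝ} {c lo hi τ : ℝ} {p : ℕ} {a b u v : ℝ}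

namespace IsSelfSimilarUnimodal


theorem lo_lt_c (S : IsSelfSimilarUnimodal f c lo hi τ p) : lo < c := S.lo_neg.trans S.c_pos

theorem c_lt_hi (S : IsSelfSimilarUnimodal f c lo hi τ p) : c < hi := S.c_lt_one.trans S.one_lt_hi

theorem hi_pos (S : IsSelfSimilarUnimodal f c lo hi τ p) : 0 < hi := S.c_pos.trans S.c_lt_hi

theorem zero_mem (S : IsSelfSimilarUnimodal f c lo hi τ p) : (0 : ℝ) ∈ Icc lo hi :=
  ⟨S.lo_neg.le, S.hi_pos.le⟩

theorem unit_subset (S : IsSelfSimilarUnimodal f c lo hi τ p) : Icc (0 : ℝ) 1 ⊆ Icc lo hi :=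
  Icc_subset_Icc S.lo_neg.le S.one_lt_hi.le

theorem map_pos (S : IsSelfSimilarUnimodal f c lo hi τ p) {x : ℝ} (hx : x ∈ Icc lo hi)
    (hc : x ≠ c) : 0 < f x := by
  rw [← S.map_c]
  rcases lt_or_gt_of_ne hc with h | h
  · exact S.strictAntiOn ⟨hx.1, h.le⟩ ⟨S.lo_lt_c.le, le_rfl⟩ h
  · exact S.strictMonoOn ⟨le_rfl, S.c_lt_hi.le⟩ ⟨h.le, hx.2⟩ h

theorem map_mem (S : IsSelfSimilarUnimodal f c lo hi τ p) {x : ℝ} (hx : x ∈ Icc lo hi) :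
    f x ∈ Icc 0 hi := by
  constructor
  · by_cases h : x = c
    · rw [h, S.map_c]
    · exact (S.map_pos hx h).le
  · rcases le_total x c with h | h
    · rw [← S.map_lo]
      exact S.strictAntiOn.antitoneOn ⟨le_rfl, S.lo_lt_c.le⟩ ⟨hx.1, h⟩ hx.1
    · conv_rhs => rw [← S.map_hi]
      exact S.strictMonoOn.monotoneOn ⟨h, hx.2⟩ ⟨S.c_lt_hi.le, le_rfl⟩ hx.2

theorem eq_c_of_map_eq_zero (S : IsSelfSimilarUnimodal f c lo hi τ p) {x : ℝ}
    (hx : x ∈ Icc lo hi) (h : f x = 0) : x = c := by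
  by_contra hc
  exact (S.map_pos hx hc).ne' h

theorem iterate_mem (S : IsSelfSimilarUnimodal f c lo hi τ p) {x : ℝ} (hx : x ∈ Icc lo hi)
    (k : ℕ) : f^[k] x ∈ Icc lo hi := by
  induction k with
  | zero => exact hx
  | succ k ih =>
    rw [Function.iterate_succ_apply']
    exact Icc_subset_Icc_left S.lo_neg.le (S.map_mem ih)

theorem iterate_nonneg (S : IsSelfSimilarUnimodal f c lo hi τ p) {x : ℝ} (hx : x ∈ Icc lo hi)
    {k : ℕ} (hk : 1 ≤ k) : 0 ≤ f^[k] x := by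
  obtain ⟨k, rfl⟩ := Nat.exists_eq_succ_of_ne_zero (by omega : k ≠ 0)
  rw [Function.iterate_succ_apply']
  exact (S.map_mem (S.iterate_mem hx k)).1

theorem map_unit (S : IsSelfSimilarUnimodal f c lo hi τ p) {x : ℝ} (hx : x ∈ Icc (0 : ℝ) 1) :
    f x ∈ Icc (0 : ℝ) 1 := by
  refine ⟨(S.map_mem (S.unit_subset hx)).1, ?_⟩
  rcases le_total x c with h | h
  · rw [← S.map_zero]
    exact S.strictAntiOn.antitoneOn ⟨S.lo_neg.le, S.c_pos.le⟩ ⟨S.lo_neg.le.trans hx.1, h⟩ hx.1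
  · exact (S.strictMonoOn.monotoneOn ⟨h, hx.2.trans S.one_lt_hi.le⟩
      ⟨S.c_lt_one.le, S.one_lt_hi.le⟩ hx.2).trans S.map_one_le

theorem iterate_unit (S : IsSelfSimilarUnimodal f c lo hi τ p) {x : ℝ} (hx : x ∈ Icc (0 : ℝ) 1)
    (k : ℕ) : f^[k] x ∈ Icc (0 : ℝ) 1 := by
  induction k with
  | zero => exact hx
  | succ k ih =>
    rw [Function.iterate_succ_apply']
    exact S.map_unit ih

theorem continuousAt_iterate (S : IsSelfSimilarUnimodal f c lo hi τ p) {x : ℝ}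
    (hx : x ∈ Icc lo hi) (k : ℕ) : ContinuousAt f^[k] x := by
  induction k with
  | zero => exact continuousAt_id
  | succ k ih =>
    rw [Function.iterate_succ']
    exact (S.continuousAt _ (S.iterate_mem hx k)).comp ih

theorem analyticAt_iterate (S : IsSelfSimilarUnimodal f c lo hi τ p) {x : ℝ}
    (hx : x ∈ Icc lo hi) {k : ℕ} (hk : ∀ j < k, f^[j] x ≠ c) : AnalyticAt ℝ f^[k] x := by
  induction k with
  | zero => exact analyticAt_id
  | succ k ih =>
    rw [Function.iterate_succ']
    exact (S.analyticAt _ (S.iterate_mem hx k) (hk k k.lt_succ_self)).comp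
      (ih fun j hj => hk j (hj.trans k.lt_succ_self))

/-- An iterate of `f` is strictly monotone and expands cross-ratios on a closed interval whose
interior avoids `c` until that time. -/
theorem iterate_expansion (S : IsSelfSimilarUnimodal f c lo hi τ p) {a b : ℝ} (ha : lo ≤ a)
    (hb : b ≤ hi) {s : ℕ} (hs : ∀ j < s, ∀ x ∈ Ioo a b, f^[j] x ≠ c) :
    (StrictMonoOn f^[s] (Icc a b) ∨ StrictAntiOn f^[s] (Icc a b)) ∧
    ∀ a' x y b', a ≤ a' → a' < x → x < y → y < b' → b' ≤ b →
      crossRatio a' x y b' ≤ crossRatio (f^[s] a') (f^[s] x) (f^[s] y) (f^[s] b') := by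
  induction s with
  | zero => exact ⟨Or.inl fun x _ y _ h => h, fun _ _ _ _ _ _ _ _ _ => le_rfl⟩
  | succ s ih =>
    obtain ⟨hm, hcr⟩ := ih fun j hj => hs j (hj.trans s.lt_succ_self)
    have hX : ∀ x ∈ Icc a b, x ∈ Icc lo hi := fun x hx => ⟨ha.trans hx.1, hx.2.trans hb⟩
    have hX' : ∀ x ∈ Icc a b, f^[s] x ∈ Icc lo hi := fun x hx => S.iterate_mem (hX x hx) s
    have hside := one_side (g := f^[s])
      (fun x hx => (S.continuousAt_iterate (hX x hx) s).continuousWithinAt)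
      (hs s s.lt_succ_self)
    rw [Function.iterate_succ']
    simp only [Function.comp_apply]
    have hstep : ∀ a' x y b', a ≤ a' → a' < x → x < y → y < b' → b' ≤ b →
        crossRatio (f^[s] a') (f^[s] x) (f^[s] y) (f^[s] b') ≤ crossRatio (f (f^[s] a'))
          (f (f^[s] x)) (f (f^[s] y)) (f (f^[s] b')) := by
      intro a' x y b' haa hax hxy hyb hbb
      have ma : a' ∈ Icc a b := ⟨haa, by linarith⟩
      have mx : x ∈ Icc a b := ⟨by linarith, by linarith⟩
      have my : y ∈ Icc a b := ⟨by linarith, by linarith⟩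
      have mb : b' ∈ Icc a b := ⟨by linarith, hbb⟩
      rcases hm with hm | hm
      · rcases hside with h | h
        · exact S.crossRatio_left _ _ _ _ (hX' _ ma).1 (hm ma mx hax) (hm mx my hxy)
            (hm my mb hyb) (h _ mb)
        · exact S.crossRatio_right _ _ _ _ (h _ ma) (hm ma mx hax) (hm mx my hxy)
            (hm my mb hyb) (hX' _ mb).2
      · rw [← crossRatio_reverse (f^[s] a'), ← crossRatio_reverse (f (f^[s] a'))]
        rcases hside with h | h
        · exact S.crossRatio_left _ _ _ _ (hX' _ mb).1 (hm my mb hyb) (hm mx my hxy)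
            (hm ma mx hax) (h _ ma)
        · exact S.crossRatio_right _ _ _ _ (h _ mb) (hm my mb hyb) (hm mx my hxy)
            (hm ma mx hax) (hX' _ ma).2
    refine ⟨?_, fun a' x y b' haa hax hxy hyb hbb =>
      (hcr a' x y b' haa hax hxy hyb hbb).trans (hstep a' x y b' haa hax hxy hyb hbb)⟩
    have hl : (∀ x ∈ Icc a b, f^[s] x ≤ c) → MapsTo f^[s] (Icc a b) (Icc lo c) := fun h x hx =>
      ⟨(hX' x hx).1, h x hx⟩
    have hr : (∀ x ∈ Icc a b, c ≤ f^[s] x) → MapsTo f^[s] (Icc a b) (Icc c hi) := fun h x hx =>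
      ⟨h x hx, (hX' x hx).2⟩
    rcases hm with hm | hm <;> rcases hside with h | h
    · exact Or.inr (S.strictAntiOn.comp_strictMonoOn hm (hl h))
    · exact Or.inl (S.strictMonoOn.comp hm (hr h))
    · exact Or.inl (S.strictAntiOn.comp hm (hl h))
    · exact Or.inr (S.strictMonoOn.comp_strictAntiOn hm (hr h))

/-! ### The self-similarity and the orbit of the critical value -/

theorem τ_pos (S : IsSelfSimilarUnimodal f c lo hi τ p) : 0 < τ := zero_lt_one.trans S.one_lt_τ

theorem inv_pow_pos (S : IsSelfSimilarUnimodal f c lo hi τ p) (n : ℕ) : 0 < (τ ^ n)⁻¹ :=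
  inv_pos.2 (pow_pos S.τ_pos n)

theorem inv_pow_le_one (S : IsSelfSimilarUnimodal f c lo hi τ p) (n : ℕ) : (τ ^ n)⁻¹ ≤ 1 :=
  inv_le_one_of_one_le₀ (one_le_pow₀ S.one_lt_τ.le)

theorem inv_pow_le (S : IsSelfSimilarUnimodal f c lo hi τ p) {m n : ℕ} (h : m ≤ n) :
    (τ ^ n)⁻¹ ≤ (τ ^ m)⁻¹ :=
  inv_anti₀ (pow_pos S.τ_pos m) (pow_le_pow_right₀ S.one_lt_τ.le h)

theorem tendsto_inv_pow (S : IsSelfSimilarUnimodal f c lo hi τ p) :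
    Tendsto (fun n : ℕ => (τ ^ n)⁻¹) atTop (𝓝 0) :=
  (tendsto_pow_atTop_atTop_of_one_lt S.one_lt_τ).inv_tendsto_atTop

theorem mul_mem_unit (S : IsSelfSimilarUnimodal f c lo hi τ p) {n : ℕ} {x : ℝ} :
    τ ^ n * x ∈ Icc (0 : ℝ) 1 ↔ x ∈ Icc 0 (τ ^ n)⁻¹ := by
  have := pow_pos S.τ_pos n
  rw [mem_Icc, mem_Icc, mul_nonneg_iff_of_pos_left this, ← one_div, le_div_iff₀ this, mul_comm x]

/-- The restriction of `f^[p ^ n]` to `[0, τ ^ (-n)]` is conjugate to `f` on `[0, 1]` by the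
dilation. -/
theorem iterate_mul_pow (S : IsSelfSimilarUnimodal f c lo hi τ p) (n k : ℕ) {x : ℝ}
    (hx : x ∈ Icc (0 : ℝ) 1) : f^[k * p ^ n] ((τ ^ n)⁻¹ * x) = (τ ^ n)⁻¹ * f^[k] x := by
  induction n generalizing k x with
  | zero => simp
  | succ n ih =>
    have hτ := S.τ_pos
    have hx' : τ⁻¹ * x ∈ Icc 0 τ⁻¹ :=
      ⟨mul_nonneg (inv_pos.2 hτ).le hx.1, mul_le_of_le_one_right (inv_pos.2 hτ).le hx.2⟩
    have hx1 : τ⁻¹ * x ∈ Icc (0 : ℝ) 1 :=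
      ⟨hx'.1, hx'.2.trans (inv_le_one_of_one_le₀ S.one_lt_τ.le)⟩
    have hone : ∀ y ∈ Icc (0 : ℝ) 1, f^[p] (τ⁻¹ * y) = τ⁻¹ * f y := by
      intro y hy
      have := S.functional_eq (τ⁻¹ * y)
        ⟨mul_nonneg (inv_pos.2 hτ).le hy.1, mul_le_of_le_one_right (inv_pos.2 hτ).le hy.2⟩
      rw [mul_inv_cancel_left₀ hτ.ne'] at this
      rw [← this, inv_mul_cancel_left₀ hτ.ne']
    have hk : ∀ k, f^[k * p] (τ⁻¹ * x) = τ⁻¹ * f^[k] x := by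
      intro k
      induction k with
      | zero => simp
      | succ k ihk =>
        rw [Nat.succ_mul, add_comm, Function.iterate_add_apply, ihk,
          hone _ (S.iterate_unit hx k), Function.iterate_succ_apply']
    rw [show (τ ^ (n + 1))⁻¹ = (τ ^ n)⁻¹ * τ⁻¹ by rw [pow_succ, mul_inv], mul_assoc,
      show k * p ^ (n + 1) = k * p * p ^ n by ring, ih (k * p) hx1, hk, mul_assoc]

theorem iterate_mul_pow' (S : IsSelfSimilarUnimodal f c lo hi τ p) {n : ℕ} (k : ℕ) {x : ℝ}
    (hx : x ∈ Icc 0 (τ ^ n)⁻¹) : f^[k * p ^ n] x = (τ ^ n)⁻¹ * f^[k] (τ ^ n * x) := by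
  rw [← S.iterate_mul_pow n k (S.mul_mem_unit.2 hx),
    inv_mul_cancel_left₀ (pow_pos S.τ_pos n).ne']

theorem iterate_mul_pow_mem (S : IsSelfSimilarUnimodal f c lo hi τ p) {n : ℕ} (k : ℕ) {x : ℝ}
    (hx : x ∈ Icc 0 (τ ^ n)⁻¹) : f^[k * p ^ n] x ∈ Icc 0 (τ ^ n)⁻¹ := by
  rw [S.iterate_mul_pow' k hx, ← S.mul_mem_unit, mul_inv_cancel_left₀ (pow_pos S.τ_pos n).ne']
  exact S.iterate_unit (S.mul_mem_unit.2 hx) k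

theorem two_le_p (S : IsSelfSimilarUnimodal f c lo hi τ p) : 2 ≤ p := by
  have h := S.functional_eq 0 ⟨le_rfl, (inv_pos.2 S.τ_pos).le⟩
  have := S.one_lt_τ
  by_contra! hp
  interval_cases p
  · simp [S.map_zero] at h
  · simp [S.map_zero] at h
    linarith

theorem iterate_mul_pow_zero (S : IsSelfSimilarUnimodal f c lo hi τ p) (n k : ℕ) :
    f^[k * p ^ n] 0 = (τ ^ n)⁻¹ * f^[k] 0 := by
  simpa using S.iterate_mul_pow n k (x := 0) ⟨le_rfl, zero_le_one⟩

theorem iterate_pow_zero (S : IsSelfSimilarUnimodal f c lo hi τ p) (n : ℕ) :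
    f^[p ^ n] 0 = (τ ^ n)⁻¹ := by
  simpa [S.map_zero] using S.iterate_mul_pow_zero n 1

/-- The critical value is not preperiodic: its orbit contains all the powers `τ ^ (-n)`. -/
theorem iterate_add_zero_ne (S : IsSelfSimilarUnimodal f c lo hi τ p) (q : ℕ) {s : ℕ}
    (hs : 1 ≤ s) : f^[q + s] 0 ≠ f^[q] 0 := by
  intro h
  have hper : ∀ j i, f^[q + i + s * j] 0 = f^[q + i] 0 := by
    intro j
    induction j with
    | zero => simp
    | succ j ih =>
      intro i
      rw [show q + i + s * (j + 1) = (i + s * j) + (q + s) by ring, Function.iterate_add_apply, h,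
        ← Function.iterate_add_apply, show i + s * j + q = q + i + s * j by ring, ih]
  have hmod : ∀ i, f^[q + i] 0 = f^[q + i % s] 0 := by
    intro i
    rw [← hper (i / s) (i % s), add_assoc, Nat.mod_add_div]
  have hle : ∀ n, q ≤ p ^ (q + n) := fun n =>
    (Nat.lt_pow_self (by have := S.two_le_p; omega)).le.trans
      (Nat.pow_le_pow_right (by have := S.two_le_p; omega) (Nat.le_add_right q n))
  have : NeZero s := ⟨by omega⟩
  obtain ⟨n, n', hne, heq⟩ := Finite.exists_ne_map_eq_of_infinite
    (fun n : ℕ => (⟨(p ^ (q + n) - q) % s, Nat.mod_lt _ hs⟩ : Fin s))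
  have heq : (p ^ (q + n) - q) % s = (p ^ (q + n') - q) % s := by simpa using heq
  have h1 := S.iterate_pow_zero (q + n)
  have h2 := S.iterate_pow_zero (q + n')
  rw [← Nat.add_sub_cancel' (hle n), hmod, heq, ← hmod, Nat.add_sub_cancel' (hle n'), h2,
    inv_inj] at h1
  have := pow_right_injective₀ S.τ_pos S.one_lt_τ.ne' h1
  omega

theorem iterate_zero_ne_c (S : IsSelfSimilarUnimodal f c lo hi τ p) (k : ℕ) : f^[k] 0 ≠ c := by
  intro h
  have := S.iterate_add_zero_ne 0 (s := k + 1) (by omega)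
  rw [zero_add, Function.iterate_succ_apply', h, S.map_c] at this
  exact this rfl

theorem iterate_c_ne_c (S : IsSelfSimilarUnimodal f c lo hi τ p) {k : ℕ} (hk : 1 ≤ k) :
    f^[k] c ≠ c := by
  obtain ⟨k, rfl⟩ := Nat.exists_eq_succ_of_ne_zero (by omega : k ≠ 0)
  rw [Function.iterate_succ_apply, S.map_c]
  exact S.iterate_zero_ne_c k

theorem one_le_pow_p (S : IsSelfSimilarUnimodal f c lo hi τ p) (n : ℕ) : 1 ≤ p ^ n :=
  Nat.one_le_pow _ _ (by have := S.two_le_p; omega)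

/-- The point `τ ^ (-n) c`, which is the critical point of `f^[p ^ n]` on `[0, τ ^ (-n)]`, reaches
`c` at time `p ^ n - 1`. -/
theorem iterate_pow_sub_one (S : IsSelfSimilarUnimodal f c lo hi τ p) (n : ℕ) :
    f^[p ^ n - 1] ((τ ^ n)⁻¹ * c) = c := by
  have hc : c ∈ Icc (0 : ℝ) 1 := ⟨S.c_pos.le, S.c_lt_one.le⟩
  have h := S.iterate_mul_pow n 1 hc
  have hmem : (τ ^ n)⁻¹ * c ∈ Icc (0 : ℝ) 1 :=
    ⟨mul_nonneg (S.inv_pow_pos n).le hc.1,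
      (mul_le_of_le_one_right (S.inv_pow_pos n).le hc.2).trans (S.inv_pow_le_one n)⟩
  rw [one_mul, Function.iterate_one, S.map_c, mul_zero, ← Nat.sub_add_cancel (S.one_le_pow_p n),
    Function.iterate_succ_apply'] at h
  exact S.eq_c_of_map_eq_zero (S.iterate_mem (S.unit_subset hmem) _) h

/-- The interval `[0, τ ^ (-n)]` and its images before time `p ^ n - 1` avoid the critical point.
If `f^[j] x = c` inside a monotonicity interval of `f^[p ^ n]`, then the map `f^[j + 1]` would be
injective near `x` and have its minimum `0` there. -/
theorem iterate_ne_c_of_lt (S : IsSelfSimilarUnimodal f c lo hi τ p) {n j : ℕ}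
    (hj : j + 1 < p ^ n) {x : ℝ} (hx : x ∈ Icc 0 (τ ^ n)⁻¹) : f^[j] x ≠ c := by
  intro hjx
  have ht := S.inv_pow_pos n
  have hτn := pow_pos S.τ_pos n
  have hxx : (τ ^ n)⁻¹ * (τ ^ n * x) = x := inv_mul_cancel_left₀ hτn.ne' x
  have hy := S.mul_mem_unit.2 hx
  have hsucc : f^[j + 1] x = 0 := by rw [Function.iterate_succ_apply', hjx, S.map_c]
  have key : ∀ e₁ e₂ : ℝ, 0 ≤ e₁ → e₂ ≤ 1 → InjOn f (Icc e₁ e₂) → ¬ τ ^ n * x ∈ Ioo e₁ e₂ := by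
    intro e₁ e₂ h0 h1 hinj hxe
    have hsub : ∀ u ∈ Icc ((τ ^ n)⁻¹ * e₁) ((τ ^ n)⁻¹ * e₂), τ ^ n * u ∈ Icc e₁ e₂ := by
      rintro u ⟨hu1, hu2⟩
      rw [inv_mul_le_iff₀ hτn] at hu1
      rw [le_inv_mul_iff₀ hτn] at hu2
      exact ⟨hu1, hu2⟩
    have hI : ∀ u ∈ Icc ((τ ^ n)⁻¹ * e₁) ((τ ^ n)⁻¹ * e₂), u ∈ Icc 0 (τ ^ n)⁻¹ := fun u hu =>
      S.mul_mem_unit.1 ⟨h0.trans (hsub u hu).1, (hsub u hu).2.trans h1⟩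
    have hX : ∀ u ∈ Icc ((τ ^ n)⁻¹ * e₁) ((τ ^ n)⁻¹ * e₂), u ∈ Icc lo hi := fun u hu =>
      S.unit_subset ⟨(hI u hu).1, (hI u hu).2.trans (S.inv_pow_le_one n)⟩
    have hinj' : InjOn f^[j + 1] (Icc ((τ ^ n)⁻¹ * e₁) ((τ ^ n)⁻¹ * e₂)) := by
      intro u hu v hv huv
      have h2 := congrArg f^[p ^ n - (j + 1)] huv
      rw [← Function.iterate_add_apply, ← Function.iterate_add_apply,
        Nat.sub_add_cancel hj.le] at h2
      have hu' := S.iterate_mul_pow' 1 (hI u hu)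
      have hv' := S.iterate_mul_pow' 1 (hI v hv)
      rw [one_mul, Function.iterate_one] at hu' hv'
      rw [hu', hv', mul_right_inj' ht.ne'] at h2
      exact mul_left_cancel₀ hτn.ne' (hinj (hsub u hu) (hsub v hv) h2)
    have hlt : (τ ^ n)⁻¹ * e₁ < x ∧ x < (τ ^ n)⁻¹ * e₂ := by
      rw [inv_mul_lt_iff₀ hτn, lt_inv_mul_iff₀ hτn]
      exact hxe
    have hmx : x ∈ Icc ((τ ^ n)⁻¹ * e₁) ((τ ^ n)⁻¹ * e₂) := ⟨hlt.1.le, hlt.2.le⟩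
    have hm1 : (τ ^ n)⁻¹ * e₁ ∈ Icc ((τ ^ n)⁻¹ * e₁) ((τ ^ n)⁻¹ * e₂) :=
      ⟨le_rfl, hlt.1.le.trans hlt.2.le⟩
    have hm2 : (τ ^ n)⁻¹ * e₂ ∈ Icc ((τ ^ n)⁻¹ * e₁) ((τ ^ n)⁻¹ * e₂) :=
      ⟨hlt.1.le.trans hlt.2.le, le_rfl⟩
    rcases ContinuousOn.strictMonoOn_of_injOn_Icc' (hlt.1.le.trans hlt.2.le)
      (fun u hu => (S.continuousAt_iterate (hX u hu) (j + 1)).continuousWithinAt) hinj' with h | h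
    · have := h hm1 hmx hlt.1
      rw [hsucc] at this
      exact absurd (S.iterate_nonneg (hX _ hm1) (by omega : 1 ≤ j + 1)) this.not_ge
    · have := h hmx hm2 hlt.2
      rw [hsucc] at this
      exact absurd (S.iterate_nonneg (hX _ hm2) (by omega : 1 ≤ j + 1)) this.not_ge
  have hcases : τ ^ n * x = 0 ∨ τ ^ n * x ∈ Ioo 0 c ∨ τ ^ n * x = c ∨ τ ^ n * x ∈ Ioo c 1 ∨
      τ ^ n * x = 1 := by
    rcases hy.1.eq_or_lt with h | h
    · exact Or.inl h.symm
    · rcases lt_trichotomy (τ ^ n * x) c with h2 | h2 | h2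
      · exact Or.inr (Or.inl ⟨h, h2⟩)
      · exact Or.inr (Or.inr (Or.inl h2))
      · rcases hy.2.eq_or_lt with h3 | h3
        · exact Or.inr (Or.inr (Or.inr (Or.inr h3)))
        · exact Or.inr (Or.inr (Or.inr (Or.inl ⟨h2, h3⟩)))
  rcases hcases with h | h | h | h | h
  · rw [h, mul_zero] at hxx
    rw [← hxx] at hjx
    exact S.iterate_zero_ne_c j hjx
  · exact key 0 c le_rfl S.c_lt_one.le
      (S.strictAntiOn.injOn.mono (Icc_subset_Icc_left S.lo_neg.le)) h
  · have h1 := S.iterate_pow_sub_one n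
    rw [← h, hxx, show p ^ n - 1 = (p ^ n - 1 - j) + j by omega, Function.iterate_add_apply,
      hjx] at h1
    rw [h] at h1
    exact S.iterate_c_ne_c (by omega : 1 ≤ p ^ n - 1 - j) h1
  · exact key c 1 S.c_pos.le le_rfl
      (S.strictMonoOn.injOn.mono (Icc_subset_Icc_right S.one_lt_hi.le)) h
  · rw [h, mul_one, ← S.iterate_pow_zero n] at hxx
    rw [← hxx, ← Function.iterate_add_apply] at hjx
    exact S.iterate_zero_ne_c _ hjx

end IsSelfSimilarUnimodal

/-! ### Homtervals -/

/-- The open interval `(u, v)` is a nonempty subinterval of `[lo, hi]` no point of which is ever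
mapped to the critical point `c`, so that all iterates of `f` are monotone on it. -/
structure IsHomterval (f : ℝ → ℝ) (c lo hi u v : ℝ) : Prop where
  lo_le : lo ≤ u
  lt : u < v
  le_hi : v ≤ hi
  iterate_ne : ∀ x ∈ Ioo u v, ∀ k, f^[k] x ≠ c

/-- A homterval that contains every homterval it meets. -/
structure IsMaximalHomterval (f : ℝ → ℝ) (c lo hi u v : ℝ) : Prop
    extends IsHomterval f c lo hi u v where
  maximal : ∀ u' v', IsHomterval f c lo hi u' v' → (Ioo u' v' ∩ Ioo u v).Nonempty →
    u ≤ u' ∧ v' ≤ v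

theorem IsHomterval.exists_maximal (h : IsHomterval f c lo hi u v) :
    ∃ a b, IsMaximalHomterval f c lo hi a b ∧ a ≤ u ∧ v ≤ b := by
  set L : Set ℝ := {t | lo ≤ t ∧ t ≤ u ∧ ∀ x ∈ Ioo t v, ∀ k, f^[k] x ≠ c} with hL
  set R : Set ℝ := {t | v ≤ t ∧ t ≤ hi ∧ ∀ x ∈ Ioo u t, ∀ k, f^[k] x ≠ c} with hR
  have huL : u ∈ L := ⟨h.lo_le, le_rfl, h.iterate_ne⟩
  have hvR : v ∈ R := ⟨le_rfl, h.le_hi, h.iterate_ne⟩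
  have hLb : BddBelow L := ⟨lo, fun t ht => ht.1⟩
  have hRb : BddAbove R := ⟨hi, fun t ht => ht.2.1⟩
  have ha : sInf L ≤ u := csInf_le hLb huL
  have hb : v ≤ sSup R := le_csSup hRb hvR
  have huv := h.lt
  have hgood : ∀ x ∈ Ioo (sInf L) (sSup R), ∀ k, f^[k] x ≠ c := by
    intro x hx
    rcases lt_or_ge x v with hxv | hxv
    · obtain ⟨t, ht, htx⟩ := exists_lt_of_csInf_lt ⟨u, huL⟩ hx.1
      exact ht.2.2 x ⟨htx, hxv⟩
    · obtain ⟨t, ht, htx⟩ := exists_lt_of_lt_csSup ⟨v, hvR⟩ hx.2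
      exact ht.2.2 x ⟨huv.trans_le hxv, htx⟩
  refine ⟨sInf L, sSup R, ⟨⟨le_csInf ⟨u, huL⟩ fun t ht => ht.1, by linarith,
    csSup_le ⟨v, hvR⟩ fun t ht => ht.2.1, hgood⟩, ?_⟩, ha, hb⟩
  rintro u' v' h' ⟨z, hz', hz⟩
  constructor
  · by_contra! hlt
    refine absurd (csInf_le hLb (show u' ∈ L from ⟨h'.lo_le, by linarith, fun x hx => ?_⟩))
      hlt.not_ge
    rcases lt_or_ge x v' with hxv | hxv
    · exact h'.iterate_ne x ⟨hx.1, hxv⟩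
    · exact hgood x ⟨by linarith [hz.1, hz'.2], hx.2.trans_le hb⟩
  · by_contra! hlt
    refine absurd (le_csSup hRb (show v' ∈ R from ⟨by linarith, h'.le_hi, fun x hx => ?_⟩))
      hlt.not_ge
    rcases lt_or_ge u' x with hxv | hxv
    · exact h'.iterate_ne x ⟨hxv, hx.2⟩
    · exact hgood x ⟨ha.trans_lt hx.1, by linarith [hz.2, hz'.1]⟩

theorem IsMaximalHomterval.not_eventually_left (h : IsMaximalHomterval f c lo hi a b)
    (ha : a ≠ lo) : ¬ ∀ᶠ x in 𝓝 a, ∀ k, f^[k] x ≠ c := by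
  intro hev
  obtain ⟨ε, hε, hball⟩ := Metric.eventually_nhds_iff.1 hev
  have hlo := lt_of_le_of_ne h.lo_le ha.symm
  have hab := h.lt
  have hmax := (h.maximal (max lo (a - ε)) (min b (a + ε)) ⟨le_max_left _ _,
    max_lt (lt_min (by linarith) (by linarith)) (lt_min (by linarith) (by linarith)),
    (min_le_left _ _).trans h.le_hi, fun x hx => ?_⟩ ?_).1
  · exact absurd hmax (max_lt hlo (by linarith)).not_ge
  · obtain ⟨h1, h2⟩ := max_lt_iff.1 hx.1
    obtain ⟨h3, h4⟩ := lt_min_iff.1 hx.2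
    exact hball (by rw [Real.dist_eq, abs_lt]; constructor <;> linarith)
  · obtain ⟨z, hz1, hz2⟩ := exists_between (lt_min hab (by linarith : a < a + ε))
    exact ⟨z, ⟨(max_lt hlo (by linarith : a - ε < a)).trans hz1, hz2⟩, hz1,
      hz2.trans_le (min_le_left _ _)⟩

theorem IsMaximalHomterval.not_eventually_right (h : IsMaximalHomterval f c lo hi a b)
    (hb : b ≠ hi) : ¬ ∀ᶠ x in 𝓝 b, ∀ k, f^[k] x ≠ c := by
  intro hev
  obtain ⟨ε, hε, hball⟩ := Metric.eventually_nhds_iff.1 hev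
  have hhi := lt_of_le_of_ne h.le_hi hb
  have hab := h.lt
  have hmax := (h.maximal (max a (b - ε)) (min hi (b + ε)) ⟨h.lo_le.trans (le_max_left _ _),
    max_lt (lt_min (by linarith) (by linarith)) (lt_min (by linarith) (by linarith)),
    min_le_left _ _, fun x hx => ?_⟩ ?_).2
  · exact absurd hmax (lt_min hhi (by linarith)).not_ge
  · obtain ⟨h1, h2⟩ := max_lt_iff.1 hx.1
    obtain ⟨h3, h4⟩ := lt_min_iff.1 hx.2
    exact hball (by rw [Real.dist_eq, abs_lt]; constructor <;> linarith)
  · obtain ⟨z, hz1, hz2⟩ := exists_between (max_lt hab (by linarith : b - ε < b))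
    exact ⟨z, ⟨hz1, hz2.trans (lt_min hhi (by linarith))⟩, (le_max_left _ _).trans_lt hz1, hz2⟩

/-! ### Increasing self-maps that expand cross-ratios -/

/-- Orbits of an increasing self-map are monotone. -/
theorem lt_iterate_of_lt {h : ℝ → ℝ} {s : Set ℝ} (hm : StrictMonoOn h s) (hs : MapsTo h s s)
    {w : ℝ} (hw : w ∈ s) {d : ℕ} (hd : 1 ≤ d) : (w < h w → h w ≤ h^[d] w) ∧
    (h w < w → h^[d] w ≤ h w) := by
  have hmem : ∀ d, h^[d] w ∈ s := fun d => hs.iterate d hw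
  induction d, hd using Nat.le_induction with
  | base => simp
  | succ d hd ih =>
    rw [Function.iterate_succ_apply']
    exact ⟨fun hlt => (hm.monotoneOn hw (hmem d) (hlt.le.trans (ih.1 hlt))),
      fun hlt => (hm.monotoneOn (hmem d) hw ((ih.2 hlt).trans hlt.le))⟩

theorem eq_of_iterate_eq {h : ℝ → ℝ} {s : Set ℝ} (hm : StrictMonoOn h s) (hs : MapsTo h s s)
    {w : ℝ} (hw : w ∈ s) {d : ℕ} (hd : 1 ≤ d) (hfix : h^[d] w = w) : h w = w := by
  obtain ⟨h1, h2⟩ := lt_iterate_of_lt hm hs hw hd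
  rw [hfix] at h1 h2
  rcases lt_trichotomy (h w) w with hlt | heq | hlt
  · exact absurd (h2 hlt) hlt.not_ge
  · exact heq
  · exact absurd (h1 hlt) hlt.not_ge

/-- If a map that fixes the endpoints of `[a, b]` and expands cross-ratios moves some point
towards `a`, then `a` is an attracting fixed point. -/
theorem deriv_lt_one_of_lt {h : ℝ → ℝ} {a b d y : ℝ} (ha : h a = a) (hb : h b = b)
    (hm : StrictMonoOn h (Icc a b))
    (hcr : ∀ x y, a < x → x < y → y < b → crossRatio a x y b ≤ crossRatio a (h x) (h y) b)
    (hd : HasDerivAt h d a) (hay : a < y) (hyb : y < b) (hy : h y < y) : 0 ≤ d ∧ d < 1 := by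
  have hab : a < b := hay.trans hyb
  have hbounds : ∀ x, a < x → x < b → a < h x ∧ h x < b := fun x h1 h2 =>
    ⟨ha ▸ hm ⟨le_rfl, hab.le⟩ ⟨h1.le, h2.le⟩ h1,
      hb ▸ hm ⟨h1.le, h2.le⟩ ⟨hab.le, le_rfl⟩ h2⟩
  have hslope : Tendsto (fun x => (h x - a) / (x - a)) (𝓝[>] a) (𝓝 d) := by
    have := (hasDerivAt_iff_tendsto_slope.1 hd).mono_left (nhdsGT_le_nhdsNE a)
    refine this.congr fun x => ?_
    rw [slope_def_field, ha]
  obtain ⟨hy1, hy2⟩ := hbounds y hay hyb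
  constructor
  · refine ge_of_tendsto hslope ?_
    filter_upwards [Ioo_mem_nhdsGT hab] with x hx
    exact div_nonneg (by linarith [(hbounds x hx.1 hx.2).1]) (by linarith [hx.1])
  · have hca : Tendsto h (𝓝[>] a) (𝓝 a) := by
      have := hd.continuousAt.tendsto
      rw [ha] at this
      exact tendsto_nhdsWithin_of_tendsto_nhds this
    have hid : Tendsto (fun x : ℝ => x) (𝓝[>] a) (𝓝 a) :=
      tendsto_nhdsWithin_of_tendsto_nhds tendsto_id
    have hR : Tendsto (fun x => (h y - a) * (b - y) * (b - h x) / ((y - a) * (b - h y) * (b - x)))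
        (𝓝[>] a) (𝓝 ((h y - a) * (b - y) * (b - a) / ((y - a) * (b - h y) * (b - a)))) :=
      ((hca.const_sub b).const_mul _).div ((hid.const_sub b).const_mul _)
        (mul_pos (mul_pos (by linarith) (by linarith)) (by linarith)).ne'
    have hle := le_of_tendsto_of_tendsto hslope hR (by
      filter_upwards [Ioo_mem_nhdsGT hay] with x hx
      obtain ⟨hx1, hx2⟩ := hbounds x hx.1 (hx.2.trans hyb)
      have hxb : x < b := hx.2.trans hyb
      have hxa : a < x := hx.1
      have := hcr x y hx.1 hx.2 hyb
      unfold crossRatio at this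
      rw [div_le_div_iff₀ (mul_pos (by linarith) (by linarith))
        (mul_pos (by linarith) (by linarith))] at this
      rw [div_le_div_iff₀ (by linarith)
        (mul_pos (mul_pos (by linarith) (by linarith)) (by linarith))]
      linarith)
    refine hle.trans_lt ?_
    rw [div_lt_one (mul_pos (mul_pos (by linarith) (by linarith)) (by linarith))]
    refine mul_lt_mul_of_pos_right ?_ (by linarith)
    nlinarith

theorem deriv_lt_one_of_gt {h : ℝ → ℝ} {a b d y : ℝ} (ha : h a = a) (hb : h b = b)
    (hm : StrictMonoOn h (Icc a b))
    (hcr : ∀ x y, a < x → x < y → y < b → crossRatio a x y b ≤ crossRatio a (h x) (h y) b)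
    (hd : HasDerivAt h d b) (hay : a < y) (hyb : y < b) (hy : y < h y) : 0 ≤ d ∧ d < 1 := by
  refine deriv_lt_one_of_lt (h := fun x => -h (-x)) (a := -b) (b := -a) (y := -y) (by simp [hb])
    (by simp [ha]) ?_ ?_ ?_ (by linarith) (by linarith) (by simpa using hy)
  · intro x hx z hz hxz
    have := hm (a := -z) (b := -x) ⟨by linarith [hz.2], by linarith [hz.1]⟩
      ⟨by linarith [hx.2], by linarith [hx.1]⟩ (by linarith)
    simpa using this
  · intro x z hx hxz hz
    have := hcr (-z) (-x) (by linarith) (by linarith) (by linarith)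
    rw [← crossRatio_reverse, ← crossRatio_neg, ← crossRatio_reverse a, ← crossRatio_neg b] at this
    simpa using this
  · have h1 : HasDerivAt h d (-(-b)) := by simpa using hd
    have h2 : HasDerivAt (fun x : ℝ => -x) (-1) (-b) := (hasDerivAt_id (-b)).fun_neg
    have := (h1.comp (-b) h2).fun_neg
    simpa using this

theorem eventually_abs_sub_le_of_hasDerivAt {h : ℝ → ℝ} {a d : ℝ} (ha : h a = a)
    (hd : HasDerivAt h d a) (h0 : 0 ≤ d) (h1 : d < 1) : ∀ᶠ x in 𝓝 a, |h x - a| ≤ |x - a| := by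
  have := (hasDerivAt_iff_isLittleO.1 hd).def (by linarith : 0 < 1 - d)
  filter_upwards [this] with x hx
  simp only [ha, smul_eq_mul, Real.norm_eq_abs] at hx
  have h2 : |h x - a| ≤ |h x - a - (x - a) * d| + |(x - a) * d| := by
    simpa using abs_add_le (h x - a - (x - a) * d) ((x - a) * d)
  rw [abs_mul, abs_of_nonneg h0] at h2
  nlinarith [abs_nonneg (x - a)]

namespace IsSelfSimilarUnimodal

theorem exists_image_eq (S : IsSelfSimilarUnimodal f c lo hi τ p)
    (h : IsHomterval f c lo hi u v) (s : ℕ) :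
    ∃ U V, IsHomterval f c lo hi U V ∧ f^[s] '' Ioo u v = Ioo U V := by
  have hX : ∀ x ∈ Icc u v, x ∈ Icc lo hi := fun x hx => ⟨h.lo_le.trans hx.1, hx.2.trans h.le_hi⟩
  have hu : u ∈ Icc u v := ⟨le_rfl, h.lt.le⟩
  have hv : v ∈ Icc u v := ⟨h.lt.le, le_rfl⟩
  have hcont : ContinuousOn f^[s] (Icc u v) := fun x hx =>
    (S.continuousAt_iterate (hX x hx) s).continuousWithinAt
  have hgood : ∀ x ∈ f^[s] '' Ioo u v, ∀ k, f^[k] x ≠ c := by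
    rintro _ ⟨x, hx, rfl⟩ k
    rw [← Function.iterate_add_apply]
    exact h.iterate_ne x hx _
  rcases (S.iterate_expansion h.lo_le h.le_hi fun j (_ : j < s) x hx =>
    h.iterate_ne x hx j).1 with hm | hm
  · have heq : f^[s] '' Ioo u v = Ioo (f^[s] u) (f^[s] v) := by
      refine Subset.antisymm ?_ (intermediate_value_Ioo h.lt.le hcont)
      rintro _ ⟨x, hx, rfl⟩
      exact ⟨hm hu (Ioo_subset_Icc_self hx) hx.1, hm (Ioo_subset_Icc_self hx) hv hx.2⟩
    exact ⟨_, _, ⟨(S.iterate_mem (hX u hu) s).1, hm hu hv h.lt, (S.iterate_mem (hX v hv) s).2,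
      heq ▸ hgood⟩, heq⟩
  · have heq : f^[s] '' Ioo u v = Ioo (f^[s] v) (f^[s] u) := by
      refine Subset.antisymm ?_ (intermediate_value_Ioo' h.lt.le hcont)
      rintro _ ⟨x, hx, rfl⟩
      exact ⟨hm (Ioo_subset_Icc_self hx) hv hx.2, hm hu (Ioo_subset_Icc_self hx) hx.1⟩
    exact ⟨_, _, ⟨(S.iterate_mem (hX v hv) s).1, hm hu hv h.lt, (S.iterate_mem (hX u hu) s).2,
      heq ▸ hgood⟩, heq⟩

end IsSelfSimilarUnimodal

namespace IsSelfSimilarUnimodal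

/-! ### Homtervals mapped into themselves by a rescaled iterate -/

/-- The interval `[0, τ ^ (-m)]` returns to itself only at multiples of the time `p ^ m`. -/
def ReturnTimes (f : ℝ → ℝ) (τ : ℝ) (p m : ℕ) : Prop :=
  ∀ x ∈ Icc 0 (τ ^ m)⁻¹, ∀ i, f^[i] x ∈ Icc 0 (τ ^ m)⁻¹ → p ^ m ∣ i

theorem returnTimes_zero : ReturnTimes f τ p 0 := fun _ _ _ _ => by simp

/-- The iterate `f^[s]` followed by the dilation by `τ ^ m`. -/
noncomputable def rescaledIterate (f : ℝ → ℝ) (τ : ℝ) (m s : ℕ) (x : ℝ) : ℝ := τ ^ m * f^[s] x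

/-- An orbit that reaches the critical point at a time `k ≥ s` does so at an earlier time from
its image under the rescaled iterate `τ ^ m f^[s]`. -/
theorem exists_lt_iterate_eq (S : IsSelfSimilarUnimodal f c lo hi τ p) {m s k : ℕ} {x : ℝ}
    (hR : ReturnTimes f τ p m) (hs : 1 ≤ s)
    (hm : m = 0 ∨ rescaledIterate f τ m s x ∈ Icc (0 : ℝ) 1) (hk : s ≤ k) (hxk : f^[k] x = c) :
    ∃ k' < k, f^[k'] (rescaledIterate f τ m s x) = c := by
  have hsplit : f^[k - s] (f^[s] x) = c := by
    rw [← Function.iterate_add_apply, Nat.sub_add_cancel hk, hxk]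
  rcases hm with rfl | hm
  · exact ⟨k - s, by omega, by simpa [rescaledIterate] using hsplit⟩
  · have hI : f^[s] x ∈ Icc 0 (τ ^ m)⁻¹ := S.mul_mem_unit.1 hm
    have h0 : f^[k - s + 1] (f^[s] x) = 0 := by
      rw [Function.iterate_succ_apply', hsplit, S.map_c]
    obtain ⟨q, hq⟩ := hR _ hI (k - s + 1) (by rw [h0]; exact ⟨le_rfl, (S.inv_pow_pos m).le⟩)
    have hq0 : q ≠ 0 := by rintro rfl; omega
    obtain ⟨q, rfl⟩ := Nat.exists_eq_succ_of_ne_zero hq0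
    rw [hq, mul_comm, S.iterate_mul_pow' _ hI, mul_eq_zero, Function.iterate_succ_apply'] at h0
    have h1 := S.eq_c_of_map_eq_zero (S.iterate_mem (S.unit_subset hm) q)
      (h0.resolve_left (S.inv_pow_pos m).ne')
    refine ⟨q, ?_, h1⟩
    have := Nat.le_mul_of_pos_left (q + 1) (S.one_le_pow_p m)
    simp only [Nat.succ_eq_add_one] at hq
    omega

/-- Where it stays in `[0, 1]`, the rescaled orbit of the critical value `0` is part of the orbit
of `0`. -/
theorem rescaled_orbit_zero (S : IsSelfSimilarUnimodal f c lo hi τ p) {m i : ℕ}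
    (hR : ReturnTimes f τ p m) (hm : m = 0 ∨ τ ^ m * f^[i] 0 ∈ Icc (0 : ℝ) 1) :
    ∃ q, i = q * p ^ m ∧ τ ^ m * f^[i] 0 = f^[q] 0 := by
  rcases hm with rfl | hm
  · exact ⟨i, by simp, by simp⟩
  · obtain ⟨q, rfl⟩ := hR 0 ⟨le_rfl, (S.inv_pow_pos m).le⟩ i (S.mul_mem_unit.1 hm)
    refine ⟨q, mul_comm _ _, ?_⟩
    rw [mul_comm, mul_comm (p ^ m), S.iterate_mul_pow_zero, mul_comm,
      mul_inv_cancel_left₀ (pow_pos S.τ_pos m).ne']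

theorem continuousAt_rescaledIterate (S : IsSelfSimilarUnimodal f c lo hi τ p) {m s : ℕ} {x : ℝ}
    (hx : x ∈ Icc lo hi) : ContinuousAt (rescaledIterate f τ m s) x :=
  (S.continuousAt_iterate hx s).const_mul (τ ^ m)

/-- Points whose images under the rescaled iterate are not precritical are not precritical
themselves, if their first `s` images avoid `c`. -/
theorem iterate_ne_of_rescaled (S : IsSelfSimilarUnimodal f c lo hi τ p) {m s : ℕ} {x : ℝ}
    (hR : ReturnTimes f τ p m) (hs : 1 ≤ s)
    (hm : m = 0 ∨ rescaledIterate f τ m s x ∈ Icc (0 : ℝ) 1) (hj : ∀ j < s, f^[j] x ≠ c)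
    (h : ∀ k, f^[k] (rescaledIterate f τ m s x) ≠ c) (k : ℕ) : f^[k] x ≠ c := by
  intro hk
  obtain ⟨k', -, hk'⟩ := S.exists_lt_iterate_eq hR hs hm
    (not_lt.1 fun hlt => hj k hlt hk) hk
  exact h k' hk'

theorem eventually_iterate_ne (S : IsSelfSimilarUnimodal f c lo hi τ p) {x : ℝ} {s : ℕ}
    (hx : x ∈ Icc lo hi) (h : ∀ k, f^[k] x ≠ c) : ∀ᶠ y in 𝓝 x, ∀ j < s, f^[j] y ≠ c := by
  have := (Finset.eventually_all (Finset.range s) (p := fun j y => f^[j] y ≠ c)).2 fun j _ =>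
    (S.continuousAt_iterate hx j).eventually_ne (h j)
  simpa using this

/-- Near a fixed point from which the rescaled iterate does not move points away, no point is
precritical, unless the fixed point is. -/
theorem eventually_not_precritical_of_contracting (S : IsSelfSimilarUnimodal f c lo hi τ p)
    {m s : ℕ} {e : ℝ} (hR : ReturnTimes f τ p m) (hs : 1 ≤ s) (he : e ∈ Ioo lo hi)
    (hm : m = 0 ∨ e ∈ Ioo (0 : ℝ) 1) (hgood : ∀ k, f^[k] e ≠ c)
    (hfix : rescaledIterate f τ m s e = e)
    (hcontr : ∀ᶠ x in 𝓝 e, |rescaledIterate f τ m s x - e| ≤ |x - e|) :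
    ∀ᶠ x in 𝓝 e, ∀ k, f^[k] x ≠ c := by
  have hd : ∀ᶠ x in 𝓝 e, m = 0 ∨ rescaledIterate f τ m s x ∈ Icc (0 : ℝ) 1 := by
    rcases hm with hm | hm
    · exact Eventually.of_forall fun _ => Or.inl hm
    · have := (S.continuousAt_rescaledIterate (m := m) (s := s)
        (Ioo_subset_Icc_self he)).eventually_mem
        (show Icc (0 : ℝ) 1 ∈ 𝓝 (rescaledIterate f τ m s e) by
          rw [hfix]; exact Icc_mem_nhds hm.1 hm.2)
      exact this.mono fun x hx => Or.inr hx
  obtain ⟨ε, hε, hball⟩ := Metric.eventually_nhds_iff.1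
    (((hd.and hcontr).and (S.eventually_iterate_ne (s := s) (Ioo_subset_Icc_self he) hgood)).and
      (Ioo_mem_nhds he.1 he.2))
  have key : ∀ k x, |x - e| < ε → f^[k] x ≠ c := by
    intro k
    induction k using Nat.strong_induction_on with
    | _ k ih =>
      intro x hx hk
      obtain ⟨⟨⟨h1, h2⟩, h3⟩, h4⟩ := hball (show dist x e < ε by rwa [Real.dist_eq])
      obtain ⟨k', hk', hk'c⟩ := S.exists_lt_iterate_eq hR hs h1
        (not_lt.1 fun hlt => h3 k hlt hk) hk
      exact ih k' hk' _ (h2.trans_lt hx) hk'c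
  filter_upwards [Metric.ball_mem_nhds e hε] with x hx k
  exact key k x (by rwa [Metric.mem_ball, Real.dist_eq] at hx)

/-- No point of a closed interval that an increasing rescaled iterate maps into itself is
precritical. -/
theorem iterate_ne_of_mapsTo (S : IsSelfSimilarUnimodal f c lo hi τ p) {m s : ℕ}
    (hR : ReturnTimes f τ p m) (hs : 1 ≤ s) (ha : lo ≤ a) (hb : b ≤ hi)
    (hm : m = 0 ∨ (0 ≤ a ∧ b ≤ 1))
    (hmono : StrictMonoOn (rescaledIterate f τ m s) (Icc a b))
    (hmaps : MapsTo (rescaledIterate f τ m s) (Icc a b) (Icc a b)) {e : ℝ} (he : e ∈ Icc a b)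
    (k : ℕ) : f^[k] e ≠ c := by
  set h := rescaledIterate f τ m s with hh
  have hX : ∀ x ∈ Icc a b, x ∈ Icc lo hi := fun x hx => ⟨ha.trans hx.1, hx.2.trans hb⟩
  have hdom : ∀ x ∈ Icc a b, m = 0 ∨ x ∈ Icc (0 : ℝ) 1 := fun x hx =>
    hm.imp id fun h => ⟨h.1.trans hx.1, hx.2.trans h.2⟩
  -- a point that reaches `c` before time `s` is mapped by `h` into the orbit of the critical value
  have hearly : ∀ x ∈ Icc a b, ∀ k < s, f^[k] x = c → ∃ q, h x = f^[q] 0 := by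
    intro x hx k hk hxk
    have hsx : f^[s] x = f^[s - k - 1] 0 := by
      have h1 : f^[(s - k - 1) + (k + 1)] x = f^[s - k - 1] 0 := by
        rw [Function.iterate_add_apply, Function.iterate_succ_apply', hxk, S.map_c]
      rwa [show (s - k - 1) + (k + 1) = s by omega] at h1
    have hd := hdom _ (hmaps hx)
    simp only [hh, rescaledIterate, hsx] at hd ⊢
    obtain ⟨q, -, hq⟩ := S.rescaled_orbit_zero hR hd
    exact ⟨q, hq⟩
  have hreach : ∀ k, ∀ x ∈ Icc a b, f^[k] x = c → ∃ i q, h^[i] x = f^[q] 0 := by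
    intro k
    induction k using Nat.strong_induction_on with
    | _ k ih =>
      intro x hx hxk
      rcases lt_or_ge k s with hks | hks
      · obtain ⟨q, hq⟩ := hearly x hx k hks hxk
        exact ⟨1, q, hq⟩
      · obtain ⟨k', hk', hk'c⟩ := S.exists_lt_iterate_eq hR hs (hdom _ (hmaps hx)) hks hxk
        obtain ⟨i, q, hiq⟩ := ih k' hk' _ (hmaps hx) hk'c
        exact ⟨i + 1, q, by rwa [Function.iterate_succ_apply]⟩
  -- points of the orbit of the critical value in `[a, b]` are fixed by `h`
  have hfixorbit : ∀ q, f^[q] 0 ∈ Icc a b → h (f^[q] 0) = f^[q] 0 := by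
    intro q hq
    rcases Nat.eq_zero_or_pos m with rfl | hmpos
    · -- `f^[q] 0` is recurrent under `h = f^[s]`, hence cannot move monotonically
      have hhf : h = f^[s] := by funext x; simp [hh, rescaledIterate]
      have hiter : ∀ n, h^[p ^ n] (f^[q] 0) = f^[q] ((τ ^ n)⁻¹ * f^[s] 0) := by
        intro n
        rw [hhf, ← Function.iterate_mul, ← Function.iterate_add_apply, Nat.add_comm,
          Function.iterate_add_apply, S.iterate_mul_pow_zero]
      have hlim : Tendsto (fun n => h^[p ^ n] (f^[q] 0)) atTop (𝓝 (f^[q] 0)) := by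
        simp only [hiter]
        have h1 : Tendsto (fun n => (τ ^ n)⁻¹ * f^[s] 0) atTop (𝓝 0) := by
          simpa using S.tendsto_inv_pow.mul_const (f^[s] 0)
        exact (S.continuousAt_iterate S.zero_mem q).tendsto.comp h1
      have hmon := fun n => lt_iterate_of_lt hmono hmaps hq (S.one_le_pow_p n)
      rcases lt_trichotomy (h (f^[q] 0)) (f^[q] 0) with hlt | heq | hlt
      · exact absurd (le_of_tendsto' hlim fun n => (hmon n).2 hlt) hlt.not_ge
      · exact heq
      · exact absurd (ge_of_tendsto' hlim fun n => (hmon n).1 hlt) hlt.not_ge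
    · -- the images `f^[q'] 0` satisfy `q' p ^ m = q + s`, hence form a finite set
      have hstep : ∀ q', f^[q'] 0 ∈ Icc a b → q' ≤ q + s →
          ∃ q'' ≤ q + s, h (f^[q'] 0) = f^[q''] 0 := by
        intro q' hq' hle
        have hd := hdom _ (hmaps hq')
        simp only [hh, rescaledIterate, ← Function.iterate_add_apply] at hd ⊢
        obtain ⟨r, hr, hr'⟩ := S.rescaled_orbit_zero hR hd
        refine ⟨r, ?_, hr'⟩
        have h2 : 2 ≤ p ^ m := S.two_le_p.trans (Nat.le_self_pow hmpos.ne' p)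
        nlinarith
      have hall : ∀ j, ∃ q'' : Fin (q + s + 1), h^[j] (f^[q] 0) = f^[(q'' : ℕ)] 0 := by
        intro j
        induction j with
        | zero => exact ⟨⟨q, by omega⟩, rfl⟩
        | succ j ih =>
          obtain ⟨q', hq'⟩ := ih
          have hmem := hmaps.iterate j hq
          rw [hq'] at hmem
          obtain ⟨q'', hle, heq⟩ := hstep q' hmem (by omega)
          exact ⟨⟨q'', by omega⟩, by rw [Function.iterate_succ_apply', hq', heq]⟩
      choose g hg using hall
      obtain ⟨i, j, hij, hgij⟩ := Finite.exists_ne_map_eq_of_infinite g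
      wlog hlt : i < j generalizing i j
      · exact this j i hij.symm hgij.symm (by omega)
      have heq : h^[i] (h^[j - i] (f^[q] 0)) = h^[i] (f^[q] 0) := by
        rw [← Function.iterate_add_apply, Nat.add_sub_cancel' hlt.le, hg, hg, hgij]
      exact eq_of_iterate_eq hmono hmaps hq (by omega : 1 ≤ j - i)
        (hmono.injOn.iterate hmaps i (hmaps.iterate _ hq) hq heq)
  have hfix : ∀ k, ∀ x ∈ Icc a b, f^[k] x = c → h x = x := by
    intro k x hx hxk
    obtain ⟨i, q, hiq⟩ := hreach k x hx hxk
    have hmem := hmaps.iterate i hx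
    rw [hiq] at hmem
    have heq : h^[i] (h x) = h^[i] x := by
      rw [← Function.iterate_succ_apply, Function.iterate_succ_apply', hiq, hfixorbit q hmem]
    exact hmono.injOn.iterate hmaps i (hmaps hx) hx heq
  have hmain : ∀ k, f^[k] e ≠ c := by
    intro k
    induction k using Nat.strong_induction_on with
    | _ k ih =>
      intro hk
      have hef := hfix k e he hk
      rcases lt_or_ge k s with hks | hks
      · obtain ⟨q, hq⟩ := hearly e he k hks hk
        rw [← hef, hq, ← Function.iterate_add_apply] at hk
        exact S.iterate_zero_ne_c _ hk
      · obtain ⟨k', hk', hk'c⟩ := S.exists_lt_iterate_eq hR hs (hdom _ (hmaps he)) hks hk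
        change f^[k'] (h e) = c at hk'c
        rw [hef] at hk'c
        exact ih k' hk' hk'c
  exact hmain k

theorem analyticAt_rescaledIterate (S : IsSelfSimilarUnimodal f c lo hi τ p) {m s : ℕ} {x : ℝ}
    (hx : x ∈ Icc lo hi) (h : ∀ k, f^[k] x ≠ c) : AnalyticAt ℝ (rescaledIterate f τ m s) x :=
  analyticAt_const.mul (S.analyticAt_iterate hx fun j _ => h j)

theorem mapsTo_Icc_of_mapsTo_Ioo (S : IsSelfSimilarUnimodal f c lo hi τ p) {m s : ℕ}
    (hab : a < b) (ha : lo ≤ a) (hb : b ≤ hi)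
    (hmaps : MapsTo (rescaledIterate f τ m s) (Ioo a b) (Ioo a b)) :
    MapsTo (rescaledIterate f τ m s) (Icc a b) (Icc a b) := by
  have := hmaps.closure_of_continuousOn (by
    rw [closure_Ioo hab.ne]
    exact fun x hx => (S.continuousAt_rescaledIterate
      ⟨ha.trans hx.1, hx.2.trans hb⟩).continuousWithinAt)
  rwa [closure_Ioo hab.ne] at this

theorem iterate_lo (S : IsSelfSimilarUnimodal f c lo hi τ p) {s : ℕ} (hs : 1 ≤ s) :
    f^[s] lo = hi := by
  obtain ⟨s, rfl⟩ := Nat.exists_eq_succ_of_ne_zero (by omega : s ≠ 0)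
  rw [Function.iterate_succ_apply, S.map_lo]
  exact Function.iterate_fixed S.map_hi s

/-- An increasing rescaled iterate `h = τ ^ m f^[s]` does not map a maximal homterval `(a, b)` into
itself. By maximality `h` fixes `a` and `b`, and neither is attracting; the expansion of
cross-ratios then forces `h` to be the identity, near `a` too, against maximality at `a`. -/
theorem not_mapsTo_of_strictMonoOn (S : IsSelfSimilarUnimodal f c lo hi τ p) {m s : ℕ}
    (hR : ReturnTimes f τ p m) (hs : 1 ≤ s) (hab : IsMaximalHomterval f c lo hi a b)
    (hm : m = 0 ∨ (0 < a ∧ b < 1))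
    (hmono : StrictMonoOn (rescaledIterate f τ m s) (Icc a b)) :
    ¬ MapsTo (rescaledIterate f τ m s) (Ioo a b) (Ioo a b) := by
  intro hmaps
  have hlt := hab.lt
  have hmapsI := S.mapsTo_Icc_of_mapsTo_Ioo hlt hab.lo_le hab.le_hi hmaps
  have hgood := fun e he k => S.iterate_ne_of_mapsTo hR hs hab.lo_le hab.le_hi
    (hm.imp id fun h => ⟨h.1.le, h.2.le⟩) hmono hmapsI (e := e) he k
  set h := rescaledIterate f τ m s with hh
  have hX : ∀ x ∈ Icc a b, x ∈ Icc lo hi := fun x hx =>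
    ⟨hab.lo_le.trans hx.1, hx.2.trans hab.le_hi⟩
  have hma : a ∈ Icc a b := ⟨le_rfl, hlt.le⟩
  have hmb : b ∈ Icc a b := ⟨hlt.le, le_rfl⟩
  have hcmem : ¬ c ∈ Icc a b := fun hc => hgood c hc 0 rfl
  have hm0 : a ≤ 0 ∨ 1 ≤ b → h = f^[s] := by
    intro h
    rcases hm with rfl | ⟨h1, h2⟩
    · funext x; simp [hh, rescaledIterate]
    · rcases h with h | h <;> linarith
  have halo : a ≠ lo := by
    intro heq
    have h1 := hmapsI hma
    rw [hm0 (Or.inl (heq ▸ S.lo_neg.le)), heq, S.iterate_lo hs] at h1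
    exact hcmem ⟨heq ▸ S.lo_lt_c.le, S.c_lt_hi.le.trans h1.2⟩
  have halt := lt_of_le_of_ne hab.lo_le halo.symm
  have haX : a ∈ Ioo lo hi := ⟨halt, hlt.trans_le hab.le_hi⟩
  -- a point mapped into the interior has a neighbourhood of points that are not precritical
  have hinterior : ∀ e ∈ Icc a b, e ∈ Ioo lo hi → h e ∈ Ioo a b →
      ∀ᶠ x in 𝓝 e, ∀ k, f^[k] x ≠ c := by
    intro e he heX hhe
    filter_upwards [(S.continuousAt_rescaledIterate (hX e he)).eventually_mem
      (Ioo_mem_nhds hhe.1 hhe.2), S.eventually_iterate_ne (s := s) (hX e he) (hgood e he)]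
      with x h1 h2
    exact S.iterate_ne_of_rescaled hR hs
      (hm.imp id fun h => ⟨(h.1.trans h1.1).le, (h1.2.trans h.2).le⟩) h2
      (hab.iterate_ne _ h1)
  obtain ⟨z, haz, hzb⟩ := exists_between hlt
  have hz : z ∈ Icc a b := ⟨haz.le, hzb.le⟩
  have hfa : h a = a := by
    by_contra hne
    refine hab.not_eventually_left halo (hinterior a hma haX
      ⟨lt_of_le_of_ne (hmapsI hma).1 (Ne.symm hne), ?_⟩)
    exact (hmono hma hz haz).trans_le (hmapsI hz).2
  have hfb : h b = b := by
    by_cases hbhi : b = hi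
    · rw [hm0 (Or.inr (hbhi ▸ S.one_lt_hi.le)), hbhi]
      exact Function.iterate_fixed S.map_hi s
    · by_contra hne
      refine hab.not_eventually_right hbhi (hinterior b hmb
        ⟨halt.trans hlt, lt_of_le_of_ne hab.le_hi hbhi⟩
        ⟨?_, lt_of_le_of_ne (hmapsI hmb).2 hne⟩)
      exact (hmapsI hz).1.trans_lt (hmono hz hmb hzb)
  have hcr : ∀ x y, a < x → x < y → y < b → crossRatio a x y b ≤ crossRatio a (h x) (h y) b := by
    intro x y hax hxy hyb
    have := (S.iterate_expansion hab.lo_le hab.le_hi fun j (_ : j < s) x hx =>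
      hab.iterate_ne x hx j).2 a x y b le_rfl hax hxy hyb le_rfl
    rw [← crossRatio_const_mul (pow_pos S.τ_pos m).ne' (f^[s] a)] at this
    change _ ≤ crossRatio (h a) (h x) (h y) (h b) at this
    rwa [hfa, hfb] at this
  have hda := (S.analyticAt_rescaledIterate (m := m) (s := s) (hX a hma)
    (hgood a hma)).differentiableAt.hasDerivAt
  have hdb := (S.analyticAt_rescaledIterate (m := m) (s := s) (hX b hmb)
    (hgood b hmb)).differentiableAt.hasDerivAt
  have hnota : ¬ ∀ᶠ x in 𝓝 a, |h x - a| ≤ |x - a| := fun hev =>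
    hab.not_eventually_left halo (S.eventually_not_precritical_of_contracting hR hs haX
      (hm.imp id fun h => ⟨h.1, hlt.trans h.2⟩) (hgood a hma) hfa hev)
  have hge : ∀ y ∈ Ioo a b, y ≤ h y := by
    intro y hy
    by_contra! hlt'
    obtain ⟨h0, h1⟩ := deriv_lt_one_of_lt hfa hfb hmono hcr hda hy.1 hy.2 hlt'
    exact hnota (eventually_abs_sub_le_of_hasDerivAt hfa hda h0 h1)
  have hle : ∀ y ∈ Ioo a b, h y ≤ y := by
    intro y hy
    by_contra! hlt'
    obtain ⟨h0, h1⟩ := deriv_lt_one_of_gt hfa hfb hmono hcr hdb hy.1 hy.2 hlt'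
    by_cases hbhi : b = hi
    · have hhf := hm0 (Or.inr (hbhi ▸ S.one_lt_hi.le))
      have hdf : HasDerivAt f (deriv f hi) hi :=
        (S.analyticAt hi ⟨S.lo_lt_c.le.trans S.c_lt_hi.le, le_rfl⟩
          S.c_lt_hi.ne').differentiableAt.hasDerivAt
      have hds := HasDerivAt.iterate _ hdf S.map_hi s
      have heq : deriv (rescaledIterate f τ m s) b = deriv f hi ^ s := by
        rw [← hh, hhf, hbhi]
        exact hds.deriv
      rw [heq] at h1
      exact absurd (one_le_pow₀ S.one_lt_deriv.le) h1.not_ge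
    · exact hab.not_eventually_right hbhi (S.eventually_not_precritical_of_contracting hR hs
        ⟨halt.trans hlt, lt_of_le_of_ne hab.le_hi hbhi⟩
        (hm.imp id fun h => ⟨h.1.trans hlt, h.2⟩) (hgood b hmb) hfb
        (eventually_abs_sub_le_of_hasDerivAt hfb hdb h0 h1))
  -- hence `h` is the identity on the homterval, and by analyticity also near its endpoint `a`
  have hid : ∀ᶠ x in 𝓝 a, h x = x := by
    refine ((S.analyticAt_rescaledIterate (hX a hma)
      (hgood a hma)).frequently_eq_iff_eventually_eq analyticAt_id).1 ?_
    have hev : ∀ᶠ x in 𝓝[>] a, h x = id x := by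
      filter_upwards [Ioo_mem_nhdsGT hlt] with x hx
      exact le_antisymm (hle x hx) (hge x hx)
    exact hev.frequently.filter_mono (nhdsGT_le_nhdsNE a)
  exact hnota (hid.mono fun x hx => by rw [hx])

theorem rescaledIterate_twice (S : IsSelfSimilarUnimodal f c lo hi τ p) {m s : ℕ} {x : ℝ}
    (hm : m = 0 ∨ rescaledIterate f τ m s x ∈ Icc (0 : ℝ) 1) :
    rescaledIterate f τ m s (rescaledIterate f τ m s x) =
      rescaledIterate f τ (2 * m) (s * p ^ m + s) x := by
  unfold rescaledIterate at *
  rw [Function.iterate_add_apply]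
  rcases hm with rfl | hm
  · simp
  · rw [S.iterate_mul_pow' s (S.mul_mem_unit.1 hm), two_mul, pow_add, mul_assoc,
      mul_inv_cancel_left₀ (pow_pos S.τ_pos m).ne']

/-- A rescaled iterate `τ ^ m f^[s]` with `s ≥ 1` does not map a maximal homterval into itself. -/
theorem not_mapsTo (S : IsSelfSimilarUnimodal f c lo hi τ p) {m s : ℕ}
    (hR : ReturnTimes f τ p m) (hR2 : ReturnTimes f τ p (2 * m)) (hs : 1 ≤ s)
    (hab : IsMaximalHomterval f c lo hi a b) (hm : m = 0 ∨ (0 < a ∧ b < 1)) :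
    ¬ MapsTo (rescaledIterate f τ m s) (Ioo a b) (Ioo a b) := by
  intro hmaps
  have hpos := pow_pos S.τ_pos m
  rcases (S.iterate_expansion hab.lo_le hab.le_hi fun j (_ : j < s) x hx =>
    hab.iterate_ne x hx j).1 with hmono | hanti
  · exact S.not_mapsTo_of_strictMonoOn hR hs hab hm
      (fun x hx y hy hxy => mul_lt_mul_of_pos_left (hmono hx hy hxy) hpos) hmaps
  · have hanti' : StrictAntiOn (rescaledIterate f τ m s) (Icc a b) := fun x hx y hy hxy =>
      mul_lt_mul_of_pos_left (hanti hx hy hxy) hpos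
    have hmapsI := S.mapsTo_Icc_of_mapsTo_Ioo hab.lt hab.lo_le hab.le_hi hmaps
    have htwice : ∀ x ∈ Icc a b, rescaledIterate f τ m s (rescaledIterate f τ m s x) =
        rescaledIterate f τ (2 * m) (s * p ^ m + s) x := fun x hx =>
      S.rescaledIterate_twice (hm.imp id fun h =>
        ⟨h.1.le.trans (hmapsI hx).1, (hmapsI hx).2.trans h.2.le⟩)
    refine S.not_mapsTo_of_strictMonoOn hR2 (by omega : 1 ≤ s * p ^ m + s) hab
      (hm.imp (by rintro rfl; rfl) id) ?_ ?_
    · intro x hx y hy hxy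
      rw [← htwice x hx, ← htwice y hy]
      exact hanti' (hmapsI hy) (hmapsI hx) (hanti' hx hy hxy)
    · intro x hx
      rw [← htwice x (Ioo_subset_Icc_self hx)]
      exact hmaps (hmaps hx)

/-- Homtervals do not return to themselves. -/
theorem iterate_notMem (S : IsSelfSimilarUnimodal f c lo hi τ p) (h : IsHomterval f c lo hi u v)
    {s : ℕ} (hs : 1 ≤ s) {x : ℝ} (hx : x ∈ Ioo u v) : f^[s] x ∉ Ioo u v := by
  intro hsx
  obtain ⟨a, b, hab, hau, hvb⟩ := h.exists_maximal
  have hsub : Ioo u v ⊆ Ioo a b := Ioo_subset_Ioo hau hvb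
  obtain ⟨U, V, hUV, himg⟩ := S.exists_image_eq hab.toIsHomterval s
  have hmax := hab.maximal U V hUV ⟨f^[s] x, himg ▸ mem_image_of_mem _ (hsub hx), hsub hsx⟩
  refine S.not_mapsTo (m := 0) returnTimes_zero returnTimes_zero hs hab (Or.inl rfl) ?_
  intro y hy
  have : f^[s] y ∈ Ioo U V := himg ▸ mem_image_of_mem _ hy
  simpa [rescaledIterate] using Ioo_subset_Ioo hmax.1 hmax.2 this

theorem iterate_c_scaled_ne (S : IsSelfSimilarUnimodal f c lo hi τ p)
    (h : IsHomterval f c lo hi u v) {x : ℝ} (hx : x ∈ Ioo u v) (m k : ℕ) :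
    f^[k] x ≠ (τ ^ m)⁻¹ * c := by
  intro hk
  have := S.iterate_pow_sub_one m
  rw [← hk, ← Function.iterate_add_apply] at this
  exact h.iterate_ne x hx _ this

/-- The return times of `[0, τ ^ (-m)]` are the multiples of `p ^ m`. Otherwise this interval and
another interval of its cycle would meet in an interval that is invariant under `f^[p ^ m]` and
does not contain the critical point `τ ^ (-m) c` of that iterate; up to scale this is a homterval
mapped into itself by `f`. -/
theorem returnTimes (S : IsSelfSimilarUnimodal f c lo hi τ p) (m : ℕ) : ReturnTimes f τ p m := by
  intro x hx i hi'
  by_contra hdvd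
  have hT := S.inv_pow_pos m
  have hτm := pow_pos S.τ_pos m
  set T := (τ ^ m)⁻¹ with hTdef
  set N := p ^ m with hN
  have hN1 : 1 ≤ N := S.one_le_pow_p m
  set r := i % N with hr
  have hr0 : 1 ≤ r := Nat.one_le_iff_ne_zero.2 fun h => hdvd (Nat.dvd_of_mod_eq_zero h)
  have hrN : r < N := Nat.mod_lt _ hN1
  have hIX : ∀ z ∈ Icc 0 T, z ∈ Icc lo hi := fun z hz =>
    S.unit_subset ⟨hz.1, hz.2.trans (S.inv_pow_le_one m)⟩
  have hIN : ∀ k, ∀ z ∈ Icc 0 T, f^[k * N] z ∈ Icc 0 T := fun k z hz => S.iterate_mul_pow_mem k hz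
  have hIN1 : ∀ z ∈ Icc 0 T, f^[N] z ∈ Icc 0 T := fun z hz => by simpa using hIN 1 z hz
  have hcont : ContinuousOn f^[r] (Icc 0 T) := fun z hz =>
    (S.continuousAt_iterate (hIX z hz) r).continuousWithinAt
  obtain ⟨k₁, k₂, hK⟩ : ∃ k₁ k₂, f^[r] '' Icc 0 T = Icc k₁ k₂ := ⟨_, _, hcont.image_Icc hT.le⟩
  have hinj : InjOn f^[r] (Icc 0 T) := by
    rcases (S.iterate_expansion S.lo_neg.le (hIX T ⟨hT.le, le_rfl⟩).2 fun j (hj : j < r) z hz =>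
      S.iterate_ne_c_of_lt (by omega : j + 1 < p ^ m) (Ioo_subset_Icc_self hz)).1 with h | h
    · exact h.injOn
    · exact h.injOn
  have hk12 : k₁ < k₂ := by
    have h0 : f^[r] 0 ∈ Icc k₁ k₂ := hK ▸ mem_image_of_mem _ ⟨le_rfl, hT.le⟩
    have h1 : f^[r] T ∈ Icc k₁ k₂ := hK ▸ mem_image_of_mem _ ⟨hT.le, le_rfl⟩
    by_contra! hle
    exact hT.ne (hinj ⟨le_rfl, hT.le⟩ ⟨hT.le, le_rfl⟩
      (le_antisymm (by linarith [h0.2, h1.1]) (by linarith [h0.1, h1.2])))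
  have hKN : ∀ z ∈ Icc k₁ k₂, f^[N] z ∈ Icc k₁ k₂ := by
    intro z hz
    rw [← hK] at hz ⊢
    obtain ⟨w, hw, rfl⟩ := hz
    refine ⟨f^[N] w, hIN1 w hw, ?_⟩
    rw [← Function.iterate_add_apply, ← Function.iterate_add_apply, add_comm]
  have hKNk : ∀ k, ∀ z ∈ Icc k₁ k₂, f^[k * N] z ∈ Icc k₁ k₂ := by
    intro k z hz
    rw [mul_comm, Function.iterate_mul]
    exact MapsTo.iterate hKN k hz
  have hcK : T * c ∉ Icc k₁ k₂ := by
    intro hmem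
    rw [← hK] at hmem
    obtain ⟨w, hw, hwc⟩ := hmem
    have h1 := S.iterate_pow_sub_one m
    rw [← hTdef, ← hwc, ← Function.iterate_add_apply,
      show p ^ m - 1 + r = (r - 1) + N by omega, Function.iterate_add_apply] at h1
    exact S.iterate_ne_c_of_lt (by omega : r - 1 + 1 < p ^ m) (hIN1 w hw) h1
  obtain ⟨z₀, hz₀K, hz₀I⟩ : ∃ z, z ∈ Icc k₁ k₂ ∧ z ∈ Icc 0 T := by
    refine ⟨f^[i] x, ?_, hi'⟩
    rw [← hK]
    refine ⟨f^[i / N * N] x, hIN _ x hx, ?_⟩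
    rw [← Function.iterate_add_apply, hr, mul_comm, Nat.mod_add_div]
  have hle : max k₁ 0 ≤ min k₂ T :=
    (max_le hz₀K.1 hz₀I.1).trans (le_min hz₀K.2 hz₀I.2)
  have hD : ∀ z ∈ Icc (max k₁ 0) (min k₂ T), z ∈ Icc k₁ k₂ ∧ z ∈ Icc 0 T := fun z hz =>
    ⟨⟨(le_max_left _ _).trans hz.1, hz.2.trans (min_le_left _ _)⟩,
      ⟨(le_max_right _ _).trans hz.1, hz.2.trans (min_le_right _ _)⟩⟩
  have hDN : ∀ z ∈ Icc (max k₁ 0) (min k₂ T), f^[N] z ∈ Icc (max k₁ 0) (min k₂ T) := by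
    intro z hz
    obtain ⟨h1, h2⟩ := hD z hz
    exact ⟨max_le (hKN z h1).1 (hIN1 z h2).1, le_min (hKN z h1).2 (hIN1 z h2).2⟩
  rcases hle.lt_or_eq with hlt | heq
  · have hscale : ∀ y, y ∈ Icc (τ ^ m * max k₁ 0) (τ ^ m * min k₂ T) →
        T * y ∈ Icc (max k₁ 0) (min k₂ T) := by
      rintro y ⟨h1, h2⟩
      rw [hTdef, mem_Icc, le_inv_mul_iff₀ hτm, inv_mul_le_iff₀ hτm]
      exact ⟨h1, h2⟩
    have hunit : ∀ y, y ∈ Icc (τ ^ m * max k₁ 0) (τ ^ m * min k₂ T) → y ∈ Icc (0 : ℝ) 1 := by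
      intro y hy
      have := S.mul_mem_unit.2 (hD _ (hscale y hy)).2
      rwa [hTdef, mul_inv_cancel_left₀ hτm.ne'] at this
    have hlt' := mul_lt_mul_of_pos_left hlt hτm
    have hhom : IsHomterval f c lo hi (τ ^ m * max k₁ 0) (τ ^ m * min k₂ T) := by
      refine ⟨(S.unit_subset (hunit _ ⟨le_rfl, hlt'.le⟩)).1, hlt',
        (S.unit_subset (hunit _ ⟨hlt'.le, le_rfl⟩)).2, fun y hy k hk => ?_⟩
      have hy' := Ioo_subset_Icc_self hy
      have h1 := S.iterate_mul_pow m k (hunit y hy')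
      rw [hk] at h1
      exact hcK (h1 ▸ hKNk k _ (hD _ (hscale y hy')).1)
    have hfD : ∀ y ∈ Icc (τ ^ m * max k₁ 0) (τ ^ m * min k₂ T),
        f y ∈ Icc (τ ^ m * max k₁ 0) (τ ^ m * min k₂ T) := by
      intro y hy
      have h1 := S.iterate_mul_pow m 1 (hunit y hy)
      have h2 := hDN _ (hscale y hy)
      rw [one_mul, Function.iterate_one] at h1
      rw [h1, mem_Icc, le_inv_mul_iff₀ hτm, inv_mul_le_iff₀ hτm] at h2
      exact h2
    obtain ⟨U, V, hUV, himg⟩ := S.exists_image_eq hhom 1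
    obtain ⟨y, hy1, hy2⟩ := exists_between hlt'
    have hfy : f^[1] y ∈ Ioo U V := himg ▸ mem_image_of_mem _ ⟨hy1, hy2⟩
    have hIoo : ∀ w ∈ Ioo U V, w ∈ Icc (τ ^ m * max k₁ 0) (τ ^ m * min k₂ T) := by
      intro w hw
      rw [← himg] at hw
      obtain ⟨w', hw', rfl⟩ := hw
      exact hfD w' (Ioo_subset_Icc_self hw')
    refine S.iterate_notMem hhom le_rfl ⟨hy1, hy2⟩ ⟨?_, ?_⟩
    · obtain ⟨w, hw1, hw2⟩ := exists_between hfy.1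
      exact (hIoo w ⟨hw1, hw2.trans hfy.2⟩).1.trans_lt hw2
    · obtain ⟨w, hw1, hw2⟩ := exists_between hfy.2
      exact hw1.trans_le (hIoo w ⟨hfy.1.trans hw1, hw2⟩).2
  · -- the two intervals have only an endpoint in common, which `f^[N]` fixes
    have hfix : f^[N] (max k₁ 0) = max k₁ 0 := by
      have := hDN _ ⟨le_rfl, hle⟩
      rw [← heq, Icc_self] at this
      exact this
    have hcase : max k₁ 0 = 0 ∨ max k₁ 0 = T := by
      rcases max_choice k₁ 0 with h | h
      · rcases min_choice k₂ T with h' | h'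
        · rw [h, h'] at heq
          exact absurd heq hk12.ne
        · exact Or.inr (heq.trans h')
      · exact Or.inl h
    rcases hcase with h | h
    · rw [h, S.iterate_pow_zero] at hfix
      exact hT.ne' hfix
    · have h1 := S.iterate_mul_pow m 1 (x := 1) ⟨zero_le_one, le_rfl⟩
      rw [h] at hfix
      rw [one_mul, mul_one, Function.iterate_one, ← hTdef, hfix] at h1
      have h2 : f 1 = 1 := by
        have : T * f 1 = T * 1 := by rw [mul_one]; exact h1.symm
        exact mul_left_cancel₀ hT.ne' this
      refine S.iterate_add_zero_ne 1 (s := 1) le_rfl ?_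
      simp [S.map_zero, h2]

theorem tendsto_iterate_add_pow_zero (S : IsSelfSimilarUnimodal f c lo hi τ p) (i : ℕ) :
    Tendsto (fun n => f^[p ^ n] (f^[i] 0)) atTop (𝓝 (f^[i] 0)) := by
  have : ∀ n, f^[p ^ n] (f^[i] 0) = f^[i] ((τ ^ n)⁻¹) := by
    intro n
    rw [← Function.iterate_add_apply, add_comm, Function.iterate_add_apply, S.iterate_pow_zero]
  simp only [this]
  exact (S.continuousAt_iterate S.zero_mem i).tendsto.comp S.tendsto_inv_pow

/-- The orbit of the critical value is recurrent, so it avoids all homtervals. -/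
theorem iterate_zero_notMem (S : IsSelfSimilarUnimodal f c lo hi τ p)
    (h : IsHomterval f c lo hi u v) (i : ℕ) : f^[i] 0 ∉ Ioo u v := by
  intro hi'
  obtain ⟨n, hn⟩ := ((S.tendsto_iterate_add_pow_zero i).eventually_mem
    (Ioo_mem_nhds hi'.1 hi'.2)).exists
  exact S.iterate_notMem h (S.one_le_pow_p n) hi' hn

/-- A homterval that meets `[0, τ ^ (-m)]` is contained in it, since both endpoints of that interval
lie on the orbit of the critical value. -/
theorem homterval_subset (S : IsSelfSimilarUnimodal f c lo hi τ p)
    (h : IsHomterval f c lo hi u v) {m : ℕ} {x : ℝ} (hx : x ∈ Ioo u v)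
    (hxm : x ∈ Icc 0 (τ ^ m)⁻¹) : 0 ≤ u ∧ v ≤ (τ ^ m)⁻¹ := by
  constructor
  · by_contra! hlt
    exact S.iterate_zero_notMem h 0 ⟨hlt, hxm.1.trans_lt hx.2⟩
  · by_contra! hlt
    exact S.iterate_zero_notMem h (p ^ m)
      (by rw [S.iterate_pow_zero]; exact ⟨hx.1.trans_le hxm.2, hlt⟩)

theorem homterval_dilate (S : IsSelfSimilarUnimodal f c lo hi τ p)
    (h : IsHomterval f c lo hi u v) {m : ℕ} (hu : 0 ≤ u) (hv : v ≤ (τ ^ m)⁻¹) :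
    IsHomterval f c lo hi (τ ^ m * u) (τ ^ m * v) := by
  have hpos := pow_pos S.τ_pos m
  have hUm := S.mul_mem_unit.2 ⟨hu, h.lt.le.trans hv⟩
  have hVm := S.mul_mem_unit.2 ⟨hu.trans h.lt.le, hv⟩
  refine ⟨(S.unit_subset hUm).1, mul_lt_mul_of_pos_left h.lt hpos, (S.unit_subset hVm).2,
    fun y hy k hk => ?_⟩
  have hy1 : y ∈ Icc (0 : ℝ) 1 := ⟨hUm.1.trans hy.1.le, hy.2.le.trans hVm.2⟩
  have h1 := S.iterate_mul_pow m k hy1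
  rw [hk] at h1
  refine S.iterate_c_scaled_ne h ?_ m _ h1
  rw [mem_Ioo, lt_inv_mul_iff₀ hpos, inv_mul_lt_iff₀ hpos]
  exact hy

/-- A rescaled iterate `τ ^ m f^[s]` with `s ≥ 1` maps no point of a homterval in `[0, 1]` into that
homterval. -/
theorem rescaledIterate_notMem (S : IsSelfSimilarUnimodal f c lo hi τ p)
    (h : IsHomterval f c lo hi u v) (hu : 0 ≤ u) (hv : v ≤ 1) {m s : ℕ} (hs : 1 ≤ s) {x : ℝ}
    (hx : x ∈ Ioo u v) : rescaledIterate f τ m s x ∉ Ioo u v := by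
  intro hsx
  obtain ⟨a, b, hab, hau, hvb⟩ := h.exists_maximal
  have huv := h.lt
  have hsub : Ioo u v ⊆ Ioo a b := Ioo_subset_Ioo hau hvb
  have hpos := pow_pos S.τ_pos m
  have hnot : ∀ i, f^[i] 0 ∉ Ioo a b := S.iterate_zero_notMem hab.toIsHomterval
  have ha0 : 0 ≤ a := by
    by_contra! hlt
    exact hnot 0 ⟨hlt, by simp only [Function.iterate_zero, id]; linarith⟩
  have hb1 : b ≤ 1 := by
    by_contra! hlt
    exact hnot 1 ⟨by simp only [Function.iterate_one, S.map_zero]; linarith,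
      by simpa only [Function.iterate_one, S.map_zero] using hlt⟩
  have ha : 0 < a := by
    refine lt_of_le_of_ne ha0 fun heq => ?_
    obtain ⟨n, hn⟩ := (S.tendsto_inv_pow.eventually_lt_const (heq ▸ hab.lt : (0 : ℝ) < b)).exists
    exact hnot (p ^ n) (by rw [S.iterate_pow_zero, ← heq]; exact ⟨S.inv_pow_pos n, hn⟩)
  have hb : b < 1 := by
    refine lt_of_le_of_ne hb1 fun heq => ?_
    have hlim := S.tendsto_iterate_add_pow_zero 1
    simp only [Function.iterate_one, S.map_zero] at hlim
    obtain ⟨n, hn⟩ := (hlim.eventually_const_lt (heq ▸ hab.lt : a < 1)).exists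
    have h1 : f^[p ^ n] 1 ≤ 1 := (S.iterate_unit ⟨zero_le_one, le_rfl⟩ _).2
    have h2 : f^[p ^ n + 1] 0 = f^[p ^ n] 1 := by rw [Function.iterate_succ_apply, S.map_zero]
    have h3 : f^[p ^ n] 1 ≠ 1 := by
      rw [← h2, add_comm]
      simpa [S.map_zero] using S.iterate_add_zero_ne 1 (S.one_le_pow_p n)
    exact hnot (p ^ n + 1) (by rw [h2, heq]; exact ⟨hn, lt_of_le_of_ne h1 h3⟩)
  obtain ⟨U, V, hUV, himg⟩ := S.exists_image_eq hab.toIsHomterval s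
  have hx' : f^[s] x ∈ Ioo U V := himg ▸ mem_image_of_mem _ (hsub hx)
  have hsx' := hsub hsx
  obtain ⟨hU, hV⟩ := S.homterval_subset hUV hx'
    (S.mul_mem_unit.1 ⟨(ha.trans hsx'.1).le, (hsx'.2.trans hb).le⟩)
  have hscaled := S.homterval_dilate hUV hU hV
  have hmax := hab.maximal _ _ hscaled ⟨τ ^ m * f^[s] x,
    ⟨mul_lt_mul_of_pos_left hx'.1 hpos, mul_lt_mul_of_pos_left hx'.2 hpos⟩, hsx'⟩
  refine S.not_mapsTo (S.returnTimes m) (S.returnTimes (2 * m)) hs hab (Or.inr ⟨ha, hb⟩) ?_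
  intro y hy
  have hy' : f^[s] y ∈ Ioo U V := himg ▸ mem_image_of_mem _ hy
  exact ⟨hmax.1.trans_lt (mul_lt_mul_of_pos_left hy'.1 hpos),
    (mul_lt_mul_of_pos_left hy'.2 hpos).trans_le hmax.2⟩

end IsSelfSimilarUnimodal

theorem exists_lt_abs_sub_lt {g : ℕ → ℝ} {l r η : ℝ} (hg : ∀ n, g n ∈ Icc l r) (hη : 0 < η) :
    ∃ i j, i < j ∧ |g i - g j| < η := by
  obtain ⟨x, -, φ, hφ, hlim⟩ := isCompact_Icc.tendsto_subseq hg
  obtain ⟨N, hN⟩ := Metric.cauchySeq_iff.1 hlim.cauchySeq η hη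
  exact ⟨φ N, φ (N + 1), hφ N.lt_succ_self, hN N le_rfl (N + 1) N.le_succ⟩

theorem exists_pos_le_of_pos (g : ℕ → ℝ) (N : ℕ) :
    ∃ δ > 0, ∀ q < N, 0 < g q → δ ≤ g q := by
  induction N with
  | zero => exact ⟨1, one_pos, by simp⟩
  | succ N ih =>
    obtain ⟨δ, hδ, h⟩ := ih
    by_cases hN : 0 < g N
    · refine ⟨min δ (g N), lt_min hδ hN, fun q hq hq0 => ?_⟩
      rcases Nat.lt_succ_iff_lt_or_eq.1 hq with hq | rfl
      · exact (min_le_left _ _).trans (h q hq hq0)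
      · exact min_le_right _ _
    · refine ⟨δ, hδ, fun q hq hq0 => ?_⟩
      rcases Nat.lt_succ_iff_lt_or_eq.1 hq with hq | rfl
      · exact h q hq hq0
      · exact absurd hq0 hN

namespace IsSelfSimilarUnimodal

/-! ### Monotone branches with definite space around their range -/

/-- The maximal interval around a homterval on which `f^[k]` is monotone. Its endpoints are
endpoints of `[lo, hi]` or are mapped to `c` before time `k`. -/
theorem exists_branch (S : IsSelfSimilarUnimodal f c lo hi τ p) (h : IsHomterval f c lo hi u v)
    (k : ℕ) : ∃ a b, lo ≤ a ∧ a ≤ u ∧ v ≤ b ∧ b ≤ hi ∧ (∀ j < k, ∀ x ∈ Ioo a b, f^[j] x ≠ c) ∧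
      (a = lo ∨ ∃ j < k, f^[j] a = c) ∧ (b = hi ∨ ∃ j < k, f^[j] b = c) := by
  induction k with
  | zero =>
    have := h.lt
    exact ⟨lo, hi, le_rfl, h.lo_le, h.le_hi, le_rfl, by simp, Or.inl rfl, Or.inl rfl⟩
  | succ k ih =>
    obtain ⟨a, b, hla, hau, hvb, hbh, hab, ha, hb⟩ := ih
    have ha' : a = lo ∨ ∃ j < k + 1, f^[j] a = c :=
      ha.imp id fun ⟨j, hj, h⟩ => ⟨j, by omega, h⟩
    have hb' : b = hi ∨ ∃ j < k + 1, f^[j] b = c :=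
      hb.imp id fun ⟨j, hj, h⟩ => ⟨j, by omega, h⟩
    by_cases hz : ∃ z ∈ Ioo a b, f^[k] z = c
    · obtain ⟨z, hz, hzc⟩ := hz
      have hinj : InjOn f^[k] (Icc a b) := by
        rcases (S.iterate_expansion hla hbh hab).1 with h | h
        · exact h.injOn
        · exact h.injOn
      have huniq : ∀ x ∈ Ioo a b, x ≠ z → ∀ j < k + 1, f^[j] x ≠ c := by
        intro x hx hxz j hj hjc
        rcases Nat.lt_succ_iff_lt_or_eq.1 hj with hj | rfl
        · exact hab j hj x hx hjc
        · exact hxz (hinj (Ioo_subset_Icc_self hx) (Ioo_subset_Icc_self hz) (hjc.trans hzc.symm))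
      rcases le_or_gt z u with hzu | hzu
      · exact ⟨z, b, hla.trans hz.1.le, hzu, hvb, hbh,
          fun j hj x hx => huniq x ⟨hz.1.trans hx.1, hx.2⟩ hx.1.ne' j hj,
          Or.inr ⟨k, k.lt_succ_self, hzc⟩, hb'⟩
      · have hvz : v ≤ z := by
          by_contra! hlt
          exact h.iterate_ne z ⟨hzu, hlt⟩ k hzc
        exact ⟨a, z, hla, hau, hvz, hz.2.le.trans hbh,
          fun j hj x hx => huniq x ⟨hx.1, hx.2.trans hz.2⟩ hx.2.ne j hj,
          ha', Or.inr ⟨k, k.lt_succ_self, hzc⟩⟩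
    · push Not at hz
      refine ⟨a, b, hla, hau, hvb, hbh, fun j hj x hx => ?_, ha', hb'⟩
      rcases Nat.lt_succ_iff_lt_or_eq.1 hj with hj | rfl
      · exact hab j hj x hx
      · exact hz x hx

/-- The point `e` bounds, on one side of `w`, the maximal interval of monotonicity of `f^[k]`
around `w`. -/
structure IsBranchEnd (f : ℝ → ℝ) (c lo hi : ℝ) (k : ℕ) (w e : ℝ) : Prop where
  mem : e ∈ Icc lo hi
  iterate_ne : ∀ j < k, ∀ z, (e < z ∧ z < w ∨ w < z ∧ z < e) → f^[j] z ≠ c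
  cases : e = lo ∨ e = hi ∨ ∃ j < k, f^[j] e = c

/-- If the endpoint images of the branch of `C f^[k]` around `w` are at distance at least `δ` from
the image of `w`, then the image of a homterval contains a ball around the image of `w` whose radius
depends only on `δ` and on the position of `w` in the homterval. -/
theorem image_contains_ball (S : IsSelfSimilarUnimodal f c lo hi τ p)
    (h : IsHomterval f c lo hi u v) {x w y δ C : ℝ} {k : ℕ} (hux : u < x) (hxw : x < w)
    (hwy : w < y) (hyv : y < v) (hδ : 0 < δ) (hC : 0 < C)
    (hend : ∀ e, IsBranchEnd f c lo hi k w e → δ ≤ |C * f^[k] e - C * f^[k] w|) {U V : ℝ}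
    (himg : f^[k] '' Ioo u v = Ioo U V) :
    C * U + min (w - x) (y - w) / (hi - lo) * δ / 4 ≤ C * f^[k] w ∧
      C * f^[k] w + min (w - x) (y - w) / (hi - lo) * δ / 4 ≤ C * V := by
  obtain ⟨a, b, hla, hau, hvb, hbh, hab, ha, hb⟩ := S.exists_branch h k
  have hlohi : 0 < hi - lo := by linarith [S.lo_lt_c, S.c_lt_hi]
  have hea : IsBranchEnd f c lo hi k w a := by
    refine ⟨⟨hla, by linarith⟩, fun j hj z hz => hab j hj z ?_, ha.imp id Or.inr⟩
    rcases hz with hz | hz <;> constructor <;> linarith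
  have heb : IsBranchEnd f c lo hi k w b := by
    refine ⟨⟨by linarith, hbh⟩, fun j hj z hz => hab j hj z ?_, Or.inr hb⟩
    rcases hz with hz | hz <;> constructor <;> linarith
  have hda := hend a hea
  have hdb := hend b heb
  obtain ⟨hmono, hcr⟩ := S.iterate_expansion hla hbh hab
  set F : ℝ → ℝ := fun z => C * f^[k] z with hF
  change δ ≤ |F a - F w| at hda
  change δ ≤ |F b - F w| at hdb
  have hFmono : StrictMonoOn F (Icc a b) ∨ StrictAntiOn F (Icc a b) :=
    hmono.imp (fun h s hs t ht hst => mul_lt_mul_of_pos_left (h hs ht hst) hC)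
      fun h s hs t ht hst => mul_lt_mul_of_pos_left (h hs ht hst) hC
  have hFcr : ∀ x y, a < x → x < y → y < b →
      crossRatio a x y b ≤ crossRatio (F a) (F x) (F y) (F b) := by
    intro x y h1 h2 h3
    rw [crossRatio_const_mul hC.ne']
    exact hcr a x y b le_rfl h1 h2 h3 le_rfl
  have ma : a ∈ Icc a b := ⟨le_rfl, by linarith⟩
  have mx : x ∈ Icc a b := ⟨by linarith, by linarith⟩
  have mw : w ∈ Icc a b := ⟨by linarith, by linarith⟩
  have my : y ∈ Icc a b := ⟨by linarith, by linarith⟩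
  have mb : b ∈ Icc a b := ⟨by linarith, le_rfl⟩
  have hord : ∀ s ∈ Icc a b, ∀ t ∈ Icc a b, ∀ q ∈ Icc a b, ∀ r ∈ Icc a b, s < t → t < q → q < r →
      (F s < F t ∧ F t < F q ∧ F q < F r) ∨ (F r < F q ∧ F q < F t ∧ F t < F s) := by
    intro s hs t ht q hq r hr h1 h2 h3
    rcases hFmono with h | h
    · exact Or.inl ⟨h hs ht h1, h ht hq h2, h hq hr h3⟩
    · exact Or.inr ⟨h hq hr h3, h ht hq h2, h hs ht h1⟩
  have hlower : ∀ t s r q : ℝ, 0 < t → 0 < s → 0 < r → 0 < q → s ≤ q → r ≤ hi - lo →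
      t / (hi - lo) ≤ t * q / (s * r) := by
    intro t s r q ht hs hr hq hsq hrl
    rw [div_le_div_iff₀ hlohi (mul_pos hs hr)]
    nlinarith [mul_le_mul hsq hrl hr.le hq.le]
  have h1 : (w - x) / (hi - lo) * δ / 4 ≤ |F w - F x| := by
    refine le_abs_sub_of_crossRatio (hord a ma x mx w mw b mb (by linarith) hxw (by linarith))
      ?_ (by rwa [abs_sub_comm]) hdb hδ ?_
    · rw [div_le_one hlohi]; linarith
    · refine le_trans ?_ (sub_le_sub_right (hFcr x w (by linarith) hxw (by linarith)) 1)
      rw [crossRatio_sub_one (by linarith) (by linarith)]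
      exact hlower _ _ _ _ (by linarith) (by linarith) (by linarith) (by linarith) (by linarith)
        (by linarith)
  have h2 : (y - w) / (hi - lo) * δ / 4 ≤ |F w - F y| := by
    refine le_abs_sub_of_crossRatio (A := F b) (B := F a)
      ((hord a ma w mw y my b mb (by linarith) hwy (by linarith)).symm.imp
        (fun h => ⟨h.1, h.2.1, h.2.2⟩) fun h => ⟨h.1, h.2.1, h.2.2⟩)
      ?_ (by rwa [abs_sub_comm]) hda hδ ?_
    · rw [div_le_one hlohi]; linarith
    · rw [crossRatio_reverse]
      refine le_trans ?_ (sub_le_sub_right (hFcr w y (by linarith) hwy (by linarith)) 1)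
      rw [crossRatio_sub_one (by linarith) (by linarith)]
      rw [mul_comm (w - a)]
      exact hlower _ _ _ _ (by linarith) (by linarith) (by linarith) (by linarith) (by linarith)
        (by linarith)
  have h1' : min (w - x) (y - w) / (hi - lo) * δ / 4 ≤ |F w - F x| := by
    refine le_trans ?_ h1
    have := div_le_div_of_nonneg_right (min_le_left (w - x) (y - w)) hlohi.le
    nlinarith
  have h2' : min (w - x) (y - w) / (hi - lo) * δ / 4 ≤ |F w - F y| := by
    refine le_trans ?_ h2
    have := div_le_div_of_nonneg_right (min_le_right (w - x) (y - w)) hlohi.le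
    nlinarith
  have hx : f^[k] x ∈ Ioo U V := himg ▸ mem_image_of_mem _ ⟨hux, by linarith⟩
  have hy : f^[k] y ∈ Ioo U V := himg ▸ mem_image_of_mem _ ⟨by linarith, hyv⟩
  have hx1 := mul_lt_mul_of_pos_left hx.1 hC
  have hx2 := mul_lt_mul_of_pos_left hx.2 hC
  have hy1 := mul_lt_mul_of_pos_left hy.1 hC
  have hy2 := mul_lt_mul_of_pos_left hy.2 hC
  change C * U < F x at hx1
  change F x < C * V at hx2
  change C * U < F y at hy1
  change F y < C * V at hy2
  change C * U + _ ≤ F w ∧ F w + _ ≤ C * V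
  rcases hFmono with hm | hm
  · have k1 := hm mx mw hxw
    have k2 := hm mw my hwy
    rw [abs_of_pos (by linarith)] at h1'
    rw [abs_of_neg (by linarith)] at h2'
    constructor <;> linarith
  · have k1 := hm mx mw hxw
    have k2 := hm mw my hwy
    rw [abs_of_neg (by linarith)] at h1'
    rw [abs_of_pos (by linarith)] at h2'
    constructor <;> linarith

/-- The image of a branch endpoint is `hi` or a point of the orbit of the critical value. -/
theorem iterate_branchEnd (S : IsSelfSimilarUnimodal f c lo hi τ p) {k : ℕ} (hk : 1 ≤ k) {w e : ℝ}
    (he : IsBranchEnd f c lo hi k w e) :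
    f^[k] e = hi ∨ ∃ j i, k = i + (j + 1) ∧ f^[j + 1] e = 0 ∧ f^[k] e = f^[i] 0 := by
  rcases he.cases with rfl | rfl | ⟨j, hj, hjc⟩
  · exact Or.inl (S.iterate_lo hk)
  · exact Or.inl (Function.iterate_fixed S.map_hi k)
  · have h0 : f^[j + 1] e = 0 := by rw [Function.iterate_succ_apply', hjc, S.map_c]
    refine Or.inr ⟨j, k - (j + 1), by omega, h0, ?_⟩
    rw [← h0, ← Function.iterate_add_apply, Nat.sub_add_cancel hj]

/-! ### Orbits that stay away from the critical value -/

theorem exists_uniform_iterate (S : IsSelfSimilarUnimodal f c lo hi τ p) {ε : ℝ} (hε : 0 < ε)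
    (N : ℕ) : ∃ δ > 0, ∀ j < N, ∀ x ∈ Icc lo hi, ∀ y ∈ Icc lo hi, |x - y| < δ →
      |f^[j] x - f^[j] y| < ε := by
  induction N with
  | zero => exact ⟨1, one_pos, by simp⟩
  | succ N ih =>
    obtain ⟨δ, hδ, h⟩ := ih
    have hu := isCompact_Icc.uniformContinuousOn_of_continuous
      (fun x (hx : x ∈ Icc lo hi) => (S.continuousAt_iterate hx N).continuousWithinAt)
    obtain ⟨δ', hδ', h'⟩ := Metric.uniformContinuousOn_iff.1 hu ε hε
    refine ⟨min δ δ', lt_min hδ hδ', fun j hj x hx y hy hxy => ?_⟩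
    rcases Nat.lt_succ_iff_lt_or_eq.1 hj with hj | rfl
    · exact h j hj x hx y hy (hxy.trans_le (min_le_left _ _))
    · exact h' x hx y hy (hxy.trans_le (min_le_right _ _))

/-- An orbit that never enters `[0, τ ^ (-n)]` stays at a definite distance from the whole orbit of
the critical value, each point of which enters a smaller interval after a bounded time. -/
theorem exists_le_abs_sub_iterate_zero (S : IsSelfSimilarUnimodal f c lo hi τ p) {w : ℝ}
    (hw : w ∈ Icc lo hi) {n : ℕ} (hn : ∀ k, 1 ≤ k → f^[k] w ∉ Icc 0 (τ ^ n)⁻¹) :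
    ∃ δ > 0, ∀ k, 1 ≤ k → ∀ i, δ ≤ |f^[i] 0 - f^[k] w| := by
  have hlt : (τ ^ (n + 1))⁻¹ < (τ ^ n)⁻¹ :=
    inv_strictAnti₀ (pow_pos S.τ_pos n) (pow_lt_pow_right₀ S.one_lt_τ n.lt_succ_self)
  set M := p ^ (n + 1) with hM
  have hM1 : 1 ≤ M := S.one_le_pow_p _
  obtain ⟨δ, hδ, h⟩ := S.exists_uniform_iterate (sub_pos.2 hlt) (M + 1)
  refine ⟨δ, hδ, fun k hk i => ?_⟩
  by_contra! hcon
  -- some iterate `f^[j]` with `j ≤ M` takes `f^[i] 0` into `[0, τ ^ (-(n + 1))]`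
  have hj : M - i % M < M + 1 := by omega
  have h1 := h (M - i % M) hj _ (S.iterate_mem S.zero_mem i) _ (S.iterate_mem hw k) hcon
  have hmod := Nat.mod_lt i hM1
  have hdiv := Nat.mod_add_div i M
  have hsum : M - i % M + i = (i / M + 1) * M := by
    have : (i / M + 1) * M = M * (i / M) + M := by ring
    omega
  have hI : f^[M - i % M] (f^[i] 0) ∈ Icc 0 (τ ^ (n + 1))⁻¹ := by
    rw [← Function.iterate_add_apply, hsum]
    exact S.iterate_mul_pow_mem _ ⟨le_rfl, (S.inv_pow_pos _).le⟩
  rw [← Function.iterate_add_apply] at hI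
  rw [← Function.iterate_add_apply, ← Function.iterate_add_apply, abs_lt] at h1
  refine hn (M - i % M + k) (by omega) ⟨S.iterate_nonneg hw (by omega), ?_⟩
  linarith [hI.2, h1.1]

/-- The fixed point `hi` is repelling, so an orbit that does not reach it leaves a neighbourhood of
it infinitely often. -/
theorem exists_frequently_le_sub (S : IsSelfSimilarUnimodal f c lo hi τ p) {w : ℝ}
    (hw : w ∈ Icc lo hi) (hne : ∀ k, f^[k] w ≠ hi) :
    ∃ δ > 0, ∃ᶠ k in atTop, δ ≤ |hi - f^[k] w| := by
  have hdf : HasDerivAt f (deriv f hi) hi :=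
    (S.analyticAt hi ⟨S.lo_lt_c.le.trans S.c_lt_hi.le, le_rfl⟩
      S.c_lt_hi.ne').differentiableAt.hasDerivAt
  obtain ⟨l, hl1, hl2⟩ := exists_between S.one_lt_deriv
  have hs := ((hasDerivAt_iff_tendsto_slope.1 hdf).eventually_const_lt hl2)
  rw [eventually_nhdsWithin_iff] at hs
  obtain ⟨δ, hδ, hball⟩ := Metric.eventually_nhds_iff.1 hs
  refine ⟨δ, hδ, ?_⟩
  by_contra hnot
  rw [not_frequently, eventually_atTop] at hnot
  obtain ⟨K, hK⟩ := hnot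
  have hlt : ∀ k, f^[k] w < hi := fun k => lt_of_le_of_ne (S.iterate_mem hw k).2 (hne k)
  have hstep : ∀ k ≥ K, l * (hi - f^[k] w) ≤ hi - f^[k + 1] w := by
    intro k hk
    have h1 := not_le.1 (hK k hk)
    have h2 := hball (y := f^[k] w) (by rwa [dist_comm, Real.dist_eq]) (hne k)
    rw [slope_def_field, S.map_hi, ← neg_div_neg_eq, neg_sub, neg_sub,
      lt_div_iff₀ (by linarith [hlt k])] at h2
    rw [Function.iterate_succ_apply']
    exact h2.le
  have hpow : ∀ n, l ^ n * (hi - f^[K] w) ≤ hi - f^[K + n] w := by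
    intro n
    induction n with
    | zero => simp
    | succ n ih =>
      rw [pow_succ', mul_assoc]
      exact (mul_le_mul_of_nonneg_left ih (by linarith)).trans (hstep (K + n) (by omega))
  have hpos : 0 < hi - f^[K] w := by linarith [hlt K]
  obtain ⟨n, hn⟩ := ((tendsto_pow_atTop_atTop_of_one_lt hl1).eventually_gt_atTop
    (δ / (hi - f^[K] w))).exists
  rw [div_lt_iff₀ hpos] at hn
  have h3 := not_le.1 (hK (K + n) (by omega))
  rw [abs_of_pos (by linarith [hlt (K + n)])] at h3
  linarith [hpow n]

/-- The orbit of a point of a homterval accumulates at the critical value. Otherwise it stays away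
from the orbit of the critical value and returns infinitely often to places with space around
them, where the images of the homterval have a definite size and have to overlap. -/
theorem exists_iterate_mem_of_homterval (S : IsSelfSimilarUnimodal f c lo hi τ p)
    (h : IsHomterval f c lo hi u v) {x w y : ℝ} (hux : u < x) (hxw : x < w) (hwy : w < y)
    (hyv : y < v) (n : ℕ) : ∃ k, 1 ≤ k ∧ f^[k] w ∈ Icc 0 (τ ^ n)⁻¹ := by
  by_contra! hn
  have hwJ : w ∈ Ioo u v := ⟨hux.trans hxw, hwy.trans hyv⟩
  have hw : w ∈ Icc lo hi := ⟨h.lo_le.trans hwJ.1.le, hwJ.2.le.trans h.le_hi⟩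
  have hlohi : 0 < hi - lo := by linarith [S.lo_lt_c, S.c_lt_hi]
  have hne : ∀ k, f^[k] w ≠ hi := by
    intro k hk
    obtain ⟨U, V, hUV, himg⟩ := S.exists_image_eq h k
    have hm : f^[k] w ∈ Ioo U V := himg ▸ mem_image_of_mem _ hwJ
    exact absurd hUV.le_hi (hk ▸ hm.2).not_ge
  obtain ⟨δ₁, hδ₁, h₁⟩ := S.exists_le_abs_sub_iterate_zero hw hn
  obtain ⟨δ₂, hδ₂, h₂⟩ := S.exists_frequently_le_sub hw hne
  obtain ⟨φ, hφ, hφ'⟩ := extraction_of_frequently_atTop (h₂.and_eventually (eventually_ge_atTop 1))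
  set δ := min δ₁ δ₂ with hδdef
  have hδ : 0 < δ := lt_min hδ₁ hδ₂
  set η := min (w - x) (y - w) / (hi - lo) * δ / 4 with hη
  have hηpos : 0 < η := by
    have : 0 < min (w - x) (y - w) := lt_min (by linarith) (by linarith)
    positivity
  obtain ⟨i, j, hij, hlt⟩ := exists_lt_abs_sub_lt (g := fun i => f^[φ i] w)
    (fun i => S.iterate_mem hw _) hηpos
  obtain ⟨U, V, hUV, himg⟩ := S.exists_image_eq h (φ i)
  have hball := S.image_contains_ball h hux hxw hwy hyv hδ one_pos (k := φ i) (fun e he => by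
    rw [one_mul, one_mul]
    rcases S.iterate_branchEnd (hφ' i).2 he with heq | ⟨_, q, -, -, heq⟩
    · rw [heq]; exact (min_le_right _ _).trans (hφ' i).1
    · rw [heq]; exact (min_le_left _ _).trans (h₁ _ (hφ' i).2 q)) himg
  rw [← hη, one_mul, one_mul, one_mul] at hball
  rw [abs_lt] at hlt
  refine S.iterate_notMem hUV (s := φ j - φ i) (by have := hφ hij; omega) (x := f^[φ i] w)
    (himg ▸ mem_image_of_mem _ hwJ) ?_
  rw [← Function.iterate_add_apply, Nat.sub_add_cancel (hφ hij).le]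
  constructor <;> linarith [hlt.1, hlt.2, hball.1, hball.2]

/-! ### Orbits that accumulate at the critical value -/

/-- The branch of the first entry map into `[0, τ ^ (-n)]` around a point `w` that does not enter
`[0, τ ^ (-n - 1)]` covers a definite neighbourhood of the image of `w`, relative to the size of the
interval. -/
theorem exists_entry_space (S : IsSelfSimilarUnimodal f c lo hi τ p) :
    ∃ δ > 0, ∀ (w : ℝ) (n k : ℕ), w ∈ Icc lo hi → 1 ≤ n → 1 ≤ k → f^[k] w ∈ Icc 0 (τ ^ n)⁻¹ →
      f^[k] w ∉ Icc 0 (τ ^ (n + 1))⁻¹ → (∀ j, 1 ≤ j → j < k → f^[j] w ∉ Icc 0 (τ ^ n)⁻¹) →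
      ∀ e, IsBranchEnd f c lo hi k w e → δ ≤ |τ ^ n * f^[k] e - τ ^ n * f^[k] w| := by
  have hτ := S.τ_pos
  have hτ1 := S.one_lt_τ
  obtain ⟨δ₃, hδ₃, h₃⟩ := exists_pos_le_of_pos (fun q => τ * f^[q] 0 - 1) p
  refine ⟨min (min (hi - 1) (τ - 1)) (min δ₃ τ⁻¹), lt_min (lt_min (by linarith [S.one_lt_hi])
    (by linarith)) (lt_min hδ₃ (inv_pos.2 hτ)), ?_⟩
  intro w n k hw hn hk hkI hkI' hfirst e he
  have hd1 : min (min (hi - 1) (τ - 1)) (min δ₃ τ⁻¹) ≤ hi - 1 :=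
    (min_le_left _ _).trans (min_le_left _ _)
  have hd2 : min (min (hi - 1) (τ - 1)) (min δ₃ τ⁻¹) ≤ τ - 1 :=
    (min_le_left _ _).trans (min_le_right _ _)
  have hd3 : min (min (hi - 1) (τ - 1)) (min δ₃ τ⁻¹) ≤ δ₃ :=
    (min_le_right _ _).trans (min_le_left _ _)
  have hd4 : min (min (hi - 1) (τ - 1)) (min δ₃ τ⁻¹) ≤ τ⁻¹ :=
    (min_le_right _ _).trans (min_le_right _ _)
  generalize min (min (hi - 1) (τ - 1)) (min δ₃ τ⁻¹) = δ at *
  have hτn := pow_pos hτ n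
  have hW := S.mul_mem_unit.2 hkI
  set W := τ ^ n * f^[k] w with hWdef
  have key : ∀ E : ℝ, δ ≤ E - 1 → δ ≤ |E - W| := fun E hE =>
    le_trans (by linarith [hW.2]) (le_abs_self _)
  rcases S.iterate_branchEnd hk he with heq | ⟨j, i, hji, hj0, heq⟩
  · rw [heq]
    refine key _ ?_
    have := le_mul_of_one_le_left S.hi_pos.le (one_le_pow₀ hτ1.le : 1 ≤ τ ^ n)
    linarith
  · rw [heq]
    rcases Nat.eq_zero_or_pos i with rfl | hi0
    · have h1 : (τ ^ (n + 1))⁻¹ < f^[k] w := by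
        by_contra! hle
        exact hkI' ⟨hkI.1, hle⟩
      have h2 : τ⁻¹ < W := by
        have := mul_lt_mul_of_pos_left h1 hτn
        rwa [pow_succ, mul_inv, mul_inv_cancel_left₀ hτn.ne'] at this
      simp only [Function.iterate_zero, id, mul_zero, zero_sub, abs_neg]
      exact le_trans (by linarith) (le_abs_self _)
    · have hyI := hfirst (j + 1) (by omega) (by omega)
      have hy : (τ ^ n)⁻¹ < f^[j + 1] w := by
        by_contra! hle
        exact hyI ⟨S.iterate_nonneg hw (by omega), hle⟩
      -- otherwise the branch would contain a preimage of the critical point `τ ^ (-n) c`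
      have hip : i < p ^ n := by
        by_contra! hle
        have hcn : (τ ^ n)⁻¹ * c ∈ uIcc (f^[j + 1] e) (f^[j + 1] w) := by
          rw [hj0]
          refine mem_uIcc.2 (Or.inl ⟨mul_nonneg (S.inv_pow_pos n).le S.c_pos.le, ?_⟩)
          exact (mul_le_of_le_one_right (S.inv_pow_pos n).le S.c_lt_one.le).trans hy.le
        have hsub : uIcc e w ⊆ Icc lo hi := ordConnected_Icc.uIcc_subset he.mem hw
        obtain ⟨z, hz, hzc⟩ := intermediate_value_uIcc (f := f^[j + 1]) (fun t ht =>
          (S.continuousAt_iterate (hsub ht) (j + 1)).continuousWithinAt) hcn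
        have hze : z ≠ e := by
          rintro rfl
          rw [hj0] at hzc
          exact (mul_pos (S.inv_pow_pos n) S.c_pos).ne hzc
        have hzw : z ≠ w := by
          rintro rfl
          rw [hzc] at hy
          exact absurd (mul_le_of_le_one_right (S.inv_pow_pos n).le S.c_lt_one.le) hy.not_ge
        have hzz : e < z ∧ z < w ∨ w < z ∧ z < e := by
          rcases mem_uIcc.1 hz with ⟨h1, h2⟩ | ⟨h1, h2⟩
          · exact Or.inl ⟨lt_of_le_of_ne h1 hze.symm, lt_of_le_of_ne h2 hzw⟩
          · exact Or.inr ⟨lt_of_le_of_ne h1 hzw.symm, lt_of_le_of_ne h2 hze⟩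
        refine he.iterate_ne (p ^ n - 1 + (j + 1)) (by
          have := S.one_le_pow_p n; omega) z hzz ?_
        rw [Function.iterate_add_apply, hzc, S.iterate_pow_sub_one]
      refine key _ ?_
      have h0n : (0 : ℝ) ∈ Icc 0 (τ ^ n)⁻¹ := ⟨le_rfl, (S.inv_pow_pos n).le⟩
      have hinonneg : 0 ≤ f^[i] 0 := S.iterate_nonneg S.zero_mem hi0
      have hiI : (τ ^ n)⁻¹ < f^[i] 0 := by
        by_contra! hle
        exact absurd (Nat.le_of_dvd hi0 (S.returnTimes n 0 h0n i ⟨hinonneg, hle⟩)) hip.not_ge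
      obtain ⟨n, rfl⟩ := Nat.exists_eq_succ_of_ne_zero (by omega : n ≠ 0)
      simp only [Nat.succ_eq_add_one] at *
      have hτn' := pow_pos hτ n
      rcases le_or_gt (f^[i] 0) (τ ^ n)⁻¹ with hle | hgt
      · obtain ⟨q, rfl⟩ := S.returnTimes n 0 ⟨le_rfl, (S.inv_pow_pos n).le⟩ i ⟨hinonneg, hle⟩
        have hqp : q < p := by
          rw [pow_succ] at hip
          exact lt_of_mul_lt_mul_left hip (Nat.zero_le _)
        have hval : τ ^ (n + 1) * f^[p ^ n * q] 0 = τ * f^[q] 0 := by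
          rw [mul_comm (p ^ n), S.iterate_mul_pow_zero, pow_succ, mul_right_comm,
            mul_inv_cancel_left₀ hτn'.ne', mul_comm]
        have hgt : 0 < τ * f^[q] 0 - 1 := by
          rw [inv_lt_iff_one_lt_mul₀ hτn, mul_comm, hval] at hiI
          linarith
        rw [hval]
        exact hd3.trans (h₃ q hqp hgt)
      · have h1 : τ < τ ^ (n + 1) * f^[i] 0 := by
          have := mul_lt_mul_of_pos_left hgt hτn
          rw [pow_succ, mul_right_comm, mul_inv_cancel₀ hτn'.ne', one_mul] at this
          rwa [pow_succ]
        linarith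

/-- There are no homtervals. A homterval would enter infinitely many of the intervals
`[0, τ ^ (-n)]` with a definite relative size, so two of its rescaled images would overlap. -/
theorem not_isHomterval (S : IsSelfSimilarUnimodal f c lo hi τ p) :
    ¬ IsHomterval f c lo hi u v := by
  intro h
  obtain ⟨w, huw, hwv⟩ := exists_between h.lt
  obtain ⟨x, hux, hxw⟩ := exists_between huw
  obtain ⟨y, hwy, hyv⟩ := exists_between hwv
  have hwJ : w ∈ Ioo u v := ⟨huw, hwv⟩
  have hw : w ∈ Icc lo hi := ⟨h.lo_le.trans hwJ.1.le, hwJ.2.le.trans h.le_hi⟩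
  have hlohi : 0 < hi - lo := by linarith [S.lo_lt_c, S.c_lt_hi]
  have hτ := S.τ_pos
  obtain ⟨δ, hδ, hspace⟩ := S.exists_entry_space
  -- infinitely many scales `n` at which the first entry of `w` is not an entry to the next scale
  have hscales : ∃ᶠ n in atTop, 1 ≤ n ∧ ∃ k, 1 ≤ k ∧ f^[k] w ∈ Icc 0 (τ ^ n)⁻¹ ∧
      f^[k] w ∉ Icc 0 (τ ^ (n + 1))⁻¹ ∧
      ∀ j, 1 ≤ j → j < k → f^[j] w ∉ Icc 0 (τ ^ n)⁻¹ := by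
    rw [frequently_atTop]
    intro n₀
    have hex := S.exists_iterate_mem_of_homterval h hux hxw hwy hyv (n₀ + 1)
    obtain ⟨hk1, hkI⟩ := Nat.find_spec hex
    have hmin := fun j (hj : j < Nat.find hex) => Nat.find_min hex hj
    set k := Nat.find hex
    have hpos : 0 < f^[k] w := by
      refine lt_of_le_of_ne hkI.1 fun heq => ?_
      obtain ⟨k', hk'⟩ := Nat.exists_eq_succ_of_ne_zero (by omega : k ≠ 0)
      rw [hk', Function.iterate_succ_apply'] at heq
      exact h.iterate_ne w hwJ k' (S.eq_c_of_map_eq_zero (S.iterate_mem hw k') heq.symm)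
    have hex' : ∃ N, (τ ^ N)⁻¹ < f^[k] w := (S.tendsto_inv_pow.eventually_lt_const hpos).exists
    have hN := Nat.find_spec hex'
    have hNmin := fun j (hj : j < Nat.find hex') => Nat.find_min hex' hj
    set N := Nat.find hex'
    have hNn : n₀ + 1 < N := by
      by_contra! hle
      exact absurd (hN.trans_le hkI.2) (S.inv_pow_le hle).not_gt
    refine ⟨N - 1, by omega, by omega, k, hk1, ⟨hpos.le, not_lt.1 (hNmin _ (by omega))⟩, ?_, ?_⟩
    · rw [Nat.sub_add_cancel (by omega : 1 ≤ N)]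
      exact fun hmem => absurd hmem.2 hN.not_ge
    · intro j hj1 hjk hmem
      exact hmin j hjk ⟨hj1, hmem.1, hmem.2.trans (S.inv_pow_le (by omega))⟩
  obtain ⟨φ, hφ, hφ'⟩ := extraction_of_frequently_atTop hscales
  choose hφ1 k hk1 hkI hkI' hfirst using hφ'
  set η := min (w - x) (y - w) / (hi - lo) * δ / 4 with hη
  have hηpos : 0 < η := by
    have : 0 < min (w - x) (y - w) := lt_min (by linarith) (by linarith)
    positivity
  obtain ⟨i, j, hij, hlt⟩ := exists_lt_abs_sub_lt (g := fun i => τ ^ φ i * f^[k i] w)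
    (fun i => S.mul_mem_unit.2 (hkI i)) hηpos
  have hφij := hφ hij
  have hpos := pow_pos hτ (φ i)
  obtain ⟨U, V, hUV, himg⟩ := S.exists_image_eq h (k i)
  have hmem : f^[k i] w ∈ Ioo U V := himg ▸ mem_image_of_mem _ hwJ
  have hball := S.image_contains_ball h hux hxw hwy hyv hδ hpos
    (hspace w (φ i) (k i) hw (hφ1 i) (hk1 i) (hkI i) (hkI' i) (hfirst i)) himg
  rw [← hη] at hball
  obtain ⟨hU, hV⟩ := S.homterval_subset hUV hmem (hkI i)
  have hdil := S.homterval_dilate hUV hU hV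
  have hjI : f^[k j] w ∈ Icc 0 (τ ^ φ i)⁻¹ := ⟨(hkI j).1, (hkI j).2.trans (S.inv_pow_le hφij.le)⟩
  have hkle : k i ≤ k j := by
    by_contra! hlt'
    exact hfirst i (k j) (hk1 j) hlt' hjI
  have hkne : k i ≠ k j := by
    intro heq
    refine hkI' i ?_
    rw [heq]
    exact ⟨(hkI j).1, (hkI j).2.trans (S.inv_pow_le hφij)⟩
  have hsplit : f^[k j - k i] (f^[k i] w) = f^[k j] w := by
    rw [← Function.iterate_add_apply, Nat.sub_add_cancel hkle]
  obtain ⟨q, hq⟩ := S.returnTimes (φ i) _ (hkI i) (k j - k i) (by rw [hsplit]; exact hjI)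
  have hq1 : 1 ≤ q := by
    rw [Nat.one_le_iff_ne_zero]
    rintro rfl
    omega
  -- the two rescaled images of `w` are related by a rescaled iterate
  have hrel : rescaledIterate f τ (φ j - φ i) q (τ ^ φ i * f^[k i] w) = τ ^ φ j * f^[k j] w := by
    have h1 := S.iterate_mul_pow' q (hkI i)
    rw [mul_comm q, ← hq, hsplit] at h1
    rw [rescaledIterate, h1, ← mul_assoc, ← div_eq_mul_inv, pow_sub₀ _ hτ.ne' hφij.le,
      div_eq_mul_inv]
  rw [abs_lt] at hlt
  refine S.rescaledIterate_notMem hdil (mul_nonneg hpos.le hU) ?_ hq1 (m := φ j - φ i)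
    (x := τ ^ φ i * f^[k i] w)
    ⟨mul_lt_mul_of_pos_left hmem.1 hpos, mul_lt_mul_of_pos_left hmem.2 hpos⟩ ?_
  · exact (S.mul_mem_unit.2 ⟨hU.trans hUV.lt.le, hV⟩).2
  · rw [hrel]
    constructor <;> linarith [hlt.1, hlt.2, hball.1, hball.2]

end IsSelfSimilarUnimodal

end Dynamics

theorem proposition3 {p : ℕ} (A : CombinatorialType p) (H : ℝ → ℝ) (S : EckmannWittwer A H) :
    ¬ ∃ J : Set ℝ, IsWanderingInterval H S.x₀ (Icc S.b₀' S.b₀) J := by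
  rintro ⟨J, hJ⟩
  obtain ⟨u, hu, v, hv, huv⟩ := hJ.nontrivial.exists_lt
  refine S.isSelfSimilarUnimodal.not_isHomterval (u := u) (v := v)
    ⟨(hJ.subset hu).1, huv, (hJ.subset hv).2, fun x hx k hk => ?_⟩
  exact hJ.avoids k ⟨x, hJ.ordConnected.out hu hv (Ioo_subset_Icc_self hx), hk⟩
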